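/- Let $L>0$ and let $X_0=[L^2_{\mathbb C}(0,L)]^2$ be equipped with the scalar product $\big((\theta,u),(\varphi,\omega)\big)=\int_0^L(\theta\overline{\varphi}+u\overline{\omega})\,dx$. Let $A$ be the unbounded operator in $X_0$ given by $$A(\eta,w)=(-w'-w''',\,-\eta'-\eta'''),\qquad D(A)=\{(\eta,w)\in[H^3(0,L)\cap H^1_0(0,L)]^2:\ \eta'(0)=w'(L)=0\}.$$ Consider orthonormal (Hilbert) bases $\{(\theta_n^+,u_n^+)\}_{n\in\mathbb Z}\cup\{(\theta_n^-,u_n^-)\}_{n\in\mathbb Z}$ of $X_0$ composed of eigenfunctions of $A$, with $$A(\theta_n^\pm,u_n^\pm)=\pm i\lambda_n(\theta_n^\pm,u_n^\pm),\qquad \lambda_n\in\mathbb R,\ n\in\mathbb Z,$$ labelled in such a way that, for some $k_1,k_2\in\mathbb Z$, $$\lambda_n=\Big(\frac{\pi+12\pi(k_1+n)}{6L}\Big)^3+O(n)\ \ (n\to+\infty),\qquad \lambda_n=-\Big(\frac{7\pi+12\pi(k_2-n)}{6L}\Big)^3+O(n)\ \ (n\to-\infty).$$ Such a basis exists. Moreover,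 there are positive constants $C_1^+,C_1^-,C_2^+,C_2^-$ (depending only on $L$) such that for every such basis $$\lim_{|n|\to\infty}\frac{|\theta^{\pm}_{n,x}(L)|}{|n|}=C_1^{\pm}\qquad\text{and}\qquad \lim_{|n|\to\infty}\frac{|u^{\pm}_{n,x}(0)|}{|n|}=C_2^{\pm},$$ where the subscript $x$ denotes the derivative in $x$, evaluated through its continuous representative on $[0,L]$. -/

import Mathlib

open MeasureTheory Filter Topology
open scoped ContDiff

noncomputable section

namespace KdVKdV

/-- `L²_ℂ(0,L)`. -/
abbrev L2 (L : ℝ) : Type := Lp ℂ 2 ((volume : Measure ℝ).restrict (Set.Ioo 0 L))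

/-- The complex Hilbert space `X₀ = [L²_ℂ(0,L)]²` with the norm `‖(θ,u)‖² = ‖θ‖² + ‖u‖²`. -/
abbrev X0 (L : ℝ) : Type := WithLp 2 (L2 L × L2 L)

/-- `g` is the weak derivative of `f` on `(0,L)`:
`∫₀ᴸ φ' f = - ∫₀ᴸ φ g` for every `φ ∈ C_c^∞(0,L)`. -/
def HasWeakDeriv (L : ℝ) (f g : L2 L) : Prop :=
  ∀ φ : ℝ → ℝ, ContDiff ℝ ∞ φ → HasCompactSupport φ → tsupport φ ⊆ Set.Ioo 0 L →
    ∫ x in Set.Ioo 0 L, deriv φ x • f x = -∫ x in Set.Ioo 0 L, φ x • g x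

/-- `f ∈ H^k(0,L)`: `f` has weak derivatives in `L²(0,L)` up to order `k`. -/
def MemSobolev (L : ℝ) : ℕ → L2 L → Prop
  | 0, _ => True
  | k + 1, f => ∃ g, HasWeakDeriv L f g ∧ MemSobolev L k g

open Classical in
/-- The weak derivative of `f` (and `0` if there is none). -/
def weakDeriv (L : ℝ) (f : L2 L) : L2 L :=
  if h : ∃ g, HasWeakDeriv L f g then h.choose else 0

/-- `f` has a representative that is continuous on `[0,L]`, with value `c` at `a`. -/
def HasTrace (L : ℝ) (f : L2 L) (a : ℝ) (c : ℂ) : Prop :=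
  ∃ F : ℝ → ℂ, ContinuousOn F (Set.Icc 0 L) ∧
    f =ᵐ[(volume : Measure ℝ).restrict (Set.Ioo 0 L)] F ∧ F a = c

open Classical in
/-- The value `f(a)` at `a ∈ [0,L]` of the continuous representative of `f`
(and `0` if there is none). -/
def trace (L : ℝ) (f : L2 L) (a : ℝ) : ℂ :=
  if h : ∃ c, HasTrace L f a c then h.choose else 0

theorem integrable_smul {L : ℝ} (φ : ℝ → ℝ) (hφ : Continuous φ) (hc : HasCompactSupport φ)
    (f : L2 L) :
    Integrable (fun x => φ x • f x) ((volume : Measure ℝ).restrict (Set.Ioo 0 L)) := by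
  have hf : Integrable (f : ℝ → ℂ) ((volume : Measure ℝ).restrict (Set.Ioo 0 L)) :=
    (Lp.memLp f).integrable (by norm_num)
  obtain ⟨C, hC⟩ := hc.exists_bound_of_continuous hφ
  exact hf.bdd_smul C hφ.aestronglyMeasurable (Eventually.of_forall hC)

theorem HasWeakDeriv.unique {L : ℝ} {f g₁ g₂ : L2 L} (h₁ : HasWeakDeriv L f g₁)
    (h₂ : HasWeakDeriv L f g₂) : g₁ = g₂ := by
  have hi : ∀ g : L2 L, IntegrableOn (g : ℝ → ℂ) (Set.Ioo 0 L) volume := fun g =>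
    (Lp.memLp g).integrable (by norm_num)
  have key : ∀ᵐ x ∂(volume : Measure ℝ), x ∈ Set.Ioo 0 L → g₁ x - g₂ x = 0 := by
    refine isOpen_Ioo.ae_eq_zero_of_integral_contDiff_smul_eq_zero
      (((hi g₁).sub (hi g₂)).locallyIntegrableOn) ?_
    intro φ hφ hc hs
    have e : ∫ x, φ x • (g₁ x - g₂ x) = ∫ x in Set.Ioo 0 L, φ x • (g₁ x - g₂ x) := by
      symm
      apply setIntegral_eq_integral_of_forall_compl_eq_zero
      intro x hx
      have : φ x = 0 := by
        by_contra h
        exact hx (hs (subset_tsupport φ h))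
      simp [this]
    rw [e]
    simp only [smul_sub]
    rw [integral_sub (integrable_smul φ hφ.continuous hc g₁)
      (integrable_smul φ hφ.continuous hc g₂)]
    have := (h₁ φ hφ hc hs).symm.trans (h₂ φ hφ hc hs)
    rw [neg_inj.mp this, sub_self]
  apply Lp.ext
  rw [Filter.EventuallyEq, ae_restrict_iff' measurableSet_Ioo]
  filter_upwards [key] with x hx hx'
  exact sub_eq_zero.mp (hx hx')

theorem HasWeakDeriv.weakDeriv_eq {L : ℝ} {f g : L2 L} (h : HasWeakDeriv L f g) :
    weakDeriv L f = g := by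
  have hex : ∃ g, HasWeakDeriv L f g := ⟨g, h⟩
  rw [weakDeriv, dif_pos hex]
  exact hex.choose_spec.unique h

theorem HasWeakDeriv.add {L : ℝ} {f₁ f₂ g₁ g₂ : L2 L} (h₁ : HasWeakDeriv L f₁ g₁)
    (h₂ : HasWeakDeriv L f₂ g₂) : HasWeakDeriv L (f₁ + f₂) (g₁ + g₂) := by
  intro φ hφ hc hs
  have hd : Continuous (deriv φ) := hφ.continuous_deriv (by simp)
  have e : ∀ (ψ : ℝ → ℝ) (a b : L2 L), Continuous ψ → HasCompactSupport ψ →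
      ∫ x in Set.Ioo 0 L, ψ x • (a + b : L2 L) x =
        (∫ x in Set.Ioo 0 L, ψ x • a x) + ∫ x in Set.Ioo 0 L, ψ x • b x := by
    intro ψ a b h1 h2
    rw [← integral_add (integrable_smul ψ h1 h2 a) (integrable_smul ψ h1 h2 b)]
    apply integral_congr_ae
    filter_upwards [Lp.coeFn_add a b] with x hx
    rw [hx, Pi.add_apply, smul_add]
  rw [e _ _ _ hd hc.deriv, e _ _ _ hφ.continuous hc, h₁ φ hφ hc hs, h₂ φ hφ hc hs, neg_add]

theorem HasWeakDeriv.smul {L : ℝ} {f g : L2 L} (c : ℂ) (h : HasWeakDeriv L f g) :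
    HasWeakDeriv L (c • f) (c • g) := by
  intro φ hφ hc hs
  have e : ∀ (ψ : ℝ → ℝ) (a : L2 L),
      ∫ x in Set.Ioo 0 L, ψ x • (c • a : L2 L) x = c • ∫ x in Set.Ioo 0 L, ψ x • a x := by
    intro ψ a
    rw [← integral_smul]
    apply integral_congr_ae
    filter_upwards [Lp.coeFn_smul c a] with x hx
    rw [hx, Pi.smul_apply, smul_comm]
  rw [e, e, h φ hφ hc hs, smul_neg]

theorem hasWeakDeriv_zero (L : ℝ) : HasWeakDeriv L 0 0 := by
  simpa using HasWeakDeriv.smul (L := L) (f := 0) (g := 0) 0 (by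
    intro φ _ _ _
    have e : ∀ (ψ : ℝ → ℝ), ∫ x in Set.Ioo 0 L, ψ x • (0 : L2 L) x = 0 := by
      intro ψ
      apply integral_eq_zero_of_ae
      filter_upwards [Lp.coeFn_zero ℂ 2 ((volume : Measure ℝ).restrict (Set.Ioo 0 L))] with x hx
      exact (congrArg (ψ x • ·) hx).trans (smul_zero _)
    rw [e, e, neg_zero])

theorem MemSobolev.zero (L : ℝ) : ∀ k, MemSobolev L k 0
  | 0 => trivial
  | k + 1 => ⟨0, hasWeakDeriv_zero L, MemSobolev.zero L k⟩

theorem MemSobolev.add {L : ℝ} : ∀ {k : ℕ} {f g : L2 L},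
    MemSobolev L k f → MemSobolev L k g → MemSobolev L k (f + g)
  | 0, _, _, _, _ => trivial
  | _ + 1, _, _, ⟨_, hf, hf'⟩, ⟨_, hg, hg'⟩ => ⟨_, hf.add hg, MemSobolev.add hf' hg'⟩

theorem MemSobolev.smul {L : ℝ} (c : ℂ) : ∀ {k : ℕ} {f : L2 L},
    MemSobolev L k f → MemSobolev L k (c • f)
  | 0, _, _ => trivial
  | _ + 1, _, ⟨_, hf, hf'⟩ => ⟨_, hf.smul c, MemSobolev.smul c hf'⟩

theorem MemSobolev.weakDeriv {L : ℝ} {k : ℕ} {f : L2 L} (h : MemSobolev L (k + 1) f) :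
    MemSobolev L k (weakDeriv L f) := by
  obtain ⟨g, hg, hk⟩ := h
  rwa [hg.weakDeriv_eq]

theorem MemSobolev.weakDeriv_add {L : ℝ} {k : ℕ} {f g : L2 L} (hf : MemSobolev L (k + 1) f)
    (hg : MemSobolev L (k + 1) g) :
    KdVKdV.weakDeriv L (f + g) = KdVKdV.weakDeriv L f + KdVKdV.weakDeriv L g := by
  obtain ⟨_, hf, _⟩ := hf
  obtain ⟨_, hg, _⟩ := hg
  rw [(hf.add hg).weakDeriv_eq, hf.weakDeriv_eq, hg.weakDeriv_eq]

theorem MemSobolev.weakDeriv_smul {L : ℝ} {k : ℕ} {f : L2 L} (c : ℂ)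
    (hf : MemSobolev L (k + 1) f) :
    KdVKdV.weakDeriv L (c • f) = c • KdVKdV.weakDeriv L f := by
  obtain ⟨_, hf, _⟩ := hf
  rw [(hf.smul c).weakDeriv_eq, hf.weakDeriv_eq]

theorem HasTrace.unique {L : ℝ} (hL : 0 < L) {f : L2 L} {a : ℝ} {c d : ℂ}
    (ha : a ∈ Set.Icc 0 L) (hc : HasTrace L f a c) (hd : HasTrace L f a d) : c = d := by
  obtain ⟨F, hF, hfF, rfl⟩ := hc
  obtain ⟨G, hG, hfG, rfl⟩ := hd
  refine Measure.eqOn_Icc_of_ae_eq volume hL.ne ?_ hF hG ha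
  rw [← Measure.restrict_congr_set (Ioo_ae_eq_Icc (μ := (volume : Measure ℝ)))]
  exact hfF.symm.trans hfG

theorem HasTrace.trace_eq {L : ℝ} (hL : 0 < L) {f : L2 L} {a : ℝ} {c : ℂ}
    (ha : a ∈ Set.Icc 0 L) (hc : HasTrace L f a c) : trace L f a = c := by
  have hex : ∃ c, HasTrace L f a c := ⟨c, hc⟩
  rw [trace, dif_pos hex]
  exact hex.choose_spec.unique hL ha hc

theorem HasTrace.zero (L a : ℝ) : HasTrace L 0 a 0 :=
  ⟨fun _ => 0, continuousOn_const, Lp.coeFn_zero _ _ _, rfl⟩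

theorem HasTrace.add {L : ℝ} {f g : L2 L} {a : ℝ} {c d : ℂ}
    (hc : HasTrace L f a c) (hd : HasTrace L g a d) : HasTrace L (f + g) a (c + d) := by
  obtain ⟨F, hF, hfF, rfl⟩ := hc
  obtain ⟨G, hG, hgG, rfl⟩ := hd
  refine ⟨fun x => F x + G x, hF.add hG, ?_, rfl⟩
  filter_upwards [Lp.coeFn_add f g, hfF, hgG] with x h1 h2 h3
  rw [h1, Pi.add_apply, h2, h3]

theorem HasTrace.smul {L : ℝ} {f : L2 L} {a : ℝ} {c : ℂ} (k : ℂ)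
    (hc : HasTrace L f a c) : HasTrace L (k • f) a (k * c) := by
  obtain ⟨F, hF, hfF, rfl⟩ := hc
  refine ⟨fun x => k * F x, continuousOn_const.mul hF, ?_, rfl⟩
  filter_upwards [Lp.coeFn_smul k f, hfF] with x h1 h2
  rw [h1, Pi.smul_apply, h2, smul_eq_mul]

/-- The component space `{f ∈ H³(0,L) ∩ H¹₀(0,L) : f'(a) = 0}`, where membership in `H¹₀(0,L)` is
the vanishing of the (continuous representative of the) function at `0` and `L`. -/
def compDomain (L a : ℝ) : Submodule ℂ (L2 L) where
  carrier := {f | MemSobolev L 3 f ∧ HasTrace L f 0 0 ∧ HasTrace L f L 0 ∧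
    HasTrace L (weakDeriv L f) a 0}
  zero_mem' := ⟨MemSobolev.zero L 3, HasTrace.zero L 0, HasTrace.zero L L, by
    rw [(hasWeakDeriv_zero L).weakDeriv_eq]; exact HasTrace.zero L a⟩
  add_mem' := by
    rintro f g ⟨hf, hf0, hfL, hf'⟩ ⟨hg, hg0, hgL, hg'⟩
    refine ⟨hf.add hg, by simpa using hf0.add hg0, by simpa using hfL.add hgL, ?_⟩
    rw [hf.weakDeriv_add hg]
    simpa using hf'.add hg'
  smul_mem' := by
    rintro c f ⟨hf, hf0, hfL, hf'⟩
    refine ⟨hf.smul c, by simpa using hf0.smul c, by simpa using hfL.smul c, ?_⟩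
    rw [hf.weakDeriv_smul c]
    simpa using hf'.smul c

/-- `f ↦ -f' - f'''`. -/
def minusD (L : ℝ) (f : L2 L) : L2 L :=
  -weakDeriv L f - weakDeriv L (weakDeriv L (weakDeriv L f))

theorem minusD_add {L : ℝ} {f g : L2 L} (hf : MemSobolev L 3 f) (hg : MemSobolev L 3 g) :
    minusD L (f + g) = minusD L f + minusD L g := by
  simp only [minusD]
  rw [hf.weakDeriv_add hg, hf.weakDeriv.weakDeriv_add hg.weakDeriv,
    hf.weakDeriv.weakDeriv.weakDeriv_add hg.weakDeriv.weakDeriv]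
  abel

theorem minusD_smul {L : ℝ} {f : L2 L} (c : ℂ) (hf : MemSobolev L 3 f) :
    minusD L (c • f) = c • minusD L f := by
  simp only [minusD]
  rw [hf.weakDeriv_smul c, hf.weakDeriv.weakDeriv_smul c,
    hf.weakDeriv.weakDeriv.weakDeriv_smul c, smul_sub, smul_neg]

/-- The unbounded operator `A(η,w) = (-w' - w''', -η' - η''')` in `X₀`, with domain
`D(A) = {(η,w) ∈ [H³(0,L) ∩ H¹₀(0,L)]² : η'(0) = w'(L) = 0}`. -/
def opA (L : ℝ) : X0 L →ₗ.[ℂ] X0 L where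
  domain :=
    { carrier := {p | p.fst ∈ compDomain L 0 ∧ p.snd ∈ compDomain L L}
      zero_mem' := ⟨zero_mem _, zero_mem _⟩
      add_mem' := fun h k => ⟨add_mem h.1 k.1, add_mem h.2 k.2⟩
      smul_mem' := fun c _ h =>
        ⟨(compDomain L 0).smul_mem c h.1, (compDomain L L).smul_mem c h.2⟩ }
  toFun :=
    { toFun := fun p => WithLp.toLp 2 (minusD L p.1.snd, minusD L p.1.fst)
      map_add' := by
        rintro ⟨p, hp⟩ ⟨q, hq⟩
        apply WithLp.ofLp_injective 2
        exact Prod.ext (minusD_add hp.2.1 hq.2.1) (minusD_add hp.1.1 hq.1.1)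
      map_smul' := by
        rintro c ⟨p, hp⟩
        apply WithLp.ofLp_injective 2
        exact Prod.ext (minusD_smul c hp.2.1) (minusD_smul c hp.1.1) }

/-- `e ∈ D(A)` and `A e = μ e`. -/
def IsEigenvectorA (L : ℝ) (μ : ℂ) (e : X0 L) : Prop :=
  ∃ h : e ∈ (opA L).domain, opA L ⟨e, h⟩ = μ • e

/-- The numbers `λ_n` have the asymptotic forms
`λ_n = ((π + 12π(k₁+n))/(6L))³ + O(n)` as `n → +∞` and
`λ_n = -((7π + 12π(k₂-n))/(6L))³ + O(n)` as `n → -∞`, for some integers `k₁, k₂`. -/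
def HasSpectralAsymptotics (L : ℝ) (lam : ℤ → ℝ) : Prop :=
  ∃ k₁ k₂ : ℤ,
    ((fun n : ℤ => lam n - ((Real.pi + 12 * Real.pi * (k₁ + n)) / (6 * L)) ^ 3)
      =O[atTop] fun n : ℤ => (n : ℝ)) ∧
    ((fun n : ℤ => lam n - -((7 * Real.pi + 12 * Real.pi * (k₂ - n)) / (6 * L)) ^ 3)
      =O[atBot] fun n : ℤ => (n : ℝ))

/-- The Hilbert basis `(e_n^+)_{n ∈ ℤ} ∪ (e_n^-)_{n ∈ ℤ}` of `X₀`, where `e_n^+ = b (inl n)` and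
`e_n^- = b (inr n)`, consists of eigenfunctions of `A`: `A e_n^± = ± i λ_n e_n^±`, labelled by
`n ∈ ℤ` so that the `λ_n` have the asymptotic forms above. -/
structure IsEigenbasis (L : ℝ) (lam : ℤ → ℝ) (b : HilbertBasis (ℤ ⊕ ℤ) ℂ (X0 L)) : Prop where
  eigen_pos : ∀ n, IsEigenvectorA L (Complex.I * lam n) (b (Sum.inl n))
  eigen_neg : ∀ n, IsEigenvectorA L (-(Complex.I * lam n)) (b (Sum.inr n))
  asymp : HasSpectralAsymptotics L lam

end KdVKdV

end

open MeasureTheory Filter Topology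
open scoped ContDiff

noncomputable section

namespace KdVKdV

/-! ### Integration by parts as a Fubini identity -/

section IntegrationByParts

/-! The reflection `f ↦ f(L - ·)` exchanges the boundary conditions of the two components and
anticommutes with `-d/dx - d³/dx³`. So `A` reduces to the scalar operator `B f = (f' + f''')(L - ·)`
on `compDomain L 0`, which is symmetric (`inner_refl_minusD`). A pair `(f, ± i f(L - ·))` with `B f
= λ f` is an eigenvector of `A` for `± iλ`. Conversely an eigenvector of `A` for `iλ` is a sum of
two such pairs, coming from the eigenvalues `λ` and `-λ` of `B` (`IsEigenvectorA.exists_split`).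

Put `λ = ξ³ - ξ`. If `F''' + F' = λ F(L - ·)`, then `p = F + i F(L - ·)` solves `p''' + p' = -iλ p`,
whose characteristic roots are `iξ` and `-iξ/2 ± β` with `β² = 3ξ²/4 - 1`. Hence `F` combines one
oscillating mode and two boundary layers. Vanishing at both ends leaves a multiple of `eta`, and
`F'(0) = 0` becomes `charH L ξ = 0`.

As `ξ → ±∞`, `charH` is a small perturbation of a sine: `2 sin(Lξ/2 - π/12)` for `ξ > 0`, `2
sin(L|ξ|/2 + 5π/12)` for `ξ < 0`. This gives one zero per half period, located up to `O(1/n)`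
(`exists_roots`), whence `λ` up to `O(n)`. The two sines are a quarter period apart, so `λ` and `-λ`
are not both eigenvalues of `B` when `|λ|` is large, and the eigenvectors of `A` are single pairs.

For the boundary derivatives, `charH² + charD² → 4` (`tendsto_charH_sq_add`), where `F'(L) = β
charD`. At a zero of `charH` this gives `|F'(L)| ~ 2β ~ √3 |ξ|`, while `‖eta‖ → √(L/2)`; since `|ξ|
~ 2π|n|/L`, the limits follow with the same constant in all four cases.

Existence of the basis: modulo its kernel, `B` has a compact symmetric inverse
(`exists_green_operator`), so it has an orthonormal eigenbasis (`exists_eigenbasis`). Its large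
eigenvalues are simple and are enumerated by the zeros of `charH`; the finitely many others fill the
gap in the labelling by `ℤ`. -/

theorem integral_mul_setIntegral_Iic_add {μ : Measure ℝ} [IsFiniteMeasure μ] [NullSingletonClass μ]
    {f g : ℝ → ℂ} (hf : Integrable f μ) (hg : Integrable g μ) :
    (∫ x, f x * (∫ t in Set.Iic x, g t ∂μ) ∂μ) + ∫ x, (∫ t in Set.Iic x, f t ∂μ) * g x ∂μ =
      (∫ x, f x ∂μ) * ∫ x, g x ∂μ := by
  have hfg : Integrable (fun z : ℝ × ℝ => f z.1 * g z.2) (μ.prod μ) := hf.mul_prod hg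
  -- The two terms are the integrals of the product over the triangle below the diagonal and over
  -- its complement. The complement has open slices, which is harmless because points are null.
  have hS : MeasurableSet {z : ℝ × ℝ | z.2 ≤ z.1} := measurableSet_le measurable_snd measurable_fst
  have h1 : ∫ x, f x * (∫ t in Set.Iic x, g t ∂μ) ∂μ =
      ∫ z in {z : ℝ × ℝ | z.2 ≤ z.1}, f z.1 * g z.2 ∂(μ.prod μ) := by
    rw [← integral_indicator hS, integral_prod _ (hfg.indicator hS)]
    refine integral_congr_ae (Eventually.of_forall fun x => ?_)
    simp only
    rw [← integral_const_mul, ← integral_indicator measurableSet_Iic]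
    rfl
  have h2 : ∫ x, (∫ t in Set.Iic x, f t ∂μ) * g x ∂μ =
      ∫ z in {z : ℝ × ℝ | z.2 ≤ z.1}ᶜ, f z.1 * g z.2 ∂(μ.prod μ) := by
    rw [← integral_indicator hS.compl, integral_prod_symm _ (hfg.indicator hS.compl)]
    refine integral_congr_ae (Eventually.of_forall fun x => ?_)
    simp only
    rw [integral_Iic_eq_integral_Iio, ← integral_mul_const, ← integral_indicator measurableSet_Iio]
    refine integral_congr_ae (Eventually.of_forall fun t => ?_)
    simp [Set.indicator_apply]
  rw [h1, h2, integral_add_compl hS hfg, integral_prod_mul]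

end IntegrationByParts

/-! ### Primitives of square integrable functions and the Volterra operator -/

section Primitive

variable {L : ℝ}

/-- Lebesgue measure on `(0,L)`. -/
abbrev vol (L : ℝ) : Measure ℝ := (volume : Measure ℝ).restrict (Set.Ioo 0 L)

theorem integrable_coe (f : L2 L) : Integrable f (vol L) :=
  (Lp.memLp f).integrable (by norm_num)

/-- The primitive of `f` vanishing at `0`. -/
def primFun (f : L2 L) (x : ℝ) : ℂ := ∫ t in Set.Iic x, f t ∂(vol L)

theorem norm_setIntegral_le (f : L2 L) {s : Set ℝ} (hs : MeasurableSet s) :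
    ‖∫ t in s, f t ∂(vol L)‖ ≤ √((vol L).real s) * ‖f‖ := by
  have := L2.inner_indicatorConstLp_one (𝕜 := ℂ) hs (measure_ne_top (vol L) s) f
  rw [← this]
  refine (norm_inner_le_norm _ _).trans ?_
  gcongr
  rw [norm_indicatorConstLp (by norm_num) (by norm_num)]
  simp [Real.sqrt_eq_rpow]

theorem primFun_sub (f : L2 L) {x y : ℝ} (h : x ≤ y) :
    primFun f y - primFun f x = ∫ t in Set.Ioc x y, f t ∂(vol L) := by
  rw [primFun, primFun, ← Set.Iic_union_Ioc_eq_Iic h, setIntegral_union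
    (Set.Iic_disjoint_Ioc le_rfl) measurableSet_Ioc (integrable_coe f).integrableOn
    (integrable_coe f).integrableOn]
  ring

/-- Cauchy–Schwarz. This Hölder bound gives continuity of primitives and later the compactness of
the Volterra operator. -/
theorem norm_primFun_sub_le (f : L2 L) {x y : ℝ} (h : x ≤ y) :
    ‖primFun f y - primFun f x‖ ≤ √(y - x) * ‖f‖ := by
  rw [primFun_sub f h]
  refine (norm_setIntegral_le f measurableSet_Ioc).trans ?_
  gcongr
  calc (vol L).real (Set.Ioc x y) ≤ volume.real (Set.Ioc x y) :=
        ENNReal.toReal_mono (by simp) (Measure.restrict_le_self _)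
    _ = y - x := by rw [Real.volume_real_Ioc_of_le h]

theorem continuous_primFun (f : L2 L) : Continuous (primFun f) := by
  rw [continuous_iff_continuousAt]
  intro x
  rw [ContinuousAt, tendsto_iff_norm_sub_tendsto_zero]
  have key : ∀ y, ‖primFun f y - primFun f x‖ ≤ √|y - x| * ‖f‖ := by
    intro y
    rcases le_total x y with h | h
    · rw [abs_of_nonneg (by linarith)]; exact norm_primFun_sub_le f h
    · rw [abs_of_nonpos (by linarith), norm_sub_rev, neg_sub]; exact norm_primFun_sub_le f h
  refine squeeze_zero (fun _ => norm_nonneg _) key ?_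
  have : Continuous fun y : ℝ => √|y - x| * ‖f‖ := by fun_prop
  simpa using this.tendsto x

theorem primFun_of_nonpos (f : L2 L) {x : ℝ} (hx : x ≤ 0) : primFun f x = 0 := by
  rw [primFun, Measure.restrict_restrict measurableSet_Iic]
  have : Set.Iic x ∩ Set.Ioo 0 L = ∅ := by
    ext t; simp only [Set.mem_inter_iff, Set.mem_Iic, Set.mem_Ioo, Set.mem_empty_iff_false]
    constructor
    · rintro ⟨a, b, _⟩; linarith
    · simp
  rw [this]; simp

theorem primFun_of_ge (f : L2 L) {x : ℝ} (hx : L ≤ x) : primFun f x = ∫ t, f t ∂(vol L) := by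
  rw [primFun, Measure.restrict_restrict measurableSet_Iic]
  have : Set.Iic x ∩ Set.Ioo 0 L = Set.Ioo 0 L := by
    rw [Set.inter_eq_right]
    exact fun t ht => ht.2.le.trans hx
  rw [this]

theorem setIntegral_Iic_vol {f : ℝ → ℂ} {x : ℝ} (hx0 : 0 ≤ x) (hxL : x ≤ L) :
    ∫ t in Set.Iic x, f t ∂(vol L) = ∫ t in (0 : ℝ)..x, f t := by
  rw [Measure.restrict_restrict measurableSet_Iic, intervalIntegral.integral_of_le hx0]
  refine setIntegral_congr_set ?_
  have h : (Set.Iic x ∩ Set.Ioo 0 L : Set ℝ) =ᵐ[volume] (Set.Iic x ∩ Set.Ioc 0 L : Set ℝ) :=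
    ae_eq_set_inter (ae_eq_refl _) Ioo_ae_eq_Ioc
  have : Set.Iic x ∩ Set.Ioc 0 L = Set.Ioc 0 x := by
    ext t; simp only [Set.mem_inter_iff, Set.mem_Iic, Set.mem_Ioc]
    constructor
    · rintro ⟨a, b, c⟩; exact ⟨b, a⟩
    · rintro ⟨a, b⟩; exact ⟨b, a, b.trans hxL⟩
  rwa [this] at h

theorem memLp_of_continuous {F : ℝ → ℂ} (hF : Continuous F) : MemLp F 2 (vol L) := by
  obtain ⟨C, hC⟩ := (isCompact_Icc (a := (0 : ℝ)) (b := L)).exists_bound_of_continuousOn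
    hF.continuousOn
  refine MemLp.of_bound hF.aestronglyMeasurable C ?_
  filter_upwards [ae_restrict_mem measurableSet_Ioo] with x hx
  exact hC x ⟨hx.1.le, hx.2.le⟩

/-- The class in `L²(0,L)` of a continuous function. -/
def ofCont (L : ℝ) (F : ℝ → ℂ) (hF : Continuous F) : L2 L := (memLp_of_continuous hF).toLp F

theorem coeFn_ofCont {F : ℝ → ℂ} (hF : Continuous F) : ofCont L F hF =ᵐ[vol L] F :=
  MemLp.coeFn_toLp _

theorem eq_ofCont {F : ℝ → ℂ} (hF : Continuous F) {f : L2 L} (h : f =ᵐ[vol L] F) :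
    f = ofCont L F hF :=
  Lp.ext (h.trans (coeFn_ofCont hF).symm)

theorem ofCont_congr {F G : ℝ → ℂ} (hF : Continuous F) (hG : Continuous G)
    (h : ∀ x ∈ Set.Ioo 0 L, F x = G x) : ofCont L F hF = ofCont L G hG := by
  refine Lp.ext ((coeFn_ofCont hF).trans (EventuallyEq.trans ?_ (coeFn_ofCont hG).symm))
  filter_upwards [ae_restrict_mem measurableSet_Ioo] with x hx using h x hx

theorem ofCont_eq_iff (hL : 0 < L) {F G : ℝ → ℂ} (hF : Continuous F) (hG : Continuous G) :
    ofCont L F hF = ofCont L G hG ↔ ∀ x ∈ Set.Icc 0 L, F x = G x := by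
  refine ⟨fun h => ?_, fun h => ofCont_congr hF hG fun x hx => h x ⟨hx.1.le, hx.2.le⟩⟩
  refine Measure.eqOn_Icc_of_ae_eq volume hL.ne ?_ hF.continuousOn hG.continuousOn
  rw [← Measure.restrict_congr_set (Ioo_ae_eq_Icc (μ := (volume : Measure ℝ)))]
  refine (coeFn_ofCont hF).symm.trans (EventuallyEq.trans ?_ (coeFn_ofCont hG))
  rw [h]

theorem hasTrace_ofCont {F : ℝ → ℂ} (hF : Continuous F) (a : ℝ) :
    HasTrace L (ofCont L F hF) a (F a) :=
  ⟨F, hF.continuousOn, coeFn_ofCont hF, rfl⟩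

theorem primFun_add (f g : L2 L) (x : ℝ) : primFun (f + g) x = primFun f x + primFun g x := by
  rw [primFun, primFun, primFun, ← integral_add (integrable_coe f).integrableOn
    (integrable_coe g).integrableOn]
  refine integral_congr_ae (ae_restrict_of_ae ?_)
  filter_upwards [Lp.coeFn_add f g] with t ht using ht

theorem primFun_smul (c : ℂ) (f : L2 L) (x : ℝ) : primFun (c • f) x = c * primFun f x := by
  rw [primFun, primFun, ← integral_const_mul]
  refine integral_congr_ae (ae_restrict_of_ae ?_)
  filter_upwards [Lp.coeFn_smul c f] with t ht using ht

theorem norm_primFun_le (f : L2 L) {x : ℝ} (hx : x ∈ Set.Icc 0 L) :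
    ‖primFun f x‖ ≤ √L * ‖f‖ := by
  have := norm_primFun_sub_le f hx.1
  rw [primFun_of_nonpos f le_rfl, sub_zero, sub_zero] at this
  exact this.trans (by gcongr; exact hx.2)

theorem vol_real_univ (hL : 0 ≤ L) : (vol L).real Set.univ = L := by
  rw [measureReal_restrict_apply_univ, Real.volume_real_Ioo_of_le hL, sub_zero]

theorem norm_le_of_forall_bound (hL : 0 < L) {f : L2 L} {C : ℝ} (hC : 0 ≤ C)
    (h : ∀ᵐ x ∂(vol L), ‖f x‖ ≤ C) : ‖f‖ ≤ √L * C := by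
  have h1 := Lp.norm_le_of_ae_bound hC h
  have h2 : (measureUnivNNReal (vol L) : ℝ) = L := vol_real_univ hL.le
  rw [h2] at h1
  simpa [Real.sqrt_eq_rpow] using h1

/-- The Volterra operator `f ↦ ∫₀ˣ f`. -/
def primOp (hL : 0 < L) : L2 L →L[ℂ] L2 L :=
  LinearMap.mkContinuous
    { toFun := fun f => ofCont L (primFun f) (continuous_primFun f)
      map_add' := fun f g => by
        refine Lp.ext ((coeFn_ofCont _).trans ?_)
        filter_upwards [Lp.coeFn_add (ofCont L (primFun f) (continuous_primFun f))
          (ofCont L (primFun g) (continuous_primFun g)), coeFn_ofCont (L := L)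
          (continuous_primFun f), coeFn_ofCont (L := L) (continuous_primFun g)] with x h1 h2 h3
        rw [h1, Pi.add_apply, h2, h3, primFun_add]
      map_smul' := fun c f => by
        refine Lp.ext ((coeFn_ofCont _).trans ?_)
        filter_upwards [Lp.coeFn_smul c (ofCont L (primFun f) (continuous_primFun f)),
          coeFn_ofCont (L := L) (continuous_primFun f)] with x h1 h2
        simp only [RingHom.id_apply]
        rw [h1, Pi.smul_apply, h2, primFun_smul, smul_eq_mul] }
    (√L * √L) (fun f => by
      rw [mul_assoc]
      refine norm_le_of_forall_bound hL (by positivity) ?_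
      filter_upwards [coeFn_ofCont (L := L) (continuous_primFun f),
        ae_restrict_mem measurableSet_Ioo] with x hx hx'
      simp only [LinearMap.coe_mk, AddHom.coe_mk]
      rw [hx]
      exact norm_primFun_le f ⟨hx'.1.le, hx'.2.le⟩)

theorem primOp_apply (hL : 0 < L) (f : L2 L) :
    primOp hL f = ofCont L (primFun f) (continuous_primFun f) := rfl

end Primitive

/-! ### Weak derivatives versus primitives -/

section WeakDeriv

variable {L : ℝ}

theorem test_zero {φ : ℝ → ℝ} (hs : tsupport φ ⊆ Set.Ioo 0 L) {x : ℝ} (hx : x ∉ Set.Ioo 0 L) :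
    φ x = 0 := by
  by_contra h
  exact hx (hs (subset_tsupport φ h))

/-- The Fubini identity applied to `φ'` and `g`: the primitive of `φ'` is `φ`, and since `φ'` has
integral zero both the constant `c` and the boundary term drop out. -/
theorem hasWeakDeriv_of_ae_eq (hL : 0 < L) {f g : L2 L} {c : ℂ}
    (h : f =ᵐ[vol L] fun x => c + primFun g x) : HasWeakDeriv L f g := by
  intro φ hφ hc hs
  have hd : Continuous (deriv φ) := hφ.continuous_deriv (by simp)
  have hdc : Continuous fun x => ((deriv φ x : ℝ) : ℂ) := by fun_prop
  have hder : ∀ x, HasDerivAt (fun t => ((φ t : ℝ) : ℂ)) ((deriv φ x : ℝ) : ℂ) x := fun x =>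
    ((hφ.differentiable (by simp)).differentiableAt.hasDerivAt).ofReal_comp
  have hint : ∀ x, 0 ≤ x → x ≤ L →
      ∫ t in Set.Iic x, ((deriv φ t : ℝ) : ℂ) ∂(vol L) = φ x := by
    intro x hx hx'
    rw [setIntegral_Iic_vol hx hx', intervalIntegral.integral_eq_sub_of_hasDerivAt
      (fun t _ => hder t) (hdc.intervalIntegrable _ _), test_zero hs (x := 0) (by simp)]
    simp
  have hI : Integrable (fun x => ((deriv φ x : ℝ) : ℂ)) (vol L) :=
    (memLp_of_continuous hdc).integrable (by norm_num)
  have htot : ∫ t, ((deriv φ t : ℝ) : ℂ) ∂(vol L) = 0 := by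
    have h1 := hint L hL.le le_rfl
    have h2 : Set.Iic L ∩ Set.Ioo 0 L = Set.Ioo 0 L :=
      Set.inter_eq_right.mpr fun t ht => ht.2.le
    rw [Measure.restrict_restrict measurableSet_Iic, h2, test_zero hs (x := L) (by simp)] at h1
    simpa using h1
  have key := integral_mul_setIntegral_Iic_add hI (integrable_coe g)
  rw [htot, zero_mul] at key
  have e1 : ∫ x in Set.Ioo 0 L, deriv φ x • f x =
      ∫ x, ((deriv φ x : ℝ) : ℂ) * (∫ t in Set.Iic x, g t ∂(vol L)) ∂(vol L) := by
    have : ∫ x in Set.Ioo 0 L, deriv φ x • f x = ∫ x, (((deriv φ x : ℝ) : ℂ) * c +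
        ((deriv φ x : ℝ) : ℂ) * (∫ t in Set.Iic x, g t ∂(vol L))) ∂(vol L) := by
      refine integral_congr_ae ?_
      filter_upwards [h] with x hx
      rw [hx, Complex.real_smul, primFun, mul_add]
    rw [this, integral_add (hI.mul_const c), integral_mul_const, htot, zero_mul, zero_add]
    exact (memLp_of_continuous (hdc.mul (continuous_primFun g))).integrable (by norm_num)
  have e2 : ∫ x in Set.Ioo 0 L, φ x • g x =
      ∫ x, (∫ t in Set.Iic x, ((deriv φ t : ℝ) : ℂ) ∂(vol L)) * g x ∂(vol L) := by
    refine integral_congr_ae ?_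
    filter_upwards [ae_restrict_mem measurableSet_Ioo] with x hx
    rw [hint x hx.1.le hx.2.le, Complex.real_smul]
  rw [e1, e2, eq_neg_iff_add_eq_zero]
  exact key

/-- The primitive from `0` vanishes to the left of the support of `χ`, and to its right because the
total integral is zero. -/
theorem exists_test_antideriv {χ : ℝ → ℝ} (hχ : ContDiff ℝ ∞ χ) (hc : HasCompactSupport χ)
    (hs : tsupport χ ⊆ Set.Ioo 0 L) (h0 : ∫ x in (0 : ℝ)..L, χ x = 0) (hL : 0 < L) :
    ∃ φ : ℝ → ℝ, ContDiff ℝ ∞ φ ∧ HasCompactSupport φ ∧ tsupport φ ⊆ Set.Ioo 0 L ∧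
      deriv φ = χ := by
  have hd : ∀ x, HasDerivAt (fun x => ∫ t in (0 : ℝ)..x, χ t) (χ x) x := fun x =>
    intervalIntegral.integral_hasDerivAt_right (hχ.continuous.intervalIntegrable _ _)
      (hχ.continuous.stronglyMeasurableAtFilter _ _) hχ.continuous.continuousAt
  have hderiv : deriv (fun x => ∫ t in (0 : ℝ)..x, χ t) = χ := funext fun x => (hd x).deriv
  obtain ⟨a, b, ha, hb, hab⟩ : ∃ a b, 0 < a ∧ b < L ∧ tsupport χ ⊆ Set.Icc a b := by
    rcases (tsupport χ).eq_empty_or_nonempty with he | hne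
    · exact ⟨L / 2, L / 2, by linarith, by linarith, by simp [he]⟩
    · obtain ⟨a, ha, ha'⟩ := hc.isCompact.exists_isLeast hne
      obtain ⟨b, hb, hb'⟩ := hc.isCompact.exists_isGreatest hne
      exact ⟨a, b, (hs ha).1, (hs hb).2, fun x hx => ⟨ha' hx, hb' hx⟩⟩
  have hz : ∀ x, x ∉ Set.Icc a b → χ x = 0 := fun x hx => by
    by_contra h
    exact hx (hab (subset_tsupport χ h))
  have hsupp : Function.support (fun x => ∫ t in (0 : ℝ)..x, χ t) ⊆ Set.Icc a b := by
    intro x hx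
    by_contra hn
    refine hx ?_
    rcases lt_or_ge x a with h | h
    · refine (intervalIntegral.integral_congr (g := fun _ => 0) fun t ht => hz t fun h' => ?_).trans
        (by simp)
      have := ht.2
      have h3 : max 0 x < a := max_lt ha h
      exact absurd h'.1 (not_le.mpr (this.trans_lt h3))
    · have hxb : b < x := by
        by_contra h'
        exact hn ⟨h, not_lt.mp h'⟩
      have h4 : (∫ t in (0 : ℝ)..x, χ t) = (∫ t in (0 : ℝ)..L, χ t) + ∫ t in L..x, χ t :=
        (intervalIntegral.integral_add_adjacent_intervals (hχ.continuous.intervalIntegrable _ _)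
          (hχ.continuous.intervalIntegrable _ _)).symm
      simp only
      rw [h4, h0, zero_add]
      refine (intervalIntegral.integral_congr (g := fun _ => 0) fun t ht => hz t fun h' => ?_).trans
        (by simp)
      have := ht.1
      have h3 : b < min L x := lt_min hb hxb
      exact absurd h'.2 (not_le.mpr (h3.trans_le this))
  have hts : tsupport (fun x => ∫ t in (0 : ℝ)..x, χ t) ⊆ Set.Icc a b :=
    closure_minimal hsupp isClosed_Icc
  refine ⟨_, ?_, ?_, hts.trans (fun x hx => ⟨ha.trans_le hx.1, hx.2.trans_lt hb⟩), hderiv⟩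
  · rw [contDiff_infty_iff_deriv, hderiv]
    exact ⟨fun x => (hd x).differentiableAt, hχ⟩
  · exact isCompact_Icc.of_isClosed_subset (isClosed_tsupport _) hts

/-- Du Bois-Reymond: with a fixed bump `ψ` of integral one, `χ - (∫ χ) ψ` is the derivative of a
test function for every `χ`, so `∫ χ f = (∫ χ) c` with `c = ∫ ψ f`. -/
theorem exists_const_of_hasWeakDeriv_zero (hL : 0 < L) {f : L2 L} (h : HasWeakDeriv L f 0) :
    ∃ c : ℂ, f =ᵐ[vol L] fun _ => c := by
  obtain ⟨ψ, hψ, hψc, hψs, hψ1⟩ : ∃ ψ : ℝ → ℝ, ContDiff ℝ ∞ ψ ∧ HasCompactSupport ψ ∧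
      tsupport ψ ⊆ Set.Ioo 0 L ∧ ∫ x in (0 : ℝ)..L, ψ x = 1 := by
    let B : ContDiffBump (L / 2 : ℝ) := ⟨L / 8, L / 4, by linarith, by linarith⟩
    have hts : tsupport (B.normed volume) ⊆ Set.Ioo 0 L := by
      rw [B.tsupport_normed_eq]
      intro x hx
      have h2 : |x - L / 2| ≤ L / 4 := by simpa [Real.dist_eq] using hx
      rw [abs_le] at h2
      exact ⟨by linarith [h2.1], by linarith [h2.2]⟩
    refine ⟨B.normed volume, B.contDiff_normed, B.hasCompactSupport_normed, hts, ?_⟩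
    rw [intervalIntegral.integral_of_le hL.le, integral_Ioc_eq_integral_Ioo,
      setIntegral_eq_integral_of_forall_compl_eq_zero fun x hx => test_zero hts hx]
    exact B.integral_normed
  set c : ℂ := ∫ x in Set.Ioo 0 L, ψ x • f x with hc
  refine ⟨c, ?_⟩
  have hfi : IntegrableOn (f : ℝ → ℂ) (Set.Ioo 0 L) volume := integrable_coe f
  have key : ∀ᵐ x ∂(volume : Measure ℝ), x ∈ Set.Ioo 0 L → f x - c = 0 := by
    refine isOpen_Ioo.ae_eq_zero_of_integral_contDiff_smul_eq_zero
      ((hfi.sub (integrable_const c)).locallyIntegrableOn) ?_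
    intro χ hχ hχc hχs
    have e : ∫ x, χ x • (f x - c) = ∫ x in Set.Ioo 0 L, χ x • (f x - c) := by
      symm
      apply setIntegral_eq_integral_of_forall_compl_eq_zero
      intro x hx
      rw [test_zero hχs hx, zero_smul]
    rw [e]
    set k : ℝ := ∫ x in (0 : ℝ)..L, χ x with hk
    have hk' : k = ∫ x in Set.Ioo 0 L, χ x := by
      rw [hk, intervalIntegral.integral_of_le hL.le, integral_Ioc_eq_integral_Ioo]
    obtain ⟨φ, h1, h2, h3, h4⟩ := exists_test_antideriv (L := L) (χ := fun x => χ x - k * ψ x)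
      (hχ.sub (contDiff_const.mul hψ)) (hχc.sub hψc.mul_left)
      ((tsupport_sub χ _).trans (Set.union_subset hχs
        ((tsupport_mul_subset_right (f := fun _ => k)).trans hψs)))
      (by
        have hkψ : Continuous fun x => k * ψ x := continuous_const.mul hψ.continuous
        rw [intervalIntegral.integral_sub (hχ.continuous.intervalIntegrable _ _)
          (hkψ.intervalIntegrable _ _),
          intervalIntegral.integral_const_mul, hψ1, ← hk]; ring) hL
    have h5 := h φ h1 h2 h3
    have h6 : ∫ x in Set.Ioo 0 L, φ x • (0 : L2 L) x = 0 := by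
      apply integral_eq_zero_of_ae
      filter_upwards [Lp.coeFn_zero ℂ 2 (vol L)] with x hx
      exact (congrArg (φ x • ·) hx).trans (smul_zero _)
    rw [h6, neg_zero, h4] at h5
    simp only [sub_smul, mul_smul] at h5
    have i1 := integrable_smul χ hχ.continuous hχc f
    have i2 := integrable_smul ψ hψ.continuous hψc f
    have i4 : Integrable (fun x => k • ψ x • f x) (vol L) := i2.smul k
    rw [integral_sub i1 i4, integral_smul, ← hc] at h5
    simp only [smul_sub]
    have i3 : Integrable (fun x => χ x • c) (vol L) := by
      have : Continuous fun x => χ x • c := hχ.continuous.smul continuous_const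
      exact (memLp_of_continuous this).integrable (by norm_num)
    rw [integral_sub i1 i3, integral_smul_const, ← hk']
    exact h5
  rw [Filter.EventuallyEq, ae_restrict_iff' measurableSet_Ioo]
  filter_upwards [key] with x hx hx'
  exact sub_eq_zero.mp (hx hx')

theorem HasWeakDeriv.exists_ae_eq (hL : 0 < L) {f g : L2 L} (h : HasWeakDeriv L f g) :
    ∃ c : ℂ, f =ᵐ[vol L] fun x => c + primFun g x := by
  have h1 : HasWeakDeriv L (primOp hL g) g := by
    refine hasWeakDeriv_of_ae_eq hL (c := 0) ?_
    simp only [zero_add]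
    exact coeFn_ofCont (continuous_primFun g)
  have h2 : HasWeakDeriv L (f + (-1 : ℂ) • primOp hL g) 0 := by
    have := h.add (h1.smul (-1 : ℂ))
    simpa using this
  obtain ⟨c, hc⟩ := exists_const_of_hasWeakDeriv_zero hL h2
  refine ⟨c, ?_⟩
  filter_upwards [hc, Lp.coeFn_add f ((-1 : ℂ) • primOp hL g),
    Lp.coeFn_smul (-1 : ℂ) (primOp hL g), coeFn_ofCont (L := L) (continuous_primFun g)]
    with x a b d e
  rw [b, Pi.add_apply, d, Pi.smul_apply, primOp_apply, e] at a
  rw [← a]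
  simp

theorem hasWeakDeriv_ofCont (hL : 0 < L) {F F' : ℝ → ℂ} (hd : ∀ x, HasDerivAt F (F' x) x)
    (hF : Continuous F) (hF' : Continuous F') :
    HasWeakDeriv L (ofCont L F hF) (ofCont L F' hF') := by
  refine hasWeakDeriv_of_ae_eq hL (c := F 0) ?_
  filter_upwards [coeFn_ofCont hF, ae_restrict_mem measurableSet_Ioo] with x hx hx'
  rw [hx, primFun]
  have : ∫ t in Set.Iic x, ofCont L F' hF' t ∂(vol L) = ∫ t in Set.Iic x, F' t ∂(vol L) :=
    integral_congr_ae (ae_restrict_of_ae (coeFn_ofCont hF'))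
  rw [this, setIntegral_Iic_vol hx'.1.le hx'.2.le,
    intervalIntegral.integral_eq_sub_of_hasDerivAt (fun t _ => hd t)
    (hF'.intervalIntegrable _ _)]
  ring

theorem HasWeakDeriv.mul_smooth {f g p q : L2 L} (h : HasWeakDeriv L f g) {m : ℝ → ℝ}
    (hm : ContDiff ℝ ∞ m) (hp : p =ᵐ[vol L] fun x => m x • f x)
    (hq : q =ᵐ[vol L] fun x => deriv m x • f x + m x • g x) : HasWeakDeriv L p q := by
  intro φ hφ hc hs
  have hdφ : Continuous (deriv φ) := hφ.continuous_deriv (by simp)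
  have hdm : Continuous (deriv m) := hm.continuous_deriv (by simp)
  have hd : deriv (fun x => φ x * m x) = fun x => deriv φ x * m x + φ x * deriv m x :=
    funext fun x => deriv_fun_mul (hφ.differentiable (by simp)).differentiableAt
      (hm.differentiable (by simp)).differentiableAt
  have h1 := h (fun x => φ x * m x) (hφ.mul hm) hc.mul_right
    ((tsupport_mul_subset_left (f := φ) (g := m)).trans hs)
  rw [hd] at h1
  have i1 := integrable_smul (fun x => deriv φ x * m x) (hdφ.mul hm.continuous) hc.deriv.mul_right f
  have i2 := integrable_smul (fun x => φ x * deriv m x) (hφ.continuous.mul hdm) hc.mul_right f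
  have i3 := integrable_smul (fun x => φ x * m x) (hφ.continuous.mul hm.continuous) hc.mul_right g
  simp only [add_smul] at h1
  rw [integral_add i1 i2] at h1
  have e1 : ∫ x in Set.Ioo 0 L, deriv φ x • p x =
      ∫ x in Set.Ioo 0 L, (deriv φ x * m x) • f x := by
    refine integral_congr_ae ?_
    filter_upwards [hp] with x hx
    rw [hx, mul_smul]
  have e2 : ∫ x in Set.Ioo 0 L, φ x • q x =
      (∫ x in Set.Ioo 0 L, (φ x * deriv m x) • f x) + ∫ x in Set.Ioo 0 L, (φ x * m x) • g x := by
    rw [← integral_add i2 i3]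
    refine integral_congr_ae ?_
    filter_upwards [hq] with x hx
    rw [hx, smul_add, mul_smul, mul_smul]
  rw [e1, e2, eq_sub_of_add_eq h1]
  ring

end WeakDeriv

/-! ### The reflection of the interval -/

section Reflection

variable {L : ℝ}

theorem measurePreserving_reflect (L : ℝ) :
    MeasurePreserving (fun x : ℝ => L - x) (vol L) (vol L) := by
  have h := (Measure.measurePreserving_sub_left (volume : Measure ℝ) L).restrict_preimage
    (measurableSet_Ioo (a := (0 : ℝ)) (b := L))
  simpa using h

theorem integral_reflect (F : ℝ → ℂ) : ∫ x, F (L - x) ∂(vol L) = ∫ x, F x ∂(vol L) :=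
  (measurePreserving_reflect L).integral_comp (MeasurableEquiv.subLeft L).measurableEmbedding F

/-- The reflection `f ↦ f(L - ·)`. -/
def refl (L : ℝ) : L2 L →ₗᵢ[ℂ] L2 L :=
  Lp.compMeasurePreservingₗᵢ ℂ (fun x => L - x) (measurePreserving_reflect L)

theorem coeFn_refl (f : L2 L) : refl L f =ᵐ[vol L] fun x => f (L - x) :=
  Lp.coeFn_compMeasurePreserving f (measurePreserving_reflect L)

theorem ae_reflect {P : ℝ → Prop} (h : ∀ᵐ x ∂(vol L), P x) : ∀ᵐ x ∂(vol L), P (L - x) :=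
  (measurePreserving_reflect L).quasiMeasurePreserving.ae h

theorem refl_ae_eq {f : L2 L} {F : ℝ → ℂ} (h : f =ᵐ[vol L] F) :
    refl L f =ᵐ[vol L] fun x => F (L - x) := by
  filter_upwards [coeFn_refl f, ae_reflect h] with x h1 h2
  rw [h1, h2]

theorem refl_refl (f : L2 L) : refl L (refl L f) = f := by
  refine Lp.ext ?_
  filter_upwards [refl_ae_eq (coeFn_refl f)] with x h1
  rw [h1, sub_sub_cancel]

theorem refl_ofCont {F : ℝ → ℂ} (hF : Continuous F) :
    refl L (ofCont L F hF) = ofCont L (fun x => F (L - x)) (by fun_prop) :=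
  eq_ofCont _ (refl_ae_eq (coeFn_ofCont hF))

theorem inner_refl (f g : L2 L) : inner ℂ (refl L f) g = inner ℂ f (refl L g) := by
  rw [← (refl L).inner_map_map f (refl L g), refl_refl]

theorem HasWeakDeriv.refl {f g : L2 L} (h : HasWeakDeriv L f g) :
    HasWeakDeriv L (KdVKdV.refl L f) (-KdVKdV.refl L g) := by
  intro φ hφ hc hs
  have hd : ∀ x, deriv (fun t => φ (L - t)) x = -deriv φ (L - x) := fun x => by
    rw [deriv_comp_const_sub]
  have hcL : HasCompactSupport fun t => φ (L - t) :=
    hc.comp_homeomorph (Homeomorph.subLeft L)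
  have hsL : tsupport (fun t => φ (L - t)) ⊆ Set.Ioo 0 L := by
    have : tsupport (fun t => φ (L - t)) ⊆ (fun t => L - t) ⁻¹' tsupport φ :=
      closure_minimal (fun x hx => subset_tsupport φ hx)
        ((isClosed_tsupport φ).preimage (by fun_prop))
    refine this.trans fun x hx => ?_
    have h1 := hs hx
    exact ⟨by linarith [h1.2], by linarith [h1.1]⟩
  have key := h (fun t => φ (L - t)) (hφ.comp (contDiff_const.sub contDiff_id)) hcL hsL
  simp only [hd] at key
  have e1 : ∫ x in Set.Ioo 0 L, deriv φ x • KdVKdV.refl L f x =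
      ∫ x in Set.Ioo 0 L, deriv φ (L - x) • f x := by
    rw [← integral_reflect fun x => deriv φ (L - x) • f x]
    refine integral_congr_ae ?_
    filter_upwards [coeFn_refl f] with x hx
    rw [hx, sub_sub_cancel]
  have e2 : ∫ x in Set.Ioo 0 L, φ x • (-KdVKdV.refl L g : L2 L) x =
      -∫ x in Set.Ioo 0 L, φ (L - x) • g x := by
    rw [← integral_reflect fun x => φ (L - x) • g x, ← integral_neg]
    refine integral_congr_ae ?_
    filter_upwards [coeFn_refl g, Lp.coeFn_neg (KdVKdV.refl L g)] with x hx hx'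
    rw [hx', Pi.neg_apply, hx, sub_sub_cancel, smul_neg]
  simp only [neg_smul, integral_neg, neg_inj] at key
  rw [e1, e2, key, neg_neg]

theorem HasWeakDeriv.neg {f g : L2 L} (h : HasWeakDeriv L f g) : HasWeakDeriv L (-f) (-g) := by
  simpa using h.smul (-1 : ℂ)

theorem MemSobolev.neg {k : ℕ} {f : L2 L} (h : MemSobolev L k f) : MemSobolev L k (-f) := by
  simpa using h.smul (-1 : ℂ)

theorem MemSobolev.refl : ∀ {k : ℕ} {f : L2 L}, MemSobolev L k f →
    MemSobolev L k (KdVKdV.refl L f)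
  | 0, _, _ => trivial
  | _ + 1, _, ⟨_, hf, hf'⟩ => ⟨_, hf.refl, (MemSobolev.refl hf').neg⟩

theorem MemSobolev.hasWeakDeriv {k : ℕ} {f : L2 L} (h : MemSobolev L (k + 1) f) :
    HasWeakDeriv L f (KdVKdV.weakDeriv L f) := by
  obtain ⟨g, hg, _⟩ := h
  rwa [hg.weakDeriv_eq]

theorem MemSobolev.weakDeriv_refl {k : ℕ} {f : L2 L} (h : MemSobolev L (k + 1) f) :
    KdVKdV.weakDeriv L (KdVKdV.refl L f) = -KdVKdV.refl L (KdVKdV.weakDeriv L f) :=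
  h.hasWeakDeriv.refl.weakDeriv_eq

theorem MemSobolev.weakDeriv_neg {k : ℕ} {f : L2 L} (h : MemSobolev L (k + 1) f) :
    KdVKdV.weakDeriv L (-f) = -KdVKdV.weakDeriv L f :=
  h.hasWeakDeriv.neg.weakDeriv_eq

theorem HasTrace.refl {f : L2 L} {a : ℝ} {c : ℂ} (h : HasTrace L f a c) :
    HasTrace L (KdVKdV.refl L f) (L - a) c := by
  obtain ⟨F, hF, hfF, rfl⟩ := h
  refine ⟨fun x => F (L - x), ?_, refl_ae_eq hfF, by simp⟩
  exact hF.comp (by fun_prop) fun x hx => ⟨by linarith [hx.2], by linarith [hx.1]⟩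

theorem HasTrace.neg {f : L2 L} {a : ℝ} {c : ℂ} (h : HasTrace L f a c) :
    HasTrace L (-f) a (-c) := by
  simpa using h.smul (-1 : ℂ)

theorem refl_mem_compDomain {f : L2 L} {a : ℝ} (h : f ∈ compDomain L a) :
    refl L f ∈ compDomain L (L - a) := by
  obtain ⟨h1, h2, h3, h4⟩ := h
  refine ⟨h1.refl, by simpa using h3.refl, by simpa using h2.refl, ?_⟩
  rw [h1.weakDeriv_refl]
  simpa using h4.refl.neg

/-- Only derivatives of odd order occur. Together with `refl_mem_compDomain`, which swaps the two
derivative conditions, this reduces `A` to a scalar operator. -/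
theorem minusD_refl {f : L2 L} (h : MemSobolev L 3 f) :
    minusD L (refl L f) = -refl L (minusD L f) := by
  simp only [minusD]
  rw [h.weakDeriv_refl, h.weakDeriv.refl.weakDeriv_neg, h.weakDeriv.weakDeriv_refl, neg_neg, neg_neg,
    h.weakDeriv.weakDeriv.weakDeriv_refl, map_sub, map_neg]
  abel

end Reflection

/-! ### Integration by parts with traces; symmetry of the scalar operator -/

section Symmetry

variable {L : ℝ}

theorem HasWeakDeriv.exists_hasTrace (hL : 0 < L) {f g : L2 L} (h : HasWeakDeriv L f g) (a : ℝ) :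
    ∃ c, HasTrace L f a c := by
  obtain ⟨c, hc⟩ := h.exists_ae_eq hL
  have := continuous_primFun g
  exact ⟨_, _, Continuous.continuousOn (by fun_prop), hc, rfl⟩

/-- Both functions are a constant plus a primitive; the constants are the traces at `0`, and the
rest is the Fubini identity for `conj f₁` and `g₁`. -/
theorem HasWeakDeriv.inner_add_inner (hL : 0 < L) {f f₁ g g₁ : L2 L} (hf : HasWeakDeriv L f f₁)
    (hg : HasWeakDeriv L g g₁) {a₀ a₁ b₀ b₁ : ℂ} (ha₀ : HasTrace L f 0 a₀)
    (ha₁ : HasTrace L f L a₁) (hb₀ : HasTrace L g 0 b₀) (hb₁ : HasTrace L g L b₁) :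
    inner ℂ f g₁ + inner ℂ f₁ g =
      (starRingEnd ℂ) a₁ * b₁ - (starRingEnd ℂ) a₀ * b₀ := by
  obtain ⟨c, hc⟩ := hf.exists_ae_eq hL
  obtain ⟨d, hd⟩ := hg.exists_ae_eq hL
  have hF : Continuous fun x => c + primFun f₁ x := continuous_const.add (continuous_primFun _)
  have hG : Continuous fun x => d + primFun g₁ x := continuous_const.add (continuous_primFun _)
  have m0 : (0 : ℝ) ∈ Set.Icc 0 L := ⟨le_rfl, hL.le⟩
  have mL : L ∈ Set.Icc 0 L := ⟨hL.le, le_rfl⟩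
  have ea₀ : a₀ = c := by
    refine ha₀.unique hL m0 ⟨_, hF.continuousOn, hc, ?_⟩
    simp [primFun_of_nonpos]
  have ea₁ : a₁ = c + ∫ t, f₁ t ∂(vol L) := by
    refine ha₁.unique hL mL ⟨_, hF.continuousOn, hc, ?_⟩
    simp [primFun_of_ge]
  have eb₀ : b₀ = d := by
    refine hb₀.unique hL m0 ⟨_, hG.continuousOn, hd, ?_⟩
    simp [primFun_of_nonpos]
  have eb₁ : b₁ = d + ∫ t, g₁ t ∂(vol L) := by
    refine hb₁.unique hL mL ⟨_, hG.continuousOn, hd, ?_⟩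
    simp [primFun_of_ge]
  have hfc : Integrable (fun x => (starRingEnd ℂ) (f₁ x)) (vol L) :=
    (Complex.conjCLE.toContinuousLinearMap).integrable_comp (integrable_coe f₁)
  have key := integral_mul_setIntegral_Iic_add hfc (integrable_coe g₁)
  have hp : ∀ x, ∫ t in Set.Iic x, (starRingEnd ℂ) (f₁ t) ∂(vol L) =
      (starRingEnd ℂ) (primFun f₁ x) := fun x => integral_conj
  rw [integral_conj] at key
  simp only [hp] at key
  have hcp : Continuous fun x => (starRingEnd ℂ) (primFun f₁ x) :=
    Complex.continuous_conj.comp (continuous_primFun _)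
  have i1 : Integrable (fun x => (starRingEnd ℂ) (primFun f₁ x) * g₁ x) (vol L) := by
    obtain ⟨C, hC⟩ := (isCompact_Icc (a := (0 : ℝ)) (b := L)).exists_bound_of_continuousOn
      hcp.continuousOn
    refine (integrable_coe g₁).bdd_mul (c := C) hcp.aestronglyMeasurable ?_
    filter_upwards [ae_restrict_mem measurableSet_Ioo] with x hx
    exact hC x ⟨hx.1.le, hx.2.le⟩
  have i2 : Integrable (fun x => (starRingEnd ℂ) (f₁ x) * primFun g₁ x) (vol L) := by
    obtain ⟨C, hC⟩ := (isCompact_Icc (a := (0 : ℝ)) (b := L)).exists_bound_of_continuousOn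
      (continuous_primFun g₁).continuousOn
    refine hfc.mul_bdd (c := C) (continuous_primFun g₁).aestronglyMeasurable ?_
    filter_upwards [ae_restrict_mem measurableSet_Ioo] with x hx
    exact hC x ⟨hx.1.le, hx.2.le⟩
  have e1 : inner ℂ f g₁ = (starRingEnd ℂ) c * (∫ t, g₁ t ∂(vol L)) +
      ∫ x, (starRingEnd ℂ) (primFun f₁ x) * g₁ x ∂(vol L) := by
    rw [L2.inner_def, ← integral_const_mul, ← integral_add ((integrable_coe g₁).const_mul _) i1]
    refine integral_congr_ae ?_
    filter_upwards [hc] with x hx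
    rw [hx, RCLike.inner_apply, map_add]
    ring
  have e2 : inner ℂ f₁ g = (starRingEnd ℂ) (∫ t, f₁ t ∂(vol L)) * d +
      ∫ x, (starRingEnd ℂ) (f₁ x) * primFun g₁ x ∂(vol L) := by
    rw [L2.inner_def, ← integral_conj, ← integral_mul_const, ← integral_add (hfc.mul_const _) i2]
    refine integral_congr_ae ?_
    filter_upwards [hd] with x hx
    rw [hx, RCLike.inner_apply]
    ring
  simp only [primFun] at key e1 e2
  rw [e1, e2, ea₀, ea₁, eb₀, eb₁, map_add]
  linear_combination key

/-- The symmetry of `B`, since `refl ∘ minusD = -B` on its domain. After moving the reflection onto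
`g`, the derivatives are moved one at a time between `f` and `z = g(L - ·)`. -/
theorem inner_refl_minusD (hL : 0 < L) {f g : L2 L} (hf : f ∈ compDomain L 0)
    (hg : g ∈ compDomain L 0) :
    inner ℂ (refl L (minusD L f)) g = inner ℂ f (refl L (minusD L g)) := by
  have hz := refl_mem_compDomain hg
  rw [sub_zero] at hz
  rw [inner_refl, ← neg_neg (refl L (minusD L g)), ← minusD_refl hg.1]
  set z := refl L g
  obtain ⟨sf, f0, fL, f10⟩ := hf
  obtain ⟨sz, z0, zL, z1L⟩ := hz
  have f1 := sf.hasWeakDeriv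
  have f2 := sf.weakDeriv.hasWeakDeriv
  have f3 := sf.weakDeriv.weakDeriv.hasWeakDeriv
  have z1 := sz.hasWeakDeriv
  have z2 := sz.weakDeriv.hasWeakDeriv
  have z3 := sz.weakDeriv.weakDeriv.hasWeakDeriv
  obtain ⟨_, f1L⟩ := f2.exists_hasTrace hL L
  obtain ⟨_, f20⟩ := f3.exists_hasTrace hL 0
  obtain ⟨_, f2L⟩ := f3.exists_hasTrace hL L
  obtain ⟨_, z10⟩ := z2.exists_hasTrace hL 0
  obtain ⟨_, z20⟩ := z3.exists_hasTrace hL 0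
  obtain ⟨_, z2L⟩ := z3.exists_hasTrace hL L
  have k1 := f1.inner_add_inner hL z1 f0 fL z0 zL
  have k2 := f3.inner_add_inner hL z1 f20 f2L z0 zL
  -- Here the boundary terms vanish by the derivative conditions `f'(0) = 0` and `z'(L) = 0`; in the
  -- other three identities they vanish by the Dirichlet conditions.
  have k3 := f2.inner_add_inner hL z2 f10 f1L z10 z1L
  have k4 := f1.inner_add_inner hL z3 f0 fL z20 z2L
  simp only [map_zero, mul_zero, zero_mul, sub_zero] at k1 k2 k3 k4
  simp only [minusD, inner_sub_left, inner_neg_left, inner_sub_right, inner_neg_right]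
  linear_combination -k1 - k2 + k3 - k4

end Symmetry

/-! ### Eigenvectors of the scalar operator and of `A` -/

section Eigen

variable {L : ℝ}

/-- `f` lies in the domain of the scalar operator `B f = (f' + f''')(L - ·)` and `B f = λ f`. -/
def IsEigB (L lam : ℝ) (f : L2 L) : Prop :=
  f ∈ compDomain L 0 ∧ minusD L f = -((lam : ℂ) • refl L f)

theorem isEigB_ofCont (hL : 0 < L) {lam : ℝ} {F₀ F₁ F₂ F₃ : ℝ → ℂ}
    (h0 : Continuous F₀) (h1 : Continuous F₁) (h2 : Continuous F₂) (h3 : Continuous F₃)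
    (d0 : ∀ x, HasDerivAt F₀ (F₁ x) x) (d1 : ∀ x, HasDerivAt F₁ (F₂ x) x)
    (d2 : ∀ x, HasDerivAt F₂ (F₃ x) x) (b0 : F₀ 0 = 0) (bL : F₀ L = 0) (b1 : F₁ 0 = 0)
    (ode : ∀ x ∈ Set.Ioo 0 L, F₃ x + F₁ x = lam * F₀ (L - x)) :
    IsEigB L lam (ofCont L F₀ h0) := by
  have w0 := hasWeakDeriv_ofCont hL d0 h0 h1
  have w1 := hasWeakDeriv_ofCont hL d1 h1 h2
  have w2 := hasWeakDeriv_ofCont hL d2 h2 h3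
  refine ⟨⟨⟨_, w0, _, w1, _, w2, trivial⟩, b0 ▸ hasTrace_ofCont h0 0, ?_, ?_⟩, ?_⟩
  · simpa [bL] using hasTrace_ofCont (L := L) h0 L
  · rw [w0.weakDeriv_eq]
    simpa [b1] using hasTrace_ofCont (L := L) h1 0
  · rw [minusD, w0.weakDeriv_eq, w1.weakDeriv_eq, w2.weakDeriv_eq, refl_ofCont]
    refine Lp.ext ?_
    filter_upwards [ae_restrict_mem measurableSet_Ioo, coeFn_ofCont (L := L) h1,
      coeFn_ofCont (L := L) h3, coeFn_ofCont (L := L) (F := fun x => F₀ (L - x)) (by fun_prop),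
      Lp.coeFn_neg (ofCont L F₁ h1), Lp.coeFn_sub (-ofCont L F₁ h1) (ofCont L F₃ h3),
      Lp.coeFn_neg ((lam : ℂ) • ofCont L (fun x => F₀ (L - x)) (by fun_prop)),
      Lp.coeFn_smul (lam : ℂ) (ofCont L (fun x => F₀ (L - x)) (by fun_prop))]
      with x hx e1 e2 e3 e4 e5 e6 e7
    rw [e5, e6, Pi.sub_apply, e4, Pi.neg_apply, Pi.neg_apply, e7, Pi.smul_apply, e1, e2, e3,
      smul_eq_mul, ← ode x hx]
    ring

theorem primFun_ofCont {F : ℝ → ℂ} (hF : Continuous F) {x : ℝ} (hx : x ∈ Set.Icc 0 L) :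
    primFun (ofCont L F hF) x = ∫ t in (0 : ℝ)..x, F t := by
  have : ∫ t in Set.Iic x, ofCont L F hF t ∂(vol L) = ∫ t in Set.Iic x, F t ∂(vol L) :=
    integral_congr_ae (ae_restrict_of_ae (coeFn_ofCont hF))
  rw [primFun, this, setIntegral_Iic_vol hx.1 hx.2]

theorem HasWeakDeriv.exists_ofCont (hL : 0 < L) {f : L2 L} {G : ℝ → ℂ} (hG : Continuous G)
    (h : HasWeakDeriv L f (ofCont L G hG)) :
    ∃ (F : ℝ → ℂ) (hF : Continuous F), (∀ x, HasDerivAt F (G x) x) ∧ f = ofCont L F hF := by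
  obtain ⟨c, hc⟩ := h.exists_ae_eq hL
  have hd : ∀ x, HasDerivAt (fun x => c + ∫ t in (0 : ℝ)..x, G t) (G x) x := fun x =>
    (intervalIntegral.integral_hasDerivAt_right (hG.intervalIntegrable _ _)
      (hG.stronglyMeasurableAtFilter _ _) hG.continuousAt).const_add c
  have hF : Continuous (fun x => c + ∫ t in (0 : ℝ)..x, G t) :=
    continuous_iff_continuousAt.mpr fun x => (hd x).continuousAt
  refine ⟨_, hF, hd, eq_ofCont hF ?_⟩
  filter_upwards [hc, ae_restrict_mem measurableSet_Ioo] with x hx hx'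
  rw [hx, primFun_ofCont hG ⟨hx'.1.le, hx'.2.le⟩]

theorem HasWeakDeriv.exists_continuous (hL : 0 < L) {f g : L2 L} (h : HasWeakDeriv L f g) :
    ∃ (F : ℝ → ℂ) (hF : Continuous F), f = ofCont L F hF := by
  obtain ⟨c, hc⟩ := h.exists_ae_eq hL
  exact ⟨_, continuous_const.add (continuous_primFun g), eq_ofCont _ hc⟩

/-- Regularity: `f` and `f'` have continuous representatives, so the equation makes `f'''`
continuous, and three integrations give a classical solution. -/
theorem IsEigB.exists_classical (hL : 0 < L) {lam : ℝ} {f : L2 L} (h : IsEigB L lam f) :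
    ∃ (F₀ F₁ F₂ F₃ : ℝ → ℂ) (h0 : Continuous F₀) (h1 : Continuous F₁),
      (∀ x, HasDerivAt F₀ (F₁ x) x) ∧ (∀ x, HasDerivAt F₁ (F₂ x) x) ∧
      (∀ x, HasDerivAt F₂ (F₃ x) x) ∧ F₀ 0 = 0 ∧ F₀ L = 0 ∧ F₁ 0 = 0 ∧
      (∀ x ∈ Set.Icc 0 L, F₃ x + F₁ x = lam * F₀ (L - x)) ∧
      f = ofCont L F₀ h0 ∧ weakDeriv L f = ofCont L F₁ h1 := by
  obtain ⟨⟨s, t0, tL, t1⟩, he⟩ := h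
  have f1 := s.hasWeakDeriv
  have f2 := s.weakDeriv.hasWeakDeriv
  have f3 := s.weakDeriv.weakDeriv.hasWeakDeriv
  obtain ⟨P₀, hP₀, eP₀⟩ := f1.exists_continuous hL
  obtain ⟨P₁, hP₁, eP₁⟩ := f2.exists_continuous hL
  -- The third derivative is prescribed on the whole line, so the primitives are differentiable
  -- everywhere. They agree with `P₀`, `P₁` only on `[0,L]`, which is why the equation is asserted
  -- only there.
  have hF₃ : Continuous fun x => (lam : ℂ) * P₀ (L - x) - P₁ x := by fun_prop
  have e3 : weakDeriv L (weakDeriv L (weakDeriv L f)) =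
      (lam : ℂ) • refl L f - weakDeriv L f := by
    rw [minusD] at he
    have := congrArg Neg.neg he
    rw [neg_sub, neg_neg, sub_neg_eq_add] at this
    exact eq_sub_of_add_eq this
  have e3' : weakDeriv L (weakDeriv L (weakDeriv L f)) = ofCont L _ hF₃ := by
    refine eq_ofCont _ ?_
    have c1 : weakDeriv L f =ᵐ[vol L] P₁ := by
      have := coeFn_ofCont (L := L) hP₁
      rwa [← eP₁] at this
    have c0 : refl L f =ᵐ[vol L] fun x => P₀ (L - x) := by
      have := refl_ae_eq (coeFn_ofCont (L := L) hP₀)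
      rwa [← eP₀] at this
    rw [e3]
    filter_upwards [c1, c0, Lp.coeFn_sub ((lam : ℂ) • refl L f) (weakDeriv L f),
      Lp.coeFn_smul (lam : ℂ) (refl L f)] with x k1 k2 k3 k4
    rw [k3, Pi.sub_apply, k4, Pi.smul_apply, k1, k2, smul_eq_mul]
  rw [e3'] at f3
  obtain ⟨F₂, hF₂, d2, eF₂⟩ := f3.exists_ofCont hL hF₃
  rw [eF₂] at f2
  obtain ⟨F₁, hF₁, d1, eF₁⟩ := f2.exists_ofCont hL hF₂
  rw [eF₁] at f1
  obtain ⟨F₀, hF₀, d0, eF₀⟩ := f1.exists_ofCont hL hF₁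
  have m0 : (0 : ℝ) ∈ Set.Icc 0 L := ⟨le_rfl, hL.le⟩
  have mL : L ∈ Set.Icc 0 L := ⟨hL.le, le_rfl⟩
  rw [eF₀] at t0 tL
  rw [eF₁] at t1
  refine ⟨F₀, F₁, F₂, _, hF₀, hF₁, d0, d1, d2, (hasTrace_ofCont hF₀ 0).unique hL m0 t0,
    (hasTrace_ofCont hF₀ L).unique hL mL tL, (hasTrace_ofCont hF₁ 0).unique hL m0 t1, ?_,
    eF₀, eF₁⟩
  intro x hx
  have q0 := (ofCont_eq_iff hL hP₀ hF₀).mp (eP₀.symm.trans eF₀) (L - x)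
    ⟨by linarith [hx.2], by linarith [hx.1]⟩
  have q1 := (ofCont_eq_iff hL hP₁ hF₁).mp (eP₁.symm.trans eF₁) x hx
  rw [q0, q1]
  ring

theorem isEigenvectorA_iff {μ : ℂ} {e : X0 L} : IsEigenvectorA L μ e ↔
    (e.fst ∈ compDomain L 0 ∧ e.snd ∈ compDomain L L) ∧
      minusD L e.snd = μ • e.fst ∧ minusD L e.fst = μ • e.snd := by
  constructor
  · rintro ⟨h, he⟩
    exact ⟨h, congrArg WithLp.fst he, congrArg WithLp.snd he⟩
  · rintro ⟨h, h1, h2⟩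
    exact ⟨h, WithLp.ofLp_injective 2 (Prod.ext h1 h2)⟩

theorem IsEigB.smul {lam : ℝ} {f : L2 L} (h : IsEigB L lam f) (c : ℂ) :
    IsEigB L lam (c • f) := by
  refine ⟨(compDomain L 0).smul_mem c h.1, ?_⟩
  rw [minusD_smul c h.1.1, h.2, map_smul, smul_neg, smul_comm]

theorem IsEigB.isEigenvectorA {lam : ℝ} {f : L2 L} (h : IsEigB L lam f) (s : ℂ) (hs : s * s = -1) :
    IsEigenvectorA L (s * lam) (WithLp.toLp 2 (f, s • refl L f)) := by
  rw [isEigenvectorA_iff]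
  have hr : refl L f ∈ compDomain L L := by simpa using refl_mem_compDomain h.1
  refine ⟨⟨h.1, (compDomain L L).smul_mem s hr⟩, ?_, ?_⟩
  · change minusD L (s • refl L f) = (s * lam) • f
    rw [minusD_smul s hr.1, minusD_refl h.1.1, h.2, map_neg, map_smul, refl_refl, neg_neg, smul_smul]
  · change minusD L f = (s * lam) • s • refl L f
    rw [h.2, smul_smul, ← neg_smul]
    congr 1
    linear_combination -(lam : ℂ) * hs

/-- An eigenvector of `A` splits into eigenvectors of `B`. -/
theorem IsEigenvectorA.exists_split {lam : ℝ} {e : X0 L}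
    (h : IsEigenvectorA L (Complex.I * lam) e) :
    ∃ f g : L2 L, IsEigB L lam f ∧ IsEigB L (-lam) g ∧ e.fst = f + g ∧
      e.snd = Complex.I • refl L f - Complex.I • refl L g := by
  rw [isEigenvectorA_iff] at h
  obtain ⟨⟨h1, h2⟩, h3, h4⟩ := h
  have hr : refl L e.snd ∈ compDomain L 0 := by simpa using refl_mem_compDomain h2
  have hD : minusD L (refl L e.snd) = -((Complex.I * lam) • refl L e.fst) := by
    rw [minusD_refl h2.1, h3, map_smul]
  -- The two parts are `(fst + s refl snd) / 2`; the choice `s = -i` belongs to the eigenvalue `λ`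
  -- of `B`, and `s = i` to `-λ`.
  have key : ∀ s : ℂ, s * s = -1 → minusD L ((1 / 2 : ℂ) • (e.fst + s • refl L e.snd)) =
      (s * Complex.I * lam) • -((1 / 2 : ℂ) • refl L (e.fst + s • refl L e.snd)) := by
    intro s hs
    rw [minusD_smul _ ((compDomain L 0).add_mem h1 ((compDomain L 0).smul_mem s hr)).1,
      minusD_add h1.1 ((compDomain L 0).smul_mem s hr).1, minusD_smul _ hr.1, h4, hD, map_add,
      map_smul, refl_refl]
    simp only [smul_add, smul_neg, smul_smul, neg_add]
    rw [add_comm]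
    congr 1
    · rw [← neg_smul, ← neg_smul]
      congr 1; ring
    · rw [← neg_smul]
      congr 1
      linear_combination (1 / 2 : ℂ) * (Complex.I * lam) * hs
  refine ⟨(1 / 2 : ℂ) • (e.fst + (-Complex.I) • refl L e.snd),
    (1 / 2 : ℂ) • (e.fst + Complex.I • refl L e.snd), ⟨?_, ?_⟩, ⟨?_, ?_⟩, ?_, ?_⟩
  · exact (compDomain L 0).smul_mem _ ((compDomain L 0).add_mem h1 ((compDomain L 0).smul_mem _ hr))
  · rw [key _ (by simp), map_smul, smul_neg]
    simp
  · exact (compDomain L 0).smul_mem _ ((compDomain L 0).add_mem h1 ((compDomain L 0).smul_mem _ hr))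
  · rw [key _ (by simp), map_smul, smul_neg]
    simp
  · module
  · simp only [map_smul, map_add, refl_refl]
    simp only [smul_add, smul_smul]
    have : Complex.I * (1 / 2 * Complex.I) = -(1 / 2) := by
      linear_combination (1 / 2 : ℂ) * Complex.I_mul_I
    have h' : Complex.I * (1 / 2 * -Complex.I) = 1 / 2 := by
      linear_combination -(1 / 2 : ℂ) * Complex.I_mul_I
    rw [this, h']
    module

theorem IsEigB.inner_eq_zero (hL : 0 < L) {a b : ℝ} {f g : L2 L} (hf : IsEigB L a f)
    (hg : IsEigB L b g) (hab : a ≠ b) : inner ℂ f g = 0 := by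
  have h := inner_refl_minusD hL hf.1 hg.1
  rw [hf.2, hg.2, map_neg, map_neg, map_smul, map_smul, refl_refl, refl_refl, inner_neg_left,
    inner_neg_right, inner_smul_left, inner_smul_right, Complex.conj_ofReal, neg_inj] at h
  have : ((a : ℂ) - b) * inner ℂ f g = 0 := by rw [sub_mul, h, sub_self]
  rcases mul_eq_zero.mp this with h' | h'
  · exact absurd (by exact_mod_cast sub_eq_zero.mp h') hab
  · exact h'

end Eigen

/-! ### Third order equations with constant coefficients -/

section ConstantCoefficients

theorem exists_eq_exp {r : ℂ} {q : ℝ → ℂ} {L : ℝ}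
    (h : ∀ x ∈ Set.Icc 0 L, HasDerivAt q (r * q x) x) (y₀ : ℝ) :
    ∃ c : ℂ, ∀ x ∈ Set.Icc 0 L, q x = c * Complex.exp (r * (x - y₀ : ℝ)) := by
  have hd : ∀ x ∈ Set.Icc 0 L,
      HasDerivAt (fun x : ℝ => q x * Complex.exp (-(r * (x - y₀ : ℝ)))) 0 x := by
    intro x hx
    have h1 : HasDerivAt (fun x : ℝ => ((x - y₀ : ℝ) : ℂ)) ((1 : ℝ) : ℂ) x :=
      ((hasDerivAt_id x).sub_const y₀).ofReal_comp
    have h2 := (h x hx).mul ((h1.const_mul r).neg.cexp)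
    refine h2.congr_deriv ?_
    simp only [Complex.ofReal_one]
    ring
  have hconst : ∀ x ∈ Set.Icc 0 L, q x * Complex.exp (-(r * (x - y₀ : ℝ))) =
      q 0 * Complex.exp (-(r * (0 - y₀ : ℝ))) := by
    refine constant_of_derivWithin_zero
      (fun x hx => (hd x hx).differentiableAt.differentiableWithinAt) fun x hx => ?_
    exact ((hd x ⟨hx.1, hx.2.le⟩).hasDerivWithinAt).derivWithin
      (uniqueDiffOn_Icc (hx.1.trans_lt hx.2) x ⟨hx.1, hx.2.le⟩)
  refine ⟨q 0 * Complex.exp (-(r * (0 - y₀ : ℝ))), fun x hx => ?_⟩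
  rw [← hconst x hx, mul_assoc, ← Complex.exp_add]
  simp

/-- Applying two of the three factors `d/dx - rᵢ` leaves a first order equation for the remaining
root. As the roots are distinct, Lagrange interpolation recovers `p₀` from the three results. -/
theorem exists_eq_sum_exp {L : ℝ} {p₀ p₁ p₂ p₃ : ℝ → ℂ} {r₁ r₂ r₃ : ℂ}
    (d0 : ∀ x ∈ Set.Icc 0 L, HasDerivAt p₀ (p₁ x) x)
    (d1 : ∀ x ∈ Set.Icc 0 L, HasDerivAt p₁ (p₂ x) x)
    (d2 : ∀ x ∈ Set.Icc 0 L, HasDerivAt p₂ (p₃ x) x)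
    (h12 : r₁ ≠ r₂) (h13 : r₁ ≠ r₃) (h23 : r₂ ≠ r₃)
    (ode : ∀ x ∈ Set.Icc 0 L, p₃ x = (r₁ + r₂ + r₃) * p₂ x -
      (r₁ * r₂ + r₁ * r₃ + r₂ * r₃) * p₁ x + r₁ * r₂ * r₃ * p₀ x) (y₀ : ℝ) :
    ∃ c₁ c₂ c₃ : ℂ, ∀ x ∈ Set.Icc 0 L, p₀ x = c₁ * Complex.exp (r₁ * (x - y₀ : ℝ)) +
      c₂ * Complex.exp (r₂ * (x - y₀ : ℝ)) + c₃ * Complex.exp (r₃ * (x - y₀ : ℝ)) := by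
  have key : ∀ r s t : ℂ, r + s + t = r₁ + r₂ + r₃ →
      r * s + r * t + s * t = r₁ * r₂ + r₁ * r₃ + r₂ * r₃ → r * s * t = r₁ * r₂ * r₃ →
      ∃ c : ℂ, ∀ x ∈ Set.Icc 0 L,
        p₂ x - (s + t) * p₁ x + s * t * p₀ x = c * Complex.exp (r * (x - y₀ : ℝ)) := by
    intro r s t e1 e2 e3
    refine exists_eq_exp (fun x hx => ?_) y₀
    refine (((d2 x hx).sub ((d1 x hx).const_mul (s + t))).add
      ((d0 x hx).const_mul (s * t))).congr_deriv ?_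
    rw [ode x hx, ← e1, ← e2, ← e3]
    ring
  obtain ⟨c₁, k1⟩ := key r₁ r₂ r₃ rfl rfl rfl
  obtain ⟨c₂, k2⟩ := key r₂ r₁ r₃ (by ring) (by ring) (by ring)
  obtain ⟨c₃, k3⟩ := key r₃ r₁ r₂ (by ring) (by ring) (by ring)
  have n12 := sub_ne_zero.mpr h12
  have n13 := sub_ne_zero.mpr h13
  have n23 := sub_ne_zero.mpr h23
  refine ⟨c₁ / ((r₁ - r₂) * (r₁ - r₃)), -c₂ / ((r₁ - r₂) * (r₂ - r₃)),
    c₃ / ((r₁ - r₃) * (r₂ - r₃)), fun x hx => ?_⟩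
  rw [div_mul_eq_mul_div, div_mul_eq_mul_div, div_mul_eq_mul_div, neg_mul, ← k1 x hx, ← k2 x hx,
    ← k3 x hx]
  field_simp
  ring

end ConstantCoefficients

/-! ### The real modes of the reflected equation -/

section Modes

variable (ξ β : ℝ)

/-- The oscillating mode and its first three derivatives. -/
def modeA (y : ℝ) : ℝ := Real.cos (ξ * y + Real.pi / 4)
def modeA₁ (y : ℝ) : ℝ := -(ξ * Real.sin (ξ * y + Real.pi / 4))
def modeA₂ (y : ℝ) : ℝ := -(ξ ^ 2 * Real.cos (ξ * y + Real.pi / 4))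
def modeA₃ (y : ℝ) : ℝ := ξ ^ 3 * Real.sin (ξ * y + Real.pi / 4)

def cosH (y : ℝ) : ℝ := Real.cos (Real.pi / 4 - ξ / 2 * y) * Real.cosh (β * y)
def sinH (y : ℝ) : ℝ := Real.sin (Real.pi / 4 - ξ / 2 * y) * Real.sinh (β * y)
-- `cosS` and `sinC` are not solutions; they occur in the odd derivatives of `cosH` and `sinH`.
def cosS (y : ℝ) : ℝ := Real.cos (Real.pi / 4 - ξ / 2 * y) * Real.sinh (β * y)
def sinC (y : ℝ) : ℝ := Real.sin (Real.pi / 4 - ξ / 2 * y) * Real.cosh (β * y)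

/-- The first boundary layer mode is `cosH`; these are its derivatives. -/
def modeC₁ (y : ℝ) : ℝ := ξ / 2 * sinC ξ β y + β * cosS ξ β y
def modeC₂ (y : ℝ) : ℝ := (β ^ 2 - (ξ / 2) ^ 2) * cosH ξ β y + ξ * β * sinH ξ β y
def modeC₃ (y : ℝ) : ℝ := (β ^ 2 - (ξ / 2) ^ 2) * modeC₁ ξ β y +
  ξ * β * (-(ξ / 2) * cosS ξ β y + β * sinC ξ β y)

/-- The second boundary layer mode is `sinH`; these are its derivatives. -/
def modeD₁ (y : ℝ) : ℝ := -(ξ / 2) * cosS ξ β y + β * sinC ξ β y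
def modeD₂ (y : ℝ) : ℝ := (β ^ 2 - (ξ / 2) ^ 2) * sinH ξ β y - ξ * β * cosH ξ β y
def modeD₃ (y : ℝ) : ℝ := (β ^ 2 - (ξ / 2) ^ 2) * modeD₁ ξ β y - ξ * β * modeC₁ ξ β y

theorem hasDerivAt_modeA (y : ℝ) : HasDerivAt (modeA ξ) (modeA₁ ξ y) y := by
  have h : HasDerivAt (fun y => ξ * y + Real.pi / 4) ξ y := by
    simpa using ((hasDerivAt_id y).const_mul ξ).add_const (Real.pi / 4)
  exact h.cos.congr_deriv (by rw [modeA₁]; ring)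

theorem hasDerivAt_modeA₁ (y : ℝ) : HasDerivAt (modeA₁ ξ) (modeA₂ ξ y) y := by
  have h : HasDerivAt (fun y => ξ * y + Real.pi / 4) ξ y := by
    simpa using ((hasDerivAt_id y).const_mul ξ).add_const (Real.pi / 4)
  exact (h.sin.const_mul ξ).neg.congr_deriv (by rw [modeA₂]; ring)

theorem hasDerivAt_modeA₂ (y : ℝ) : HasDerivAt (modeA₂ ξ) (modeA₃ ξ y) y := by
  have h : HasDerivAt (fun y => ξ * y + Real.pi / 4) ξ y := by
    simpa using ((hasDerivAt_id y).const_mul ξ).add_const (Real.pi / 4)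
  exact (h.cos.const_mul (ξ ^ 2)).neg.congr_deriv (by rw [modeA₃]; ring)

theorem hasDerivAt_inner_angle (y : ℝ) :
    HasDerivAt (fun y => Real.pi / 4 - ξ / 2 * y) (-(ξ / 2)) y := by
  simpa using ((hasDerivAt_id y).const_mul (ξ / 2)).const_sub (Real.pi / 4)

theorem hasDerivAt_mul_left (y : ℝ) : HasDerivAt (fun y => β * y) β y := by
  simpa using (hasDerivAt_id y).const_mul β

theorem hasDerivAt_cosH (y : ℝ) : HasDerivAt (cosH ξ β) (modeC₁ ξ β y) y :=
  ((hasDerivAt_inner_angle ξ y).cos.mul (hasDerivAt_mul_left β y).cosh).congr_deriv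
    (by rw [modeC₁, sinC, cosS]; ring)

theorem hasDerivAt_sinH (y : ℝ) : HasDerivAt (sinH ξ β) (modeD₁ ξ β y) y :=
  ((hasDerivAt_inner_angle ξ y).sin.mul (hasDerivAt_mul_left β y).sinh).congr_deriv
    (by rw [modeD₁, sinC, cosS]; ring)

theorem hasDerivAt_cosS (y : ℝ) :
    HasDerivAt (cosS ξ β) (ξ / 2 * sinH ξ β y + β * cosH ξ β y) y :=
  ((hasDerivAt_inner_angle ξ y).cos.mul (hasDerivAt_mul_left β y).sinh).congr_deriv
    (by rw [sinH, cosH]; ring)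

theorem hasDerivAt_sinC (y : ℝ) :
    HasDerivAt (sinC ξ β) (-(ξ / 2) * cosH ξ β y + β * sinH ξ β y) y :=
  ((hasDerivAt_inner_angle ξ y).sin.mul (hasDerivAt_mul_left β y).cosh).congr_deriv
    (by rw [sinH, cosH]; ring)

theorem hasDerivAt_modeC₁ (y : ℝ) : HasDerivAt (modeC₁ ξ β) (modeC₂ ξ β y) y :=
  (((hasDerivAt_sinC ξ β y).const_mul (ξ / 2)).add
    ((hasDerivAt_cosS ξ β y).const_mul β)).congr_deriv (by rw [modeC₂]; ring)

theorem hasDerivAt_modeD₁ (y : ℝ) : HasDerivAt (modeD₁ ξ β) (modeD₂ ξ β y) y :=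
  (((hasDerivAt_cosS ξ β y).const_mul (-(ξ / 2))).add
    ((hasDerivAt_sinC ξ β y).const_mul β)).congr_deriv (by rw [modeD₂]; ring)

theorem hasDerivAt_modeC₂ (y : ℝ) : HasDerivAt (modeC₂ ξ β) (modeC₃ ξ β y) y :=
  (((hasDerivAt_cosH ξ β y).const_mul _).add
    ((hasDerivAt_sinH ξ β y).const_mul _)).congr_deriv (by rw [modeC₃, modeD₁])

theorem hasDerivAt_modeD₂ (y : ℝ) : HasDerivAt (modeD₂ ξ β) (modeD₃ ξ β y) y :=
  (((hasDerivAt_sinH ξ β y).const_mul _).sub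
    ((hasDerivAt_cosH ξ β y).const_mul _)).congr_deriv (by rw [modeD₃])

/-- The phase `π/4` is chosen for this: reflection about the midpoint turns the sine in the odd
derivatives back into the cosine, so a single real mode solves the reflected equation. -/
theorem sin_eq_cos_shift (t : ℝ) : Real.sin (t + Real.pi / 4) = Real.cos (-t + Real.pi / 4) := by
  rw [← Real.cos_pi_div_two_sub]; congr 1; ring

theorem modeA_ode (y : ℝ) : modeA₃ ξ y + modeA₁ ξ y = (ξ ^ 3 - ξ) * modeA ξ (-y) := by
  rw [modeA₃, modeA₁, modeA, sin_eq_cos_shift, mul_neg]; ring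

theorem cos_inner_neg (y : ℝ) :
    Real.cos (Real.pi / 4 - ξ / 2 * -y) = Real.sin (Real.pi / 4 - ξ / 2 * y) := by
  rw [← Real.cos_pi_div_two_sub]; congr 1; ring

theorem sin_inner_neg (y : ℝ) :
    Real.sin (Real.pi / 4 - ξ / 2 * -y) = Real.cos (Real.pi / 4 - ξ / 2 * y) := by
  rw [← Real.sin_pi_div_two_sub]; congr 1; ring

variable {ξ β}

theorem modeC_ode (hβ : β ^ 2 = 3 * ξ ^ 2 / 4 - 1) (y : ℝ) :
    modeC₃ ξ β y + modeC₁ ξ β y = (ξ ^ 3 - ξ) * cosH ξ β (-y) := by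
  rw [modeC₃, modeC₁, cosH, cos_inner_neg, mul_neg, Real.cosh_neg, sinC, cosS]
  linear_combination (β * Real.cos (Real.pi / 4 - ξ / 2 * y) * Real.sinh (β * y) +
    3 / 2 * ξ * Real.sin (Real.pi / 4 - ξ / 2 * y) * Real.cosh (β * y)) * hβ

theorem modeD_ode (hβ : β ^ 2 = 3 * ξ ^ 2 / 4 - 1) (y : ℝ) :
    modeD₃ ξ β y + modeD₁ ξ β y = (ξ ^ 3 - ξ) * sinH ξ β (-y) := by
  rw [modeD₃, modeD₁, modeC₁, sinH, sin_inner_neg, mul_neg, Real.sinh_neg, sinC, cosS]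
  linear_combination (β * Real.sin (Real.pi / 4 - ξ / 2 * y) * Real.cosh (β * y) -
    3 / 2 * ξ * Real.cos (Real.pi / 4 - ξ / 2 * y) * Real.sinh (β * y)) * hβ

end Modes

/-! ### The general solution of the reflected equation -/

section GeneralSolution

open Complex in
-- If `p = F + i F(L - ·)`, then `p - i p(L - ·) = 2F`. This lemma and `exp_mode_layer` compute the
-- effect of that operation on the exponentials, centred at the midpoint.
theorem exp_mode_osc (ξ y : ℝ) : Complex.exp (I * ξ * y) - I * Complex.exp (I * ξ * (-y : ℝ)) =
    ((1 - I) * √2) * (modeA ξ y : ℂ) := by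
  have e1 : (I * ξ * y : ℂ) = ((ξ * y : ℝ) : ℂ) * I := by push_cast; ring
  have e2 : (I * ξ * (-y : ℝ) : ℂ) = ((-(ξ * y) : ℝ) : ℂ) * I := by push_cast; ring
  have h2 : ((√2 : ℝ) : ℂ) * ((√2 : ℝ) : ℂ) = 2 := by
    rw [← ofReal_mul, Real.mul_self_sqrt (by norm_num)]; norm_num
  rw [e1, e2, exp_mul_I, exp_mul_I, ← ofReal_cos, ← ofReal_sin, ← ofReal_cos, ← ofReal_sin,
    Real.cos_neg, Real.sin_neg, modeA, Real.cos_add, Real.cos_pi_div_four, Real.sin_pi_div_four]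
  generalize Real.cos (ξ * y) = c
  generalize Real.sin (ξ * y) = s
  push_cast
  linear_combination -((1 - I) / 2 * (c - s : ℂ)) * h2 + (s : ℂ) * I_mul_I

open Complex in
theorem exp_mode_layer (ξ β y : ℝ) :
    Complex.exp ((-(I * (ξ / 2)) + β) * y) - I * Complex.exp ((-(I * (ξ / 2)) + β) * (-y : ℝ)) =
    ((1 - I) * √2) * (cosH ξ β y : ℂ) + ((1 + I) * √2) * (sinH ξ β y : ℂ) := by
  have e1 : ((-(I * (ξ / 2)) + β) * y : ℂ) =
      ((β * y : ℝ) : ℂ) + ((-(ξ / 2 * y) : ℝ) : ℂ) * I := by push_cast; ring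
  have e2 : ((-(I * (ξ / 2)) + β) * (-y : ℝ) : ℂ) =
      ((-(β * y) : ℝ) : ℂ) + ((ξ / 2 * y : ℝ) : ℂ) * I := by push_cast; ring
  have h2 : ((√2 : ℝ) : ℂ) * ((√2 : ℝ) : ℂ) = 2 := by
    rw [← ofReal_mul, Real.mul_self_sqrt (by norm_num)]; norm_num
  rw [e1, e2, exp_add, exp_add, exp_mul_I, exp_mul_I, ← ofReal_cos, ← ofReal_sin, ← ofReal_cos,
    ← ofReal_sin, ← ofReal_exp, ← ofReal_exp, ← Real.cosh_add_sinh (β * y),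
    ← Real.cosh_add_sinh (-(β * y)), Real.cosh_neg, Real.sinh_neg,
    Real.cos_neg, Real.sin_neg, cosH, sinH, Real.cos_sub, Real.sin_sub, Real.cos_pi_div_four,
    Real.sin_pi_div_four]
  generalize Real.cos (ξ / 2 * y) = c
  generalize Real.sin (ξ / 2 * y) = s
  generalize Real.cosh (β * y) = C
  generalize Real.sinh (β * y) = S
  push_cast
  linear_combination (-(1 - I) / 2 * ((c + s) * C) - (1 + I) / 2 * (c - s) * S) * h2 -
    s * (C - S) * I_mul_I

open Complex in
/-- The solutions of `F''' + F' = λ F(L - ·)` on `[0,L]`, where `λ = ξ³ - ξ`. -/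
theorem exists_eq_modes {L ξ β : ℝ} (hβ : β ^ 2 = 3 * ξ ^ 2 / 4 - 1) (hβ0 : β ≠ 0)
    {F₀ F₁ F₂ F₃ : ℝ → ℂ}
    (d0 : ∀ x, HasDerivAt F₀ (F₁ x) x) (d1 : ∀ x, HasDerivAt F₁ (F₂ x) x)
    (d2 : ∀ x, HasDerivAt F₂ (F₃ x) x)
    (ode : ∀ x ∈ Set.Icc 0 L, F₃ x + F₁ x = ((ξ ^ 3 - ξ : ℝ) : ℂ) * F₀ (L - x)) :
    ∃ A C D : ℂ, ∀ x ∈ Set.Icc 0 L, F₀ x = A * modeA ξ (x - L / 2) +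
      C * cosH ξ β (x - L / 2) + D * sinH ξ β (x - L / 2) := by
  have hm : ∀ x ∈ Set.Icc 0 L, L - x ∈ Set.Icc 0 L := fun x hx =>
    ⟨by linarith [hx.2], by linarith [hx.1]⟩
  have hr : ∀ {G G' : ℝ → ℂ}, (∀ x, HasDerivAt G (G' x) x) → ∀ x,
      HasDerivAt (fun x => G (L - x)) (-G' (L - x)) x := by
    intro G G' h x
    simpa using (h (L - x)).comp_const_sub L x
  have hβc : (β : ℂ) ^ 2 = 3 * (ξ : ℂ) ^ 2 / 4 - 1 := by exact_mod_cast congrArg ofReal hβ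
  have hβn : (β : ℂ) ≠ 0 := by exact_mod_cast hβ0
  have hre : ∀ s : ℝ, s ≠ 0 → I * (ξ : ℂ) ≠ -(I * (ξ / 2)) + s := by
    intro s hs h
    have := congrArg re h
    simp at this
    exact hs this.symm
  -- `p = F + i F(L - ·)` satisfies `p''' + p' = -iλ p`. The three roots are distinct because `β ≠
  -- 0`.
  obtain ⟨c₁, c₂, c₃, hc⟩ := exists_eq_sum_exp (L := L) (r₁ := I * ξ) (r₂ := -(I * (ξ / 2)) + β)
    (r₃ := -(I * (ξ / 2)) + ((-β : ℝ) : ℂ))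
    (p₀ := fun x => F₀ x + I * F₀ (L - x)) (p₁ := fun x => F₁ x + I * -F₁ (L - x))
    (p₂ := fun x => F₂ x + I * F₂ (L - x)) (p₃ := fun x => F₃ x + I * -F₃ (L - x))
    (fun x _ => (d0 x).add ((hr d0 x).const_mul I))
    (fun x _ => ((d1 x).add ((hr d1 x).neg.const_mul I)).congr_deriv (by ring))
    (fun x _ => (d2 x).add ((hr d2 x).const_mul I))
    (hre β hβ0) (hre (-β) (neg_ne_zero.mpr hβ0))
    (by
      intro h
      have := congrArg re h
      simp at this
      exact hβ0 (by linarith))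
    (fun x hx => by
      have o1 := ode x hx
      have o2 := ode (L - x) (hm x hx)
      rw [sub_sub_cancel] at o2
      push_cast at o1 o2 ⊢
      linear_combination o1 - I * o2 +
        (-(F₁ x - I * F₁ (L - x)) + I * ξ * (F₀ x + I * F₀ (L - x))) * hβc +
        ((ξ ^ 3 - ξ) * F₀ (L - x) - 3 / 4 * ξ ^ 2 * (F₁ x - I * F₁ (L - x)) -
          I * ξ ^ 3 / 4 * (F₀ x + I * F₀ (L - x))) * I_mul_I) (L / 2)
  -- Read off from `F = (p - i p(L - ·)) / 2`; `cosH` is even in `β` and `sinH` is odd, hence the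
  -- sum and the difference of `c₂` and `c₃`.
  refine ⟨(1 - I) * √2 * c₁ / 2, ((1 - I) * √2 * c₂ + (1 - I) * √2 * c₃) / 2,
    ((1 + I) * √2 * c₂ - (1 + I) * √2 * c₃) / 2, fun x hx => ?_⟩
  have k1 := hc x hx
  have k2 := hc (L - x) (hm x hx)
  simp only [sub_sub_cancel] at k2
  rw [show L - x - L / 2 = -(x - L / 2) by ring] at k2
  have m1 := exp_mode_osc ξ (x - L / 2)
  have m2 := exp_mode_layer ξ β (x - L / 2)
  have m3 := exp_mode_layer ξ (-β) (x - L / 2)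
  have t1 : cosH ξ (-β) (x - L / 2) = cosH ξ β (x - L / 2) := by
    rw [cosH, cosH, neg_mul, Real.cosh_neg]
  have t2 : sinH ξ (-β) (x - L / 2) = -sinH ξ β (x - L / 2) := by
    rw [sinH, sinH, neg_mul, Real.sinh_neg, mul_neg]
  rw [t1, t2] at m3
  simp only [ofReal_neg] at k1 k2 m1 m2 m3
  linear_combination k1 / 2 - I * k2 / 2 + c₁ / 2 * m1 + c₂ / 2 * m2 + c₃ / 2 * m3 +
    F₀ x / 2 * I_mul_I

end GeneralSolution

/-! ### Boundary conditions and the characteristic function -/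

section Characteristic

/-- The decay rate of the boundary layers. -/
def bet (ξ : ℝ) : ℝ := √(3 * ξ ^ 2 / 4 - 1)

theorem bet_sq {ξ : ℝ} (hξ : 2 ≤ |ξ|) : bet ξ ^ 2 = 3 * ξ ^ 2 / 4 - 1 := by
  refine Real.sq_sqrt ?_
  have : 2 ^ 2 ≤ ξ ^ 2 := by rw [← sq_abs ξ]; gcongr
  linarith

theorem bet_pos {ξ : ℝ} (hξ : 2 ≤ |ξ|) : 0 < bet ξ := by
  refine Real.sqrt_pos.mpr ?_
  have : 2 ^ 2 ≤ ξ ^ 2 := by rw [← sq_abs ξ]; gcongr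
  linarith

theorem bet_neg (ξ : ℝ) : bet (-ξ) = bet ξ := by rw [bet, bet, neg_sq]

variable (L ξ : ℝ)

/-- These coefficients are forced by `eta = 0` at `±L/2`: there the angle of `modeA` is that of the
layers shifted by `±3ξL/4`, and the addition formula for the cosine separates the two layers. -/
def layerC : ℝ := -(Real.cos (3 * ξ * L / 4) / Real.cosh (bet ξ * (L / 2)))
def layerD : ℝ := Real.sin (3 * ξ * L / 4) / Real.sinh (bet ξ * (L / 2))

/-- The solution vanishing at both ends, in the variable centred at the midpoint, and its
derivatives. -/
def eta (y : ℝ) : ℝ :=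
  modeA ξ y + layerC L ξ * cosH ξ (bet ξ) y + layerD L ξ * sinH ξ (bet ξ) y
def eta₁ (y : ℝ) : ℝ :=
  modeA₁ ξ y + layerC L ξ * modeC₁ ξ (bet ξ) y + layerD L ξ * modeD₁ ξ (bet ξ) y
def eta₂ (y : ℝ) : ℝ :=
  modeA₂ ξ y + layerC L ξ * modeC₂ ξ (bet ξ) y + layerD L ξ * modeD₂ ξ (bet ξ) y
def eta₃ (y : ℝ) : ℝ :=
  modeA₃ ξ y + layerC L ξ * modeC₃ ξ (bet ξ) y + layerD L ξ * modeD₃ ξ (bet ξ) y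

theorem hasDerivAt_eta (y : ℝ) : HasDerivAt (eta L ξ) (eta₁ L ξ y) y :=
  ((hasDerivAt_modeA ξ y).add ((hasDerivAt_cosH ξ _ y).const_mul _)).add
    ((hasDerivAt_sinH ξ _ y).const_mul _)

theorem hasDerivAt_eta₁ (y : ℝ) : HasDerivAt (eta₁ L ξ) (eta₂ L ξ y) y :=
  ((hasDerivAt_modeA₁ ξ y).add ((hasDerivAt_modeC₁ ξ _ y).const_mul _)).add
    ((hasDerivAt_modeD₁ ξ _ y).const_mul _)

theorem hasDerivAt_eta₂ (y : ℝ) : HasDerivAt (eta₂ L ξ) (eta₃ L ξ y) y :=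
  ((hasDerivAt_modeA₂ ξ y).add ((hasDerivAt_modeC₂ ξ _ y).const_mul _)).add
    ((hasDerivAt_modeD₂ ξ _ y).const_mul _)

theorem continuous_eta : Continuous (eta L ξ) :=
  continuous_iff_continuousAt.mpr fun y => (hasDerivAt_eta L ξ y).continuousAt

theorem continuous_eta₁ : Continuous (eta₁ L ξ) :=
  continuous_iff_continuousAt.mpr fun y => (hasDerivAt_eta₁ L ξ y).continuousAt

theorem continuous_eta₂ : Continuous (eta₂ L ξ) :=
  continuous_iff_continuousAt.mpr fun y => (hasDerivAt_eta₂ L ξ y).continuousAt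

theorem continuous_eta₃ : Continuous (eta₃ L ξ) := by
  unfold eta₃ modeA₃ modeC₃ modeD₃ modeD₁ modeC₁ cosS sinC
  fun_prop

variable {L ξ}

theorem eta_ode (hξ : 2 ≤ |ξ|) (y : ℝ) :
    eta₃ L ξ y + eta₁ L ξ y = (ξ ^ 3 - ξ) * eta L ξ (-y) := by
  rw [eta₃, eta₁, eta]
  linear_combination modeA_ode ξ y + layerC L ξ * modeC_ode (bet_sq hξ) y +
    layerD L ξ * modeD_ode (bet_sq hξ) y

/-- `F'(0) / β` for the solution `eta`. -/
def charH (L ξ : ℝ) : ℝ :=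
  -(3 * ξ / (2 * bet ξ) * Real.sin (Real.pi / 4 - ξ * L / 2)) +
    Real.cosh (bet ξ * L) / Real.sinh (bet ξ * L) * Real.cos (Real.pi / 4 - ξ * L / 2) -
    (Real.sinh (bet ξ * L))⁻¹ * Real.cos (Real.pi / 4 + ξ * L)

/-- `F'(L) / β` for the solution `eta`. -/
def charD (L ξ : ℝ) : ℝ :=
  -(3 * ξ / (2 * bet ξ) * Real.cos (Real.pi / 4 - ξ * L / 2)) -
    Real.cosh (bet ξ * L) / Real.sinh (bet ξ * L) * Real.sin (Real.pi / 4 - ξ * L / 2) +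
    (Real.sinh (bet ξ * L))⁻¹ * Real.sin (Real.pi / 4 + ξ * L)

/-- Apart from the terms with `1 / sinh`, `(charH, charD)` is a rotation of `(coth(βL), -3ξ/(2β))`,
so its length does not depend on the angle. This gives `|charD|` at a zero of `charH` without
locating the zero. -/
theorem charH_sq_add_charD_sq (L ξ : ℝ) : charH L ξ ^ 2 + charD L ξ ^ 2 =
    (3 * ξ / (2 * bet ξ)) ^ 2 + (Real.cosh (bet ξ * L) / Real.sinh (bet ξ * L)) ^ 2 +
      (Real.sinh (bet ξ * L))⁻¹ * ((Real.sinh (bet ξ * L))⁻¹ -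
      2 * (3 * ξ / (2 * bet ξ)) * Real.sin (3 * ξ * L / 2) -
      2 * (Real.cosh (bet ξ * L) / Real.sinh (bet ξ * L)) * Real.cos (3 * ξ * L / 2)) := by
  have e : 3 * ξ * L / 2 = (Real.pi / 4 + ξ * L) - (Real.pi / 4 - ξ * L / 2) := by ring
  rw [charH, charD, e, Real.sin_sub (Real.pi / 4 + ξ * L), Real.cos_sub (Real.pi / 4 + ξ * L)]
  have h1 := Real.sin_sq_add_cos_sq (Real.pi / 4 - ξ * L / 2)
  have h2 := Real.sin_sq_add_cos_sq (Real.pi / 4 + ξ * L)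
  generalize Real.cosh (bet ξ * L) / Real.sinh (bet ξ * L) = c
  generalize (Real.sinh (bet ξ * L))⁻¹ = s
  generalize 3 * ξ / (2 * bet ξ) = g
  linear_combination (g ^ 2 + c ^ 2) * h1 + s ^ 2 * h2

section Boundary

theorem sinh_layer_pos {L ξ : ℝ} (hL : 0 < L) (hξ : 2 ≤ |ξ|) : 0 < Real.sinh (bet ξ * (L / 2)) :=
  Real.sinh_pos_iff.mpr (mul_pos (bet_pos hξ) (by linarith))

theorem eta_left {L ξ : ℝ} (hL : 0 < L) (hξ : 2 ≤ |ξ|) : eta L ξ (-(L / 2)) = 0 := by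
  have hS := (sinh_layer_pos hL hξ).ne'
  have hC := (Real.cosh_pos (bet ξ * (L / 2))).ne'
  have e1 : ξ * -(L / 2) + Real.pi / 4 = (Real.pi / 4 + ξ * L / 4) - 3 * ξ * L / 4 := by ring
  have e2 : Real.pi / 4 - ξ / 2 * -(L / 2) = Real.pi / 4 + ξ * L / 4 := by ring
  rw [eta, modeA, cosH, sinH, layerC, layerD, mul_neg (bet ξ), Real.cosh_neg, Real.sinh_neg, e1, e2,
    Real.cos_sub (Real.pi / 4 + ξ * L / 4)]
  generalize Real.cosh (bet ξ * (L / 2)) = C at *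
  generalize Real.sinh (bet ξ * (L / 2)) = S at *
  field_simp
  ring

theorem eta_right {L ξ : ℝ} (hL : 0 < L) (hξ : 2 ≤ |ξ|) : eta L ξ (L / 2) = 0 := by
  have hS := (sinh_layer_pos hL hξ).ne'
  have hC := (Real.cosh_pos (bet ξ * (L / 2))).ne'
  have e1 : ξ * (L / 2) + Real.pi / 4 = (Real.pi / 4 - ξ * L / 4) + 3 * ξ * L / 4 := by ring
  have e2 : Real.pi / 4 - ξ / 2 * (L / 2) = Real.pi / 4 - ξ * L / 4 := by ring
  rw [eta, modeA, cosH, sinH, layerC, layerD, e1, e2,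
    Real.cos_add (Real.pi / 4 - ξ * L / 4)]
  generalize Real.cosh (bet ξ * (L / 2)) = C at *
  generalize Real.sinh (bet ξ * (L / 2)) = S at *
  field_simp
  ring

theorem eta₁_left {L ξ : ℝ} (hL : 0 < L) (hξ : 2 ≤ |ξ|) :
    eta₁ L ξ (-(L / 2)) = bet ξ * charH L ξ := by
  have hS := (sinh_layer_pos hL hξ).ne'
  have hC := (Real.cosh_pos (bet ξ * (L / 2))).ne'
  have hb := (bet_pos hξ).ne'
  have e1 : ξ * -(L / 2) + Real.pi / 4 = (Real.pi / 4 + ξ * L / 4) - 3 * ξ * L / 4 := by ring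
  have e2 : Real.pi / 4 - ξ / 2 * -(L / 2) = Real.pi / 4 + ξ * L / 4 := by ring
  have e3 : Real.pi / 4 - ξ * L / 2 = (Real.pi / 4 + ξ * L / 4) - 3 * ξ * L / 4 := by ring
  have e4 : Real.pi / 4 + ξ * L = (Real.pi / 4 + ξ * L / 4) + 3 * ξ * L / 4 := by ring
  have e5 : bet ξ * L = 2 * (bet ξ * (L / 2)) := by ring
  rw [eta₁, charH, modeA₁, modeC₁, modeD₁, sinC, cosS, layerC, layerD, mul_neg (bet ξ),
    Real.cosh_neg, Real.sinh_neg, e1, e2, e3, e4, e5,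
    Real.cos_sub (Real.pi / 4 + ξ * L / 4), Real.cos_add (Real.pi / 4 + ξ * L / 4),
    Real.sin_sub (Real.pi / 4 + ξ * L / 4),
    Real.cosh_two_mul, Real.sinh_two_mul]
  have h := Real.cosh_sq (bet ξ * (L / 2))
  generalize Real.cosh (bet ξ * (L / 2)) = C at *
  generalize Real.sinh (bet ξ * (L / 2)) = S at *
  generalize Real.cos (Real.pi / 4 + ξ * L / 4) = cp
  generalize Real.sin (Real.pi / 4 + ξ * L / 4) = sp
  generalize Real.cos (3 * ξ * L / 4) = ca
  generalize Real.sin (3 * ξ * L / 4) = sa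
  generalize bet ξ = b at *
  field_simp
  linear_combination (-b * (cp * ca - sp * sa)) * h

theorem eta₁_right {L ξ : ℝ} (hL : 0 < L) (hξ : 2 ≤ |ξ|) :
    eta₁ L ξ (L / 2) = bet ξ * charD L ξ := by
  have hS := (sinh_layer_pos hL hξ).ne'
  have hC := (Real.cosh_pos (bet ξ * (L / 2))).ne'
  have hb := (bet_pos hξ).ne'
  have e1 : Real.sin (ξ * (L / 2) + Real.pi / 4) =
      Real.cos (Real.pi / 4 + ξ * L / 4 - 3 * ξ * L / 4) := by
    rw [← Real.cos_pi_div_two_sub]; congr 1; ring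
  have e2 : Real.sin (Real.pi / 4 - ξ / 2 * (L / 2)) = Real.cos (Real.pi / 4 + ξ * L / 4) := by
    rw [← Real.cos_pi_div_two_sub]; congr 1; ring
  have e2' : Real.cos (Real.pi / 4 - ξ / 2 * (L / 2)) = Real.sin (Real.pi / 4 + ξ * L / 4) := by
    rw [← Real.cos_pi_div_two_sub]; congr 1; ring
  have e3 : Real.pi / 4 - ξ * L / 2 = (Real.pi / 4 + ξ * L / 4) - 3 * ξ * L / 4 := by ring
  have e4 : Real.pi / 4 + ξ * L = (Real.pi / 4 + ξ * L / 4) + 3 * ξ * L / 4 := by ring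
  have e5 : bet ξ * L = 2 * (bet ξ * (L / 2)) := by ring
  rw [eta₁, charD, modeA₁, modeC₁, modeD₁, sinC, cosS, layerC, layerD, e1, e2, e2', e3, e4, e5,
    Real.cos_sub (Real.pi / 4 + ξ * L / 4), Real.sin_add (Real.pi / 4 + ξ * L / 4),
    Real.sin_sub (Real.pi / 4 + ξ * L / 4), Real.cosh_two_mul, Real.sinh_two_mul]
  have h := Real.cosh_sq (bet ξ * (L / 2))
  generalize Real.cosh (bet ξ * (L / 2)) = C at *
  generalize Real.sinh (bet ξ * (L / 2)) = S at *
  generalize Real.cos (Real.pi / 4 + ξ * L / 4) = cp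
  generalize Real.sin (Real.pi / 4 + ξ * L / 4) = sp
  generalize Real.cos (3 * ξ * L / 4) = ca
  generalize Real.sin (3 * ξ * L / 4) = sa
  generalize bet ξ = b at *
  field_simp
  linear_combination (b * (sp * ca + cp * sa)) * h

/-- Subtracting `A` times the relations for `eta` leaves a homogeneous system whose matrix is a
rotation times `diag(cosh, sinh)` at `βL/2`, which is invertible. -/
theorem modes_coeff {L ξ : ℝ} (hL : 0 < L) (hξ : 2 ≤ |ξ|) {A C D : ℂ}
    (h1 : A * modeA ξ (-(L / 2)) + C * cosH ξ (bet ξ) (-(L / 2)) +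
      D * sinH ξ (bet ξ) (-(L / 2)) = 0)
    (h2 : A * modeA ξ (L / 2) + C * cosH ξ (bet ξ) (L / 2) + D * sinH ξ (bet ξ) (L / 2) = 0) :
    C = A * layerC L ξ ∧ D = A * layerD L ξ := by
  have hS := (sinh_layer_pos hL hξ).ne'
  have hC := (Real.cosh_pos (bet ξ * (L / 2))).ne'
  have g1 : modeA ξ (-(L / 2)) + layerC L ξ * cosH ξ (bet ξ) (-(L / 2)) +
      layerD L ξ * sinH ξ (bet ξ) (-(L / 2)) = 0 := eta_left hL hξ
  have g2 : modeA ξ (L / 2) + layerC L ξ * cosH ξ (bet ξ) (L / 2) +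
      layerD L ξ * sinH ξ (bet ξ) (L / 2) = 0 := eta_right hL hξ
  have g1' := congrArg (fun t : ℝ => (t : ℂ)) g1
  have g2' := congrArg (fun t : ℝ => (t : ℂ)) g2
  simp only [cosH, sinH, cos_inner_neg, sin_inner_neg, mul_neg (bet ξ), Real.cosh_neg,
    Real.sinh_neg] at h1 h2 g1' g2'
  have hcs := Real.sin_sq_add_cos_sq (Real.pi / 4 - ξ / 2 * (L / 2))
  generalize Real.cos (Real.pi / 4 - ξ / 2 * (L / 2)) = c at *
  generalize Real.sin (Real.pi / 4 - ξ / 2 * (L / 2)) = s at *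
  generalize Real.cosh (bet ξ * (L / 2)) = Ch at *
  generalize Real.sinh (bet ξ * (L / 2)) = Sh at *
  have hcs' : (s : ℂ) ^ 2 + (c : ℂ) ^ 2 = 1 := by exact_mod_cast hcs
  have hSc : (Sh : ℂ) ≠ 0 := by exact_mod_cast hS
  have hCc : (Ch : ℂ) ≠ 0 := by exact_mod_cast hC
  push_cast at h1 h2 g1' g2'
  constructor
  · refine mul_right_cancel₀ hCc ?_
    linear_combination (s : ℂ) * (h1 - A * g1') + (c : ℂ) * (h2 - A * g2') -
      (C - A * layerC L ξ) * Ch * hcs'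
  · refine mul_right_cancel₀ hSc ?_
    linear_combination -(c : ℂ) * (h1 - A * g1') + (s : ℂ) * (h2 - A * g2') -
      (D - A * layerD L ξ) * Sh * hcs'

end Boundary

end Characteristic

/-! ### Eigenfunctions of the scalar operator -/

section Eigenfunctions

/-- The function `eta`, as an element of `L²(0,L)`. -/
def etaL2 (L ξ : ℝ) : L2 L :=
  ofCont L (fun x => (eta L ξ (x - L / 2) : ℂ))
    (Complex.continuous_ofReal.comp ((continuous_eta L ξ).comp (by fun_prop)))

theorem isEigB_etaL2 {L ξ : ℝ} (hL : 0 < L) (hξ : 2 ≤ |ξ|) (h : charH L ξ = 0) :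
    IsEigB L (ξ ^ 3 - ξ) (etaL2 L ξ) := by
  have hd : ∀ {G G' : ℝ → ℝ}, (∀ y, HasDerivAt G (G' y) y) → ∀ x : ℝ,
      HasDerivAt (fun x => (G (x - L / 2) : ℂ)) (G' (x - L / 2) : ℂ) x := fun hG x =>
    ((hG (x - L / 2)).comp_sub_const x (L / 2)).ofReal_comp
  have hc : ∀ {G : ℝ → ℝ}, Continuous G → Continuous fun x => (G (x - L / 2) : ℂ) := fun hG =>
    Complex.continuous_ofReal.comp (hG.comp (by fun_prop))
  refine isEigB_ofCont hL _ (hc (continuous_eta₁ L ξ)) (hc (continuous_eta₂ L ξ))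
    (hc (continuous_eta₃ L ξ)) (hd (hasDerivAt_eta L ξ)) (hd (hasDerivAt_eta₁ L ξ))
    (hd (hasDerivAt_eta₂ L ξ)) ?_ ?_ ?_ ?_
  · simp [eta_left hL hξ]
  · rw [show L - L / 2 = L / 2 by ring, eta_right hL hξ, Complex.ofReal_zero]
  · simp [eta₁_left hL hξ, h]
  · intro x _
    rw [show L - x - L / 2 = -(x - L / 2) by ring]
    exact_mod_cast eta_ode hξ (x - L / 2)

/-- Of the three free coefficients, the Dirichlet conditions leave one, so the eigenspace is at most
a line; the condition at `0` on the derivative is the characteristic equation. -/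
theorem IsEigB.eq_smul_etaL2 {L ξ : ℝ} (hL : 0 < L) (hξ : 2 ≤ |ξ|) {f : L2 L}
    (h : IsEigB L (ξ ^ 3 - ξ) f) :
    ∃ A : ℂ, f = A • etaL2 L ξ ∧ A * charH L ξ = 0 ∧
      HasTrace L (weakDeriv L f) 0 0 ∧
      HasTrace L (weakDeriv L f) L (A * (bet ξ * charD L ξ : ℝ)) := by
  obtain ⟨F₀, F₁, F₂, F₃, h0, h1, d0, d1, d2, b0, bL, b1, ode, rfl, hw⟩ := h.exists_classical hL
  obtain ⟨A, C, D, hA⟩ := exists_eq_modes (bet_sq hξ) (bet_pos hξ).ne' d0 d1 d2 ode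
  have m0 : (0 : ℝ) ∈ Set.Icc 0 L := ⟨le_rfl, hL.le⟩
  have mL : L ∈ Set.Icc 0 L := ⟨hL.le, le_rfl⟩
  have k0 := hA 0 m0
  have kL := hA L mL
  rw [b0, zero_sub] at k0
  rw [bL, show L - L / 2 = L / 2 by ring] at kL
  obtain ⟨rfl, rfl⟩ := modes_coeff hL hξ k0.symm kL.symm
  have hF : ∀ x ∈ Set.Icc 0 L, F₀ x = A * (eta L ξ (x - L / 2) : ℂ) := by
    intro x hx
    rw [hA x hx, eta]
    push_cast
    ring
  -- `F₀` is known only on `[0,L]`, so derivatives are compared within this interval, which includes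
  -- its ends.
  have hF1 : ∀ x ∈ Set.Icc 0 L, F₁ x = A * (eta₁ L ξ (x - L / 2) : ℂ) := by
    intro x hx
    have e1 := (d0 x).hasDerivWithinAt (s := Set.Icc 0 L)
    have e2 : HasDerivAt (fun x => A * (eta L ξ (x - L / 2) : ℂ))
        (A * (eta₁ L ξ (x - L / 2) : ℂ)) x :=
      (((hasDerivAt_eta L ξ (x - L / 2)).comp_sub_const x (L / 2)).ofReal_comp).const_mul A
    exact (uniqueDiffOn_Icc hL x hx).eq_deriv _ e1
      (e2.hasDerivWithinAt.congr (fun y hy => hF y hy) (hF x hx))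
  refine ⟨A, ?_, ?_, ?_, ?_⟩
  · refine Lp.ext ?_
    filter_upwards [ae_restrict_mem measurableSet_Ioo, coeFn_ofCont (L := L) h0,
      Lp.coeFn_smul A (etaL2 L ξ), coeFn_ofCont (L := L) (F := fun x => (eta L ξ (x - L / 2) : ℂ))
        (Complex.continuous_ofReal.comp ((continuous_eta L ξ).comp (by fun_prop)))]
      with x hx e1 e2 e3
    rw [e1, e2, Pi.smul_apply, etaL2, e3, hF x ⟨hx.1.le, hx.2.le⟩, smul_eq_mul]
  · have := hF1 0 m0
    rw [b1, zero_sub, eta₁_left hL hξ] at this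
    have hb : (bet ξ : ℂ) ≠ 0 := by exact_mod_cast (bet_pos hξ).ne'
    refine mul_left_cancel₀ hb ?_
    rw [mul_zero, this]
    push_cast
    ring
  · rw [hw, ← b1]
    exact hasTrace_ofCont h1 0
  · have := hF1 L mL
    rw [show L - L / 2 = L / 2 by ring, eta₁_right hL hξ] at this
    rw [hw, ← this]
    exact hasTrace_ofCont h1 L

end Eigenfunctions

/-! ### Perturbations small together with their derivative -/

section SmallPerturbations

open Asymptotics

/-- `a(s) = O(1/s)` and `a'(s) → 0` as `s → ∞`. -/
def SmallAtTop (a : ℝ → ℝ) : Prop :=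
  ∃ a' : ℝ → ℝ, (∀ᶠ s in atTop, HasDerivAt a (a' s) s) ∧ (a =O[atTop] fun s => s⁻¹) ∧
    Tendsto a' atTop (𝓝 0)

theorem SmallAtTop.add {a b : ℝ → ℝ} (ha : SmallAtTop a) (hb : SmallAtTop b) :
    SmallAtTop fun s => a s + b s := by
  obtain ⟨a', h1, h2, h3⟩ := ha
  obtain ⟨b', k1, k2, k3⟩ := hb
  exact ⟨fun s => a' s + b' s, by filter_upwards [h1, k1] with s hs ks using hs.add ks, h2.add k2,
    by simpa using h3.add k3⟩

theorem SmallAtTop.neg {a : ℝ → ℝ} (ha : SmallAtTop a) : SmallAtTop fun s => -a s := by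
  obtain ⟨a', h1, h2, h3⟩ := ha
  exact ⟨fun s => -a' s, by filter_upwards [h1] with s hs using hs.neg, h2.neg_left,
    by simpa using h3.neg⟩

theorem SmallAtTop.tendsto {a : ℝ → ℝ} (ha : SmallAtTop a) : Tendsto a atTop (𝓝 0) := by
  obtain ⟨_, _, h2, _⟩ := ha
  exact h2.trans_tendsto tendsto_inv_atTop_zero

theorem SmallAtTop.mul_bounded {a b b' : ℝ → ℝ} {K : ℝ} (ha : SmallAtTop a)
    (hb : ∀ s, HasDerivAt b (b' s) s) (hb1 : ∀ s, |b s| ≤ 1) (hb2 : ∀ s, |b' s| ≤ K) :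
    SmallAtTop fun s => a s * b s := by
  have h0 := ha.tendsto
  obtain ⟨a', h1, h2, h3⟩ := ha
  refine ⟨fun s => a' s * b s + a s * b' s, ?_, ?_, ?_⟩
  · filter_upwards [h1] with s hs using hs.mul (hb s)
  · refine (IsBigO.of_bound 1 (Eventually.of_forall fun s => ?_)).trans h2
    rw [norm_mul, one_mul]
    exact mul_le_of_le_one_right (norm_nonneg _) (hb1 s)
  · have t : Tendsto (fun s => |a' s| + |a s| * K) atTop (𝓝 0) := by
      simpa using h3.abs.add (h0.abs.mul_const K)
    refine squeeze_zero_norm (fun s => ?_) t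
    refine (norm_add_le _ _).trans ?_
    rw [norm_mul, norm_mul]
    exact add_le_add (mul_le_of_le_one_right (norm_nonneg _) (hb1 s))
      (mul_le_mul_of_nonneg_left (hb2 s) (abs_nonneg _))

theorem SmallAtTop.mul_cos {a : ℝ → ℝ} (ha : SmallAtTop a) (p k : ℝ) :
    SmallAtTop fun s => a s * Real.cos (p + k * s) := by
  refine ha.mul_bounded (b' := fun s => -Real.sin (p + k * s) * k) (K := |k|) (fun s => ?_)
    (fun s => Real.abs_cos_le_one _) (fun s => ?_)
  · have : HasDerivAt (fun s => p + k * s) k s := by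
      simpa using ((hasDerivAt_id s).const_mul k).const_add p
    exact this.cos
  · rw [abs_mul, abs_neg]
    exact mul_le_of_le_one_left (abs_nonneg _) (Real.abs_sin_le_one _)

theorem SmallAtTop.mul_sin {a : ℝ → ℝ} (ha : SmallAtTop a) (p k : ℝ) :
    SmallAtTop fun s => a s * Real.sin (p + k * s) := by
  refine ha.mul_bounded (b' := fun s => Real.cos (p + k * s) * k) (K := |k|) (fun s => ?_)
    (fun s => Real.abs_sin_le_one _) (fun s => ?_)
  · have : HasDerivAt (fun s => p + k * s) k s := by
      simpa using ((hasDerivAt_id s).const_mul k).const_add p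
    exact this.sin
  · rw [abs_mul]
    exact mul_le_of_le_one_left (abs_nonneg _) (Real.abs_cos_le_one _)

end SmallPerturbations

/-! ### Asymptotics of the characteristic function -/

section CharAsymptotics

open Asymptotics

theorem two_le_abs {s : ℝ} (hs : 2 ≤ s) : 2 ≤ |s| := hs.trans (le_abs_self s)

theorem le_bet {s : ℝ} (hs : 2 ≤ s) : s / 2 ≤ bet s := by
  have h := bet_sq (two_le_abs hs)
  have hp := bet_pos (two_le_abs hs)
  nlinarith

theorem tendsto_bet : Tendsto bet atTop atTop := by
  refine tendsto_atTop_mono' _ ?_ (tendsto_id.atTop_div_const (by norm_num : (0 : ℝ) < 2))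
  filter_upwards [eventually_ge_atTop 2] with s hs using le_bet hs

theorem hasDerivAt_bet {s : ℝ} (hs : 2 ≤ s) : HasDerivAt bet (3 * s / (4 * bet s)) s := by
  have h1 : HasDerivAt (fun s : ℝ => 3 * s ^ 2 / 4 - 1) (3 * s / 2) s := by
    refine ((((hasDerivAt_id s).pow 2).const_mul 3).div_const 4 |>.sub_const 1).congr_deriv ?_
    simp; ring
  have hp := bet_pos (two_le_abs hs)
  have h2 := h1.sqrt (Real.sqrt_pos.mp hp).ne'
  refine h2.congr_deriv ?_
  change 3 * s / 2 / (2 * bet s) = _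
  field_simp
  norm_num

theorem smallAtTop_ratio : SmallAtTop fun s => √3 - 3 * s / (2 * bet s) := by
  refine ⟨fun s => 3 / 2 * ((bet s) ^ 3)⁻¹, ?_, ?_, ?_⟩
  · filter_upwards [eventually_ge_atTop 2] with s hs
    have hp := bet_pos (two_le_abs hs)
    have h := bet_sq (two_le_abs hs)
    refine ((((hasDerivAt_id s).const_mul 3).div ((hasDerivAt_bet hs).const_mul 2)
      (by positivity)).const_sub (√3)).congr_deriv ?_
    simp only [id]
    field_simp
    linear_combination -4 * h
  · refine IsBigO.of_bound 2 ?_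
    filter_upwards [eventually_ge_atTop 2] with s hs
    have hp := bet_pos (two_le_abs hs)
    have h := bet_sq (two_le_abs hs)
    have hb := le_bet hs
    have h3 : √3 ^ 2 = 3 := Real.sq_sqrt (by norm_num)
    have h30 : 0 ≤ √3 := Real.sqrt_nonneg 3
    have hsq : 0 ≤ √3 * (2 * bet s) := by positivity
    -- Multiplying by the conjugate: by `bet_sq` the leading terms cancel, so the difference is at
    -- most `12 / (3s)`.
    have key : (3 * s - √3 * (2 * bet s)) * (3 * s + √3 * (2 * bet s)) = 12 := by
      linear_combination (-4 * bet s ^ 2) * h3 - 12 * h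
    have hd : 0 ≤ 3 * s - √3 * (2 * bet s) := by
      by_contra hn
      push Not at hn
      nlinarith
    have hle : (3 * s - √3 * (2 * bet s)) * s ≤ 4 := by nlinarith
    have e : √3 - 3 * s / (2 * bet s) = -((3 * s - √3 * (2 * bet s)) / (2 * bet s)) := by
      field_simp
      ring
    rw [e, norm_neg, Real.norm_of_nonneg (by positivity), Real.norm_of_nonneg (by positivity),
      ← div_eq_mul_inv, div_le_div_iff₀ (by positivity) (by positivity)]
    nlinarith
  · have : Tendsto (fun s => ((bet s) ^ 3)⁻¹) atTop (𝓝 0) :=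
      tendsto_inv_atTop_zero.comp ((tendsto_pow_atTop (by norm_num)).comp tendsto_bet)
    simpa using this.const_mul (3 / 2)

variable {L : ℝ}

theorem tendsto_sinh_bet (hL : 0 < L) : Tendsto (fun s => Real.sinh (bet s * L)) atTop atTop := by
  have h1 : Tendsto (fun s => bet s * L) atTop atTop := tendsto_bet.atTop_mul_const hL
  refine tendsto_atTop_mono' _ ?_ h1
  filter_upwards [eventually_ge_atTop 2] with s hs
  exact Real.self_le_sinh_iff.mpr (mul_nonneg (bet_pos (two_le_abs hs)).le hL.le)

theorem tendsto_inv_sinh_bet (hL : 0 < L) :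
    Tendsto (fun s => (Real.sinh (bet s * L))⁻¹) atTop (𝓝 0) :=
  tendsto_inv_atTop_zero.comp (tendsto_sinh_bet hL)

theorem sinh_bet_pos (hL : 0 < L) {s : ℝ} (hs : 2 ≤ s) : 0 < Real.sinh (bet s * L) :=
  Real.sinh_pos_iff.mpr (mul_pos (bet_pos (two_le_abs hs)) hL)

theorem coth_sub_one_le (hL : 0 < L) {s : ℝ} (hs : 2 ≤ s) :
    |Real.cosh (bet s * L) / Real.sinh (bet s * L) - 1| ≤ (Real.sinh (bet s * L))⁻¹ := by
  have h1 := sinh_bet_pos hL hs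
  have h0 : 0 < bet s * L := mul_pos (bet_pos (two_le_abs hs)) hL
  rw [div_sub_one h1.ne', Real.cosh_sub_sinh, abs_of_nonneg (by positivity), div_eq_mul_inv]
  exact mul_le_of_le_one_left (by positivity) (Real.exp_le_one_iff.mpr (by linarith))

theorem tendsto_coth_bet (hL : 0 < L) :
    Tendsto (fun s => Real.cosh (bet s * L) / Real.sinh (bet s * L)) atTop (𝓝 1) := by
  have : Tendsto (fun s => Real.cosh (bet s * L) / Real.sinh (bet s * L) - 1) atTop (𝓝 0) := by
    refine squeeze_zero_norm' ?_ (tendsto_inv_sinh_bet hL)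
    filter_upwards [eventually_ge_atTop 2] with s hs using coth_sub_one_le hL hs
  simpa using this.add_const 1

theorem inv_sinh_isBigO (hL : 0 < L) :
    (fun s => (Real.sinh (bet s * L))⁻¹) =O[atTop] fun s : ℝ => s⁻¹ := by
  refine IsBigO.of_bound (2 / L) ?_
  filter_upwards [eventually_ge_atTop 2] with s hs
  have h1 := sinh_bet_pos hL hs
  have h2 : bet s * L ≤ Real.sinh (bet s * L) :=
    Real.self_le_sinh_iff.mpr (mul_nonneg (bet_pos (two_le_abs hs)).le hL.le)
  have h3 : s / 2 * L ≤ Real.sinh (bet s * L) :=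
    (mul_le_mul_of_nonneg_right (le_bet hs) hL.le).trans h2
  have hs0 : 0 < s := by linarith
  rw [Real.norm_of_nonneg (by positivity), Real.norm_of_nonneg (by positivity)]
  calc (Real.sinh (bet s * L))⁻¹ ≤ (s / 2 * L)⁻¹ := by gcongr
    _ = 2 / L * s⁻¹ := by field_simp

theorem abs_deriv_bet_le {s : ℝ} (hs : 2 ≤ s) : |3 * s / (4 * bet s)| ≤ 3 / 2 := by
  have hp := bet_pos (two_le_abs hs)
  rw [abs_of_nonneg (by positivity), div_le_div_iff₀ (by positivity) (by norm_num)]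
  linarith [le_bet hs]

theorem smallAtTop_inv_sinh (hL : 0 < L) : SmallAtTop fun s => (Real.sinh (bet s * L))⁻¹ := by
  refine ⟨fun s => -(Real.cosh (bet s * L) * (3 * s / (4 * bet s) * L)) /
    Real.sinh (bet s * L) ^ 2, ?_, inv_sinh_isBigO hL, ?_⟩
  · filter_upwards [eventually_ge_atTop 2] with s hs
    exact (((hasDerivAt_bet hs).mul_const L).sinh).inv (sinh_bet_pos hL hs).ne'
  · have t : Tendsto (fun s => |Real.cosh (bet s * L) / Real.sinh (bet s * L)| *
        (Real.sinh (bet s * L))⁻¹ * (3 / 2 * L)) atTop (𝓝 0) := by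
      simpa using ((tendsto_coth_bet hL).abs.mul (tendsto_inv_sinh_bet hL)).mul_const (3 / 2 * L)
    refine squeeze_zero_norm' ?_ t
    filter_upwards [eventually_ge_atTop 2] with s hs
    have h1 := sinh_bet_pos hL hs
    have e : -(Real.cosh (bet s * L) * (3 * s / (4 * bet s) * L)) / Real.sinh (bet s * L) ^ 2 =
        -(Real.cosh (bet s * L) / Real.sinh (bet s * L) * (Real.sinh (bet s * L))⁻¹ *
          (3 * s / (4 * bet s) * L)) := by
      field_simp
    rw [e, norm_neg, norm_mul, norm_mul, norm_mul]
    rw [Real.norm_of_nonneg (inv_nonneg.mpr h1.le), Real.norm_of_nonneg hL.le]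
    have := abs_deriv_bet_le hs
    simp only [Real.norm_eq_abs]
    gcongr

theorem smallAtTop_coth_sub_one (hL : 0 < L) :
    SmallAtTop fun s => Real.cosh (bet s * L) / Real.sinh (bet s * L) - 1 := by
  refine ⟨fun s => -((Real.sinh (bet s * L))⁻¹ ^ 2 * (3 * s / (4 * bet s) * L)), ?_, ?_, ?_⟩
  · filter_upwards [eventually_ge_atTop 2] with s hs
    have h1 := (sinh_bet_pos hL hs).ne'
    have hb := (hasDerivAt_bet hs).mul_const L
    refine ((hb.cosh.div hb.sinh h1).sub_const 1).congr_deriv ?_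
    have hc := Real.cosh_sq (bet s * L)
    have hp := (bet_pos (two_le_abs hs)).ne'
    generalize Real.cosh (bet s * L) = C at *
    generalize Real.sinh (bet s * L) = S at *
    field_simp
    linear_combination -hc
  · refine (IsBigO.of_bound 1 ?_).trans (inv_sinh_isBigO hL)
    filter_upwards [eventually_ge_atTop 2] with s hs
    rw [one_mul, Real.norm_of_nonneg (inv_nonneg.mpr (sinh_bet_pos hL hs).le)]
    exact coth_sub_one_le hL hs
  · have t : Tendsto (fun s => (Real.sinh (bet s * L))⁻¹ ^ 2 * (3 / 2 * L)) atTop (𝓝 0) := by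
      simpa using ((tendsto_inv_sinh_bet hL).pow 2).mul_const (3 / 2 * L)
    refine squeeze_zero_norm' ?_ t
    filter_upwards [eventually_ge_atTop 2] with s hs
    rw [norm_neg, norm_mul, norm_mul, Real.norm_of_nonneg (sq_nonneg _), Real.norm_of_nonneg hL.le]
    have := abs_deriv_bet_le hs
    rw [Real.norm_eq_abs]
    gcongr

/-- With `3s/(2β) → √3` and `coth → 1`, the main part is `cos t - √3 sin t = 2 cos(t + π/3)` at `t =
π/4 - sL/2`. -/
theorem smallAtTop_charH_pos (hL : 0 < L) :
    SmallAtTop fun s => charH L s - 2 * Real.sin (L / 2 * s - Real.pi / 12) := by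
  have h := ((smallAtTop_ratio.mul_sin (Real.pi / 4) (-(L / 2))).add
    ((smallAtTop_coth_sub_one hL).mul_cos (Real.pi / 4) (-(L / 2)))).add
    ((smallAtTop_inv_sinh hL).mul_cos (Real.pi / 4) L).neg
  refine (congrArg SmallAtTop (funext fun s => ?_)).mp h
  have e : L / 2 * s - Real.pi / 12 = Real.pi / 2 - ((Real.pi / 4 - s * L / 2) + Real.pi / 3) := by
    ring
  rw [charH, e, Real.sin_pi_div_two_sub, Real.cos_add (Real.pi / 4 - s * L / 2), Real.cos_pi_div_three,
    Real.sin_pi_div_three, show Real.pi / 4 + -(L / 2) * s = Real.pi / 4 - s * L / 2 by ring,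
    mul_comm L s]
  ring

/-- For `ξ = -s` the ratio tends to `-√3`, so the main part is `2 cos(t - π/3)` at `t = π/4 + sL/2`.
-/
theorem smallAtTop_charH_neg (hL : 0 < L) :
    SmallAtTop fun s => charH L (-s) - 2 * Real.sin (L / 2 * s - -(5 * Real.pi / 12)) := by
  have h := ((smallAtTop_ratio.mul_sin (Real.pi / 4) (L / 2)).neg.add
    ((smallAtTop_coth_sub_one hL).mul_cos (Real.pi / 4) (L / 2))).add
    ((smallAtTop_inv_sinh hL).mul_cos (Real.pi / 4) (-L)).neg
  refine (congrArg SmallAtTop (funext fun s => ?_)).mp h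
  have e : L / 2 * s - -(5 * Real.pi / 12) =
      Real.pi / 2 - -((Real.pi / 4 - -s * L / 2) - Real.pi / 3) := by
    ring
  rw [charH, e, Real.sin_pi_div_two_sub, Real.cos_neg, Real.cos_sub (Real.pi / 4 - -s * L / 2),
    Real.cos_pi_div_three,
    Real.sin_pi_div_three, show Real.pi / 4 + L / 2 * s = Real.pi / 4 - -s * L / 2 by ring,
    show Real.pi / 4 + -L * s = Real.pi / 4 + -s * L by ring, bet_neg]
  ring

/-- `ξ` and `-ξ` are not both characteristic when `|ξ|` is large. -/
theorem eventually_not_charH_both (hL : 0 < L) :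
    ∀ᶠ s in atTop, ¬(charH L s = 0 ∧ charH L (-s) = 0) := by
  have h1 := (smallAtTop_charH_pos hL).tendsto
  have h2 := (smallAtTop_charH_neg hL).tendsto
  filter_upwards [(Metric.tendsto_nhds.mp h1) 1 one_pos, (Metric.tendsto_nhds.mp h2) 1 one_pos]
    with s k1 k2
  rintro ⟨e1, e2⟩
  -- The two limiting sines are the sine and the cosine of one angle; at a common zero both would be
  -- below `1/2` in absolute value.
  have e : L / 2 * s - -(5 * Real.pi / 12) = (L / 2 * s - Real.pi / 12) + Real.pi / 2 := by ring
  rw [e, Real.sin_add_pi_div_two] at k2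
  rw [Real.dist_eq, e1, sub_zero, zero_sub, abs_neg, abs_lt] at k1
  rw [Real.dist_eq, e2, sub_zero, zero_sub, abs_neg, abs_lt] at k2
  nlinarith [Real.sin_sq_add_cos_sq (L / 2 * s - Real.pi / 12)]

end CharAsymptotics

/-! ### Zeros of a perturbed sine -/

section Roots

open Asymptotics

/-- The sum-to-product formula, Jordan's inequality and `cos ≥ 1/2`. What matters is `2/π > 1/2`,
which beats the Lipschitz constant of the perturbation in `exists_roots`. -/
theorem abs_sub_le_of_sin {x y : ℝ} (hx : |x| ≤ Real.pi / 8) (hy : |y| ≤ Real.pi / 8) :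
    2 / Real.pi * |x - y| ≤ |2 * Real.sin x - 2 * Real.sin y| := by
  rw [← mul_sub, Real.sin_sub_sin, abs_mul, abs_mul, abs_mul, abs_two]
  rw [abs_le] at hx hy
  have hpi := Real.pi_pos
  have h1 : 2 / Real.pi * |(x - y) / 2| ≤ |Real.sin ((x - y) / 2)| :=
    Real.mul_abs_le_abs_sin (abs_le.mpr ⟨by linarith, by linarith⟩)
  have h2 : 1 / 2 ≤ |Real.cos ((x + y) / 2)| := by
    refine le_trans ?_ (le_abs_self _)
    rw [← Real.cos_pi_div_three, ← Real.cos_abs ((x + y) / 2)]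
    refine Real.cos_le_cos_of_nonneg_of_le_pi (abs_nonneg _) (by linarith) ?_
    exact abs_le.mpr ⟨by linarith, by linarith⟩
  have h3 : 2 / Real.pi * |x - y| = 2 * (2 * (2 / Real.pi * |(x - y) / 2|) * (1 / 2)) := by
    rw [abs_div, abs_two]; ring
  rw [h3]
  gcongr

/-- Zeros of a small perturbation of `2 sin(l s - θ)`: one for each large half period. -/
theorem exists_roots {l θ : ℝ} (hl : 0 < l) {H : ℝ → ℝ}
    (hH : SmallAtTop fun s => H s - 2 * Real.sin (l * s - θ)) (S₁ : ℝ) :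
    ∃ (S : ℝ) (m₀ : ℤ) (r : ℕ → ℝ) (K : ℝ), S₁ ≤ S ∧ (∀ n, S < r n ∧ H (r n) = 0) ∧
      (∀ s, S < s → H s = 0 → ∃ n, r n = s) ∧ Function.Injective r ∧
      ∀ n : ℕ, |r n - (θ + Real.pi * (m₀ + n)) / l| ≤ K / (n + 1) := by
  have hpi := Real.pi_pos
  have hpi4 := Real.pi_lt_four
  have h0 := hH.tendsto
  obtain ⟨e', hd, hO, he'⟩ := hH
  obtain ⟨C, hC0, hC⟩ := hO.exists_pos
  rw [isBigOWith_iff] at hC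
  -- The bound `1/2` on the perturbation gives a zero in each cell and confines zeros to `|x| ≤
  -- π/8`; the bound `l/2` on its derivative makes them unique; the `O(1/s)` bound locates them.
  have ev := hd.and (((Metric.tendsto_nhds.mp h0) (1 / 2) (by norm_num)).and
    (((Metric.tendsto_nhds.mp he') (l / 2) (by positivity)).and hC))
  obtain ⟨S₀, hS₀⟩ := eventually_atTop.mp ev
  set e : ℝ → ℝ := fun s => H s - 2 * Real.sin (l * s - θ) with he
  set M := max (max S₀ S₁) 1
  obtain ⟨m₀, hm₀⟩ := exists_int_gt ((l * M - θ + Real.pi / 2) / Real.pi)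
  rw [div_lt_iff₀ hpi] at hm₀
  have hM0 : S₀ ≤ M := (le_max_left _ _).trans (le_max_left _ _)
  have hM1 : S₁ ≤ M := (le_max_right _ _).trans (le_max_left _ _)
  have hM2 : 1 ≤ M := le_max_right _ _
  -- The left end of cell `0`: cell `n` is the half period centred at `(θ + π(m₀ + n))/l`, with
  -- coordinate `x ∈ [-π/2, π/2]`.
  set S := (θ + Real.pi * m₀ - Real.pi / 2) / l with hSdef
  have hMS : M ≤ S := by
    rw [hSdef, le_div_iff₀ hl]; linarith
  have hHd : ∀ s, S ≤ s → ContinuousAt H s := by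
    intro s hs
    have h1 := (hS₀ s (by linarith)).1.continuousAt
    have h2 : ContinuousAt (fun s => 2 * Real.sin (l * s - θ)) s := by fun_prop
    have := h1.add h2
    refine this.congr (Eventually.of_forall fun t => ?_)
    simp [he]
  have hlip : ∀ s t, S ≤ s → S ≤ t → |e s - e t| ≤ l / 2 * |s - t| := by
    intro s t hs ht
    refine Convex.norm_image_sub_le_of_norm_hasDerivWithin_le (s := Set.Ici S) (f' := e')
      (fun x hx => (hS₀ x (by linarith [show S ≤ x from hx])).1.hasDerivWithinAt)
      (fun x hx => ?_) (convex_Ici S) ht hs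
    have := (hS₀ x (by linarith [show S ≤ x from hx])).2.2.1
    rw [dist_zero_right] at this
    exact this.le
  -- the coordinate on the cell with index `n`
  set pt : ℕ → ℝ → ℝ := fun n x => (θ + Real.pi * (m₀ + n) + x) / l with hpt
  have hptS : ∀ (n : ℕ) (x : ℝ), -(Real.pi / 2) ≤ x → S + Real.pi * n / l ≤ pt n x := by
    intro n x hx
    simp only [hpt, hSdef]
    rw [← add_div]
    exact div_le_div_of_nonneg_right (by linarith) hl.le
  have hptS' : ∀ (n : ℕ) (x : ℝ), -(Real.pi / 2) ≤ x → S ≤ pt n x := fun n x hx =>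
    le_trans (le_add_of_nonneg_right (by positivity)) (hptS n x hx)
  have hval : ∀ (n : ℕ) (x : ℝ), H (pt n x) =
      (-1) ^ (m₀ + n) * (2 * Real.sin x) + e (pt n x) := by
    intro n x
    have h1 : l * pt n x - θ = x + ((m₀ + n : ℤ) : ℝ) * Real.pi := by
      rw [hpt]; push_cast; field_simp; ring
    have h2 := Real.sin_add_int_mul_pi x (m₀ + n)
    simp only [he]
    rw [h1, h2]
    ring
  have hsgn : ∀ n : ℕ, ((-1 : ℝ) ^ (m₀ + n : ℤ)) * ((-1 : ℝ) ^ (m₀ + n : ℤ)) = 1 := by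
    intro n
    rcases Int.even_or_odd (m₀ + n) with h | h <;> rw [h.neg_one_zpow] <;> norm_num
  have hsabs : ∀ n : ℕ, |((-1 : ℝ) ^ (m₀ + n : ℤ))| = 1 := by
    intro n
    rcases Int.even_or_odd (m₀ + n) with h | h <;> rw [h.neg_one_zpow] <;> norm_num
  have hesmall : ∀ s, S ≤ s → |e s| < 1 / 2 := by
    intro s hs
    have := (hS₀ s (by linarith)).2.1
    rwa [dist_zero_right] at this
  have hzero : ∀ (n : ℕ) (x : ℝ), |x| ≤ Real.pi / 2 → H (pt n x) = 0 →
      |x| ≤ Real.pi / 4 * |e (pt n x)| := by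
    intro n x hx hz
    rw [hval] at hz
    have h1 : |2 * Real.sin x| = |e (pt n x)| := by
      rw [← abs_neg (e (pt n x)), ← eq_neg_of_add_eq_zero_left hz,
        abs_mul ((-1 : ℝ) ^ (m₀ + n : ℤ)), hsabs, one_mul]
    have h2 := Real.mul_abs_le_abs_sin hx
    rw [abs_mul, abs_two] at h1
    rw [← h1]
    calc |x| = Real.pi / 2 * (2 / Real.pi * |x|) := by field_simp
      _ ≤ Real.pi / 2 * |Real.sin x| := by gcongr
      _ = _ := by ring
  have hzero' : ∀ (n : ℕ) (x : ℝ), |x| ≤ Real.pi / 2 → H (pt n x) = 0 → |x| ≤ Real.pi / 8 := by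
    intro n x hx hz
    have h1 := hesmall _ (hptS' n x (abs_le.mp hx).1)
    have h2 := hzero n x hx hz
    nlinarith
  -- Two zeros in one cell would satisfy `(2/π)|x - y| ≤ |x - y|/2`, which forces `x = y` since `π <
  -- 4`.
  have huniq : ∀ (n : ℕ) (x y : ℝ), |x| ≤ Real.pi / 2 → |y| ≤ Real.pi / 2 → H (pt n x) = 0 →
      H (pt n y) = 0 → x = y := by
    intro n x y hx hy zx zy
    have hx8 := hzero' n x hx zx
    have hy8 := hzero' n y hy zy
    have h1 := abs_sub_le_of_sin hx8 hy8
    have h2 := hlip _ _ (hptS' n x (abs_le.mp hx).1) (hptS' n y (abs_le.mp hy).1)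
    have h3 : |2 * Real.sin x - 2 * Real.sin y| = |e (pt n x) - e (pt n y)| := by
      rw [hval] at zx zy
      have : (-1 : ℝ) ^ (m₀ + n : ℤ) * (2 * Real.sin x - 2 * Real.sin y) =
          -(e (pt n x) - e (pt n y)) := by linarith
      rw [← abs_neg (e (pt n x) - e (pt n y)), ← this, abs_mul, hsabs, one_mul]
    have h4 : pt n x - pt n y = (x - y) / l := by rw [hpt]; ring
    rw [h4, abs_div, abs_of_pos hl] at h2
    have h5 : l / 2 * (|x - y| / l) = |x - y| / 2 := by field_simp
    have h6 : 1 / 2 < 2 / Real.pi := by rw [div_lt_div_iff₀ (by norm_num) hpi]; linarith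
    have h7 : |x - y| ≤ 0 := by
      by_contra hn
      push Not at hn
      nlinarith
    exact sub_eq_zero.mp (abs_nonpos_iff.mp h7)
  have hex : ∀ n : ℕ, ∃ x, |x| ≤ Real.pi / 2 ∧ H (pt n x) = 0 := by
    intro n
    -- Once the alternating sign is removed, the values at `∓π/2` are `∓2` up to an error below
    -- `1/2`.
    set G : ℝ → ℝ := fun x => (-1 : ℝ) ^ (m₀ + n : ℤ) * H (pt n x)
    have hG : ContinuousOn G (Set.Icc (-(Real.pi / 2)) (Real.pi / 2)) := by
      intro x hx
      have h1 : ContinuousAt (pt n) x := by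
        rw [hpt]; fun_prop
      have h2 : ContinuousAt (fun x => H (pt n x)) x :=
        ContinuousAt.comp (f := pt n) (g := H) (hHd _ (hptS' n x hx.1)) h1
      exact (h2.const_mul _).continuousWithinAt
    have hGv : ∀ x, G x = 2 * Real.sin x + (-1 : ℝ) ^ (m₀ + n : ℤ) * e (pt n x) := by
      intro x
      simp only [G]
      rw [hval, mul_add, ← mul_assoc, hsgn, one_mul]
    have hGe : ∀ x, -(Real.pi / 2) ≤ x → |(-1 : ℝ) ^ (m₀ + n : ℤ) * e (pt n x)| < 1 / 2 := by
      intro x hx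
      rw [abs_mul, hsabs, one_mul]
      exact hesmall _ (hptS' n x hx)
    have ha : G (-(Real.pi / 2)) ≤ 0 := by
      rw [hGv, Real.sin_neg, Real.sin_pi_div_two]
      linarith [(abs_lt.mp (hGe (-(Real.pi / 2)) le_rfl)).2]
    have hb : 0 ≤ G (Real.pi / 2) := by
      rw [hGv, Real.sin_pi_div_two]
      linarith [(abs_lt.mp (hGe (Real.pi / 2) (by linarith))).1]
    obtain ⟨x, hx, hx0⟩ := intermediate_value_Icc (by linarith) hG ⟨ha, hb⟩
    refine ⟨x, abs_le.mpr ⟨by linarith [hx.1], hx.2⟩, ?_⟩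
    have h1 := hsabs n
    rcases mul_eq_zero.mp hx0 with h | h
    · rw [h] at h1; simp at h1
    · exact h
  choose x hx hxz using hex
  have hx8 : ∀ n, |x n| ≤ Real.pi / 8 := fun n => hzero' n _ (hx n) (hxz n)
  -- The constant combines `|x n| ≤ (π/4) C / pt n (x n)` with `pt n (x n) ≥ min 1 (π/l) * (n + 1)`,
  -- where `S ≥ 1` is used.
  refine ⟨S, m₀, fun n => pt n (x n), Real.pi / 4 * C / (l * min 1 (Real.pi / l)), hM1.trans hMS,
    fun n => ⟨?_, hxz n⟩, ?_, ?_, ?_⟩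
  · rw [hpt, hSdef]
    have := (abs_le.mp (hx8 n)).1
    have hn : (0 : ℝ) ≤ Real.pi * n := by positivity
    simp only
    gcongr
    linarith
  · intro s hs hz
    -- The nearest integer is the index of a cell containing `s`, and `s > S` forces it to be at
    -- least `m₀`.
    set m : ℤ := round ((l * s - θ) / Real.pi) with hm
    have h1 := abs_sub_round ((l * s - θ) / Real.pi)
    rw [← hm] at h1
    have h2 : |l * s - θ - Real.pi * m| ≤ Real.pi / 2 := by
      have : l * s - θ - Real.pi * m = Real.pi * ((l * s - θ) / Real.pi - m) := by field_simp
      rw [this, abs_mul, abs_of_pos hpi]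
      nlinarith
    have hmm : m₀ ≤ m := by
      by_contra hn
      push Not at hn
      have h3 : (m : ℝ) ≤ m₀ - 1 := by exact_mod_cast Int.le_sub_one_of_lt hn
      rw [hSdef, div_lt_iff₀ hl] at hs
      have := (abs_le.mp h2).2
      nlinarith
    obtain ⟨n, hn⟩ := Int.eq_ofNat_of_zero_le (sub_nonneg.mpr hmm)
    have hn' : (m : ℝ) = m₀ + n := by
      have : m = m₀ + n := by omega
      rw [this]; push_cast; ring
    have hs' : s = pt n (l * s - θ - Real.pi * m) := by
      rw [hpt, hn']; field_simp; ring_nf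
    refine ⟨n, ?_⟩
    have hz' := hz
    rw [hs'] at hz'
    simp only
    rw [huniq n _ _ (hx n) h2 (hxz n) hz', ← hs']
  · intro a b hab
    have h1 : (θ + Real.pi * (m₀ + a) + x a) / l = (θ + Real.pi * (m₀ + b) + x b) / l := hab
    rw [div_left_inj' hl.ne'] at h1
    have ha := abs_le.mp (hx8 a)
    have hb := abs_le.mp (hx8 b)
    have h2 : |Real.pi * ((a : ℝ) - b)| < Real.pi * 1 := by
      rw [abs_lt]; constructor <;> linarith
    rw [abs_mul, abs_of_pos hpi] at h2
    have h3 := lt_of_mul_lt_mul_left h2 hpi.le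
    have h4 : |(a : ℤ) - b| < 1 := by exact_mod_cast h3
    have := Int.abs_lt_one_iff.mp h4
    omega
  · intro n
    have h1 := hzero n _ (hx n) (hxz n)
    have hge := hptS n (x n) (abs_le.mp (hx n)).1
    have h2 := (hS₀ (pt n (x n)) (by
      have : (0 : ℝ) ≤ Real.pi * n / l := by positivity
      linarith)).2.2.2
    have hmin : 0 < min 1 (Real.pi / l) := lt_min one_pos (by positivity)
    have h3 : min 1 (Real.pi / l) * (n + 1) ≤ pt n (x n) := by
      have a1 : min 1 (Real.pi / l) * n ≤ Real.pi / l * n := by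
        gcongr; exact min_le_right _ _
      have a2 : min 1 (Real.pi / l) ≤ 1 := min_le_left _ _
      have a3 : Real.pi / l * n = Real.pi * n / l := by ring
      linarith
    have hp : 0 < pt n (x n) := lt_of_lt_of_le (by positivity) h3
    rw [Real.norm_eq_abs, Real.norm_of_nonneg (inv_nonneg.mpr hp.le)] at h2
    have e1 : pt n (x n) - (θ + Real.pi * (m₀ + n)) / l = x n / l := by
      rw [hpt]; ring
    simp only
    rw [e1, abs_div, abs_of_pos hl]
    calc |x n| / l ≤ Real.pi / 4 * (C * (pt n (x n))⁻¹) / l := by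
          gcongr
          exact h1.trans (by gcongr)
      _ ≤ Real.pi / 4 * (C * (min 1 (Real.pi / l) * (n + 1))⁻¹) / l := by gcongr
      _ = Real.pi / 4 * C / (l * min 1 (Real.pi / l)) / (n + 1) := by field_simp

end Roots

/-! ### Norms and boundary derivatives of the eigenfunctions for large `|ξ|` -/

section NormAsymptotics

variable {L : ℝ}

theorem norm_sq_ofCont {F : ℝ → ℂ} (hF : Continuous F) (hL : 0 ≤ L) :
    ‖ofCont L F hF‖ ^ 2 = ∫ x in (0 : ℝ)..L, ‖F x‖ ^ 2 := by
  have h1 : ((‖ofCont L F hF‖ ^ 2 : ℝ) : ℂ) = ((∫ x in (0 : ℝ)..L, ‖F x‖ ^ 2 : ℝ) : ℂ) := by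
    have := inner_self_eq_norm_sq_to_K (𝕜 := ℂ) (ofCont L F hF)
    rw [Complex.ofReal_pow]
    refine this.symm.trans ?_
    rw [L2.inner_def, intervalIntegral.integral_of_le hL, integral_Ioc_eq_integral_Ioo,
      ← integral_complex_ofReal]
    refine integral_congr_ae ?_
    filter_upwards [coeFn_ofCont (L := L) hF] with x hx
    rw [hx, inner_self_eq_norm_sq_to_K]
    simp
  exact_mod_cast h1

theorem continuous_shift {G : ℝ → ℝ} (hG : Continuous G) :
    Continuous fun x => (G (x - L / 2) : ℂ) :=
  Complex.continuous_ofReal.comp (hG.comp (by fun_prop))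

theorem norm_sq_shift {G : ℝ → ℝ} (hG : Continuous G) (hL : 0 ≤ L) :
    ‖ofCont L (fun x => (G (x - L / 2) : ℂ)) (continuous_shift hG)‖ ^ 2 =
      ∫ y in (-(L / 2))..(L / 2), G y ^ 2 := by
  rw [norm_sq_ofCont _ hL]
  have := intervalIntegral.integral_comp_sub_right (a := 0) (b := L) (fun y => G y ^ 2) (L / 2)
  rw [zero_sub, show L - L / 2 = L / 2 by ring] at this
  rw [← this]
  refine intervalIntegral.integral_congr fun x _ => ?_
  simp

theorem continuous_modeA (ξ : ℝ) : Continuous (modeA ξ) := by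
  unfold modeA; fun_prop

/-- Because of the phase `π/4`, the oscillating part of the antiderivative is even and cancels
between `±L/2`; the value is exact. -/
theorem integral_modeA_sq {ξ : ℝ} (hξ : ξ ≠ 0) :
    ∫ y in (-(L / 2))..(L / 2), modeA ξ y ^ 2 = L / 2 := by
  have hd : ∀ y ∈ Set.uIcc (-(L / 2)) (L / 2),
      HasDerivAt (fun y => y / 2 + Real.cos (2 * (ξ * y)) / (4 * ξ)) (modeA ξ y ^ 2) y := by
    intro y _
    have h1 : HasDerivAt (fun y => 2 * (ξ * y)) (2 * ξ) y := by
      simpa using ((hasDerivAt_id y).const_mul ξ).const_mul 2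
    refine (((hasDerivAt_id y).div_const 2).add (h1.cos.div_const (4 * ξ))).congr_deriv ?_
    rw [modeA, Real.cos_sq, show 2 * (ξ * y + Real.pi / 4) = 2 * (ξ * y) + Real.pi / 2 by ring,
      Real.cos_add_pi_div_two]
    field_simp
    ring
  rw [intervalIntegral.integral_eq_sub_of_hasDerivAt hd
    (((continuous_modeA ξ).pow 2).intervalIntegrable _ _)]
  simp only [mul_neg, Real.cos_neg]
  ring

/-- The boundary layers of `eta`. -/
def layers (L ξ y : ℝ) : ℝ :=
  layerC L ξ * cosH ξ (bet ξ) y + layerD L ξ * sinH ξ (bet ξ) y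

theorem continuous_layers (L ξ : ℝ) : Continuous (layers L ξ) := by
  unfold layers cosH sinH; fun_prop

/-- One factor of the square is bounded by `2` and the other by a multiple of `cosh(βy)`; the latter
integrates explicitly and yields the decay `1/β`. -/
theorem layers_sq_le (hL : 0 < L) {ξ : ℝ} (hξ : 2 ≤ |ξ|) {y : ℝ}
    (hy : y ∈ Set.Icc (-(L / 2)) (L / 2)) : layers L ξ y ^ 2 ≤
      2 * ((Real.cosh (bet ξ * (L / 2)))⁻¹ + (Real.sinh (bet ξ * (L / 2)))⁻¹) *
        Real.cosh (bet ξ * y) := by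
  have hb := bet_pos hξ
  have hS := sinh_layer_pos hL hξ
  have hC := Real.cosh_pos (bet ξ * (L / 2))
  have hCy := Real.cosh_pos (bet ξ * y)
  have hyabs : |bet ξ * y| ≤ bet ξ * (L / 2) := by
    rw [abs_mul, abs_of_pos hb]
    exact mul_le_mul_of_nonneg_left (abs_le.mpr hy) hb.le
  have h1 : Real.cosh (bet ξ * y) ≤ Real.cosh (bet ξ * (L / 2)) := by
    rw [Real.cosh_le_cosh]
    exact hyabs.trans (le_abs_self _)
  have h2 : |Real.sinh (bet ξ * y)| ≤ Real.sinh (bet ξ * (L / 2)) := by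
    rw [Real.abs_sinh]
    exact Real.sinh_le_sinh.mpr hyabs
  have h3 : |Real.sinh (bet ξ * y)| ≤ Real.cosh (bet ξ * y) := by
    rw [Real.abs_sinh, ← Real.cosh_abs (bet ξ * y)]
    exact (Real.sinh_lt_cosh _).le
  have ha : |layerC L ξ * cosH ξ (bet ξ) y| ≤
      (Real.cosh (bet ξ * (L / 2)))⁻¹ * Real.cosh (bet ξ * y) := by
    rw [layerC, cosH, abs_mul, abs_neg, abs_div, abs_mul, abs_of_pos hC, abs_of_pos hCy,
      div_eq_inv_mul]
    have t1 := Real.abs_cos_le_one (3 * ξ * L / 4)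
    have t2 := Real.abs_cos_le_one (Real.pi / 4 - ξ / 2 * y)
    calc _ ≤ (Real.cosh (bet ξ * (L / 2)))⁻¹ * 1 * (1 * Real.cosh (bet ξ * y)) := by gcongr
      _ = _ := by ring
  have hb' : |layerD L ξ * sinH ξ (bet ξ) y| ≤
      (Real.sinh (bet ξ * (L / 2)))⁻¹ * |Real.sinh (bet ξ * y)| := by
    rw [layerD, sinH, abs_mul, abs_div, abs_mul, abs_of_pos hS, div_eq_inv_mul]
    have t1 := Real.abs_sin_le_one (3 * ξ * L / 4)
    have t2 := Real.abs_sin_le_one (Real.pi / 4 - ξ / 2 * y)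
    calc _ ≤ (Real.sinh (bet ξ * (L / 2)))⁻¹ * 1 * (1 * |Real.sinh (bet ξ * y)|) := by gcongr
      _ = _ := by ring
  have ha1 : (Real.cosh (bet ξ * (L / 2)))⁻¹ * Real.cosh (bet ξ * y) ≤ 1 := by
    rw [inv_mul_le_iff₀ hC, mul_one]; exact h1
  have hb1 : (Real.sinh (bet ξ * (L / 2)))⁻¹ * |Real.sinh (bet ξ * y)| ≤ 1 := by
    rw [inv_mul_le_iff₀ hS, mul_one]; exact h2
  have hb2 : (Real.sinh (bet ξ * (L / 2)))⁻¹ * |Real.sinh (bet ξ * y)| ≤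
      (Real.sinh (bet ξ * (L / 2)))⁻¹ * Real.cosh (bet ξ * y) := by gcongr
  have hsum := abs_add_le (layerC L ξ * cosH ξ (bet ξ) y) (layerD L ξ * sinH ξ (bet ξ) y)
  rw [layers, ← sq_abs]
  have hn := abs_nonneg (layerC L ξ * cosH ξ (bet ξ) y + layerD L ξ * sinH ξ (bet ξ) y)
  nlinarith

theorem integral_layers_sq_le (hL : 0 < L) {ξ : ℝ} (hξ : 2 ≤ |ξ|) :
    ∫ y in (-(L / 2))..(L / 2), layers L ξ y ^ 2 ≤ 8 / bet ξ := by
  have hb := bet_pos hξ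
  have hS := sinh_layer_pos hL hξ
  have hC := Real.cosh_pos (bet ξ * (L / 2))
  have hint : ∫ y in (-(L / 2))..(L / 2), Real.cosh (bet ξ * y) =
      2 * Real.sinh (bet ξ * (L / 2)) / bet ξ := by
    rw [intervalIntegral.integral_eq_sub_of_hasDerivAt
      (f := fun y => Real.sinh (bet ξ * y) / bet ξ) (fun y _ => by
        refine (((hasDerivAt_mul_left (bet ξ) y).sinh).div_const _).congr_deriv ?_
        field_simp) ((by fun_prop : Continuous fun y => Real.cosh (bet ξ * y)).intervalIntegrable _ _)]
    simp only [mul_neg, Real.sinh_neg]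
    ring
  calc ∫ y in (-(L / 2))..(L / 2), layers L ξ y ^ 2
      ≤ ∫ y in (-(L / 2))..(L / 2), 2 * ((Real.cosh (bet ξ * (L / 2)))⁻¹ +
        (Real.sinh (bet ξ * (L / 2)))⁻¹) * Real.cosh (bet ξ * y) := by
        refine intervalIntegral.integral_mono_on (by linarith)
          (((continuous_layers L ξ).pow 2).intervalIntegrable _ _)
          (Continuous.intervalIntegrable (by fun_prop) _ _) fun y hy => layers_sq_le hL hξ hy
    _ = 4 / bet ξ * (Real.sinh (bet ξ * (L / 2)) / Real.cosh (bet ξ * (L / 2)) + 1) := by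
        rw [intervalIntegral.integral_const_mul, hint]
        field_simp
        ring
    _ ≤ 4 / bet ξ * (1 + 1) := by
        gcongr
        rw [div_le_one hC]
        exact (Real.sinh_lt_cosh _).le
    _ = 8 / bet ξ := by ring

theorem abs_norm_etaL2_sub_le (hL : 0 < L) {ξ : ℝ} (hξ : 2 ≤ |ξ|) :
    |‖etaL2 L ξ‖ - √(L / 2)| ≤ √(8 / bet ξ) := by
  have hξ0 : ξ ≠ 0 := by rintro rfl; norm_num at hξ
  set P : L2 L := ofCont L (fun x => (modeA ξ (x - L / 2) : ℂ)) (continuous_shift (continuous_modeA ξ))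
    with hP
  set Q : L2 L := ofCont L (fun x => (layers L ξ (x - L / 2) : ℂ))
    (continuous_shift (continuous_layers L ξ)) with hQ
  have h1 : ‖P‖ = √(L / 2) := by
    rw [← integral_modeA_sq (L := L) hξ0, ← norm_sq_shift (continuous_modeA ξ) hL.le,
      Real.sqrt_sq (norm_nonneg _)]
  have h2 : ‖Q‖ ≤ √(8 / bet ξ) := by
    refine Real.le_sqrt_of_sq_le ?_
    rw [hQ, norm_sq_shift (continuous_layers L ξ) hL.le]
    exact integral_layers_sq_le hL hξ
  have h3 : etaL2 L ξ = P + Q := by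
    refine (eq_ofCont _ ?_).symm
    filter_upwards [Lp.coeFn_add P Q, coeFn_ofCont (L := L) (continuous_shift (continuous_modeA ξ)),
      coeFn_ofCont (L := L) (continuous_shift (continuous_layers L ξ))] with x e1 e2 e3
    rw [e1, Pi.add_apply, e2, e3, eta, layers]
    push_cast
    ring
  rw [← h1]
  refine (abs_norm_sub_norm_le _ _).trans ?_
  rw [h3, add_sub_cancel_left]
  exact h2

theorem bet_abs (ξ : ℝ) : bet |ξ| = bet ξ := by rw [bet, bet, sq_abs]

/-- The filter of large `|ξ|`. -/
abbrev absTop : Filter ℝ := comap (fun ξ : ℝ => |ξ|) atTop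

theorem tendsto_absTop : Tendsto (fun ξ : ℝ => |ξ|) absTop atTop := tendsto_comap

theorem eventually_absTop : ∀ᶠ ξ in absTop, 2 ≤ |ξ| :=
  tendsto_absTop.eventually (eventually_ge_atTop 2)

theorem tendsto_bet_absTop : Tendsto bet absTop atTop :=
  (tendsto_bet.comp tendsto_absTop).congr fun ξ => bet_abs ξ

theorem tendsto_norm_etaL2 (hL : 0 < L) :
    Tendsto (fun ξ => ‖etaL2 L ξ‖) absTop (𝓝 (√(L / 2))) := by
  have h1 : Tendsto (fun ξ => √(8 / bet ξ)) absTop (𝓝 0) := by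
    have : Tendsto (fun ξ => 8 / bet ξ) absTop (𝓝 0) := tendsto_bet_absTop.const_div_atTop 8
    have h := (Real.continuous_sqrt.tendsto 0).comp this
    rw [Real.sqrt_zero] at h
    exact h
  rw [tendsto_iff_dist_tendsto_zero]
  refine squeeze_zero' (Eventually.of_forall fun _ => dist_nonneg) ?_ h1
  filter_upwards [eventually_absTop] with ξ hξ using abs_norm_etaL2_sub_le hL hξ

theorem tendsto_ratio : Tendsto (fun s => 3 * s / (2 * bet s)) atTop (𝓝 √3) := by
  simpa using smallAtTop_ratio.tendsto.const_sub √3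

theorem tendsto_charH_sq_add (hL : 0 < L) :
    Tendsto (fun ξ => charH L ξ ^ 2 + charD L ξ ^ 2) absTop (𝓝 4) := by
  have hg : Tendsto (fun ξ => |3 * ξ / (2 * bet ξ)|) absTop (𝓝 √3) := by
    refine (tendsto_ratio.comp tendsto_absTop).congr' ?_
    filter_upwards [eventually_absTop] with ξ hξ
    rw [Function.comp_apply, bet_abs, abs_div, abs_mul, abs_mul, abs_of_pos (bet_pos hξ)]
    norm_num
  have hc : Tendsto (fun ξ => Real.cosh (bet ξ * L) / Real.sinh (bet ξ * L)) absTop (𝓝 1) :=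
    ((tendsto_coth_bet hL).comp tendsto_absTop).congr fun ξ => by
      rw [Function.comp_apply, bet_abs]
  have hs : Tendsto (fun ξ => (Real.sinh (bet ξ * L))⁻¹) absTop (𝓝 0) :=
    ((tendsto_inv_sinh_bet hL).comp tendsto_absTop).congr fun ξ => by
      rw [Function.comp_apply, bet_abs]
  have hr : Tendsto (fun ξ => (Real.sinh (bet ξ * L))⁻¹ * ((Real.sinh (bet ξ * L))⁻¹ -
      2 * (3 * ξ / (2 * bet ξ)) * Real.sin (3 * ξ * L / 2) -
      2 * (Real.cosh (bet ξ * L) / Real.sinh (bet ξ * L)) * Real.cos (3 * ξ * L / 2)))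
      absTop (𝓝 0) := by
    have t : Tendsto (fun ξ => |(Real.sinh (bet ξ * L))⁻¹| * (|(Real.sinh (bet ξ * L))⁻¹| +
        2 * |3 * ξ / (2 * bet ξ)| + 2 * |Real.cosh (bet ξ * L) / Real.sinh (bet ξ * L)|))
        absTop (𝓝 0) := by
      simpa using hs.abs.mul ((hs.abs.add (hg.const_mul 2)).add (hc.abs.const_mul 2))
    refine squeeze_zero_norm (fun ξ => ?_) t
    rw [norm_mul, Real.norm_eq_abs, Real.norm_eq_abs]
    gcongr
    refine (abs_sub _ _).trans (add_le_add ((abs_sub _ _).trans (add_le_add le_rfl ?_)) ?_)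
    · rw [abs_mul, abs_mul, abs_two]
      exact mul_le_of_le_one_right (by positivity) (Real.abs_sin_le_one _)
    · rw [abs_mul, abs_mul, abs_two]
      exact mul_le_of_le_one_right (by positivity) (Real.abs_cos_le_one _)
  have h := ((hg.pow 2).add (hc.pow 2)).add hr
  have e : √3 ^ 2 + 1 ^ 2 + 0 = 4 := by rw [Real.sq_sqrt (by norm_num)]; norm_num
  rw [e] at h
  refine h.congr fun ξ => ?_
  rw [charH_sq_add_charD_sq, sq_abs]

/-- The boundary derivative of the normalized solution, divided by `|ξ|`. -/
def traceRatio (L ξ : ℝ) : ℝ :=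
  bet ξ * √(charH L ξ ^ 2 + charD L ξ ^ 2) / (|ξ| * ‖etaL2 L ξ‖)

/-- The root of `charH² + charD²` equals `|charD|` at the zeros of `charH` but converges along all
`|ξ| → ∞`. The limits are `β/|ξ| → √3/2`, `√4 = 2` and `‖eta‖ → √(L/2)`. -/
theorem tendsto_traceRatio (hL : 0 < L) :
    Tendsto (traceRatio L) absTop (𝓝 (√3 / √(L / 2))) := by
  have h1 : Tendsto (fun ξ => bet ξ / |ξ|) absTop (𝓝 (3 / (2 * √3))) := by
    have := (tendsto_const_nhds (x := (3 : ℝ))).div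
      ((tendsto_ratio.comp tendsto_absTop).const_mul 2) (by positivity)
    refine this.congr' ?_
    filter_upwards [eventually_absTop] with ξ hξ
    have hb := bet_pos hξ
    have hx : (0 : ℝ) < |ξ| := by linarith
    simp only [Pi.div_apply, Function.comp_apply]
    rw [bet_abs]
    field_simp
  have h2 := (Real.continuous_sqrt.tendsto 4).comp (tendsto_charH_sq_add hL)
  have h3 := (h1.mul h2).div (tendsto_norm_etaL2 hL) (by positivity)
  have e : 3 / (2 * √3) * √4 / √(L / 2) = √3 / √(L / 2) := by
    have : √4 = 2 := by rw [show (4 : ℝ) = 2 ^ 2 by norm_num, Real.sqrt_sq (by norm_num)]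
    rw [this]
    congr 1
    have h3 : √3 * √3 = 3 := Real.mul_self_sqrt (by norm_num)
    field_simp
    linarith
  rw [e] at h3
  refine h3.congr fun ξ => ?_
  simp only [traceRatio, Pi.div_apply, Function.comp_apply]
  rw [div_mul_eq_mul_div, div_div]

theorem trace_smul_eq (hL : 0 < L) {ξ : ℝ} (hξ : 2 ≤ |ξ|) {f : L2 L}
    (h : IsEigB L (ξ ^ 3 - ξ) f) (hf : f ≠ 0) : charH L ξ = 0 ∧
      ∃ c, HasTrace L (weakDeriv L f) L c ∧ ‖c‖ = ‖f‖ * (|ξ| * traceRatio L ξ) := by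
  obtain ⟨A, hA, hAc, -, ht⟩ := h.eq_smul_etaL2 hL hξ
  have hA0 : A ≠ 0 := by rintro rfl; exact hf (by rw [hA, zero_smul])
  have hη : ‖etaL2 L ξ‖ ≠ 0 := by
    rw [norm_ne_zero_iff]; intro h0; exact hf (by rw [hA, h0, smul_zero])
  have hc : charH L ξ = 0 := by
    exact_mod_cast (mul_eq_zero.mp hAc).resolve_left hA0
  refine ⟨hc, _, ht, ?_⟩
  have hx : |ξ| ≠ 0 := by linarith
  rw [hA, norm_smul, norm_mul, traceRatio, hc, Complex.norm_real, Real.norm_eq_abs, abs_mul,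
    abs_of_pos (bet_pos hξ)]
  have : √((0 : ℝ) ^ 2 + charD L ξ ^ 2) = |charD L ξ| := by
    rw [zero_pow two_ne_zero, zero_add, Real.sqrt_sq_eq_abs]
  rw [this]
  field_simp

theorem norm_sq_X0 (e : X0 L) : ‖e‖ ^ 2 = ‖e.fst‖ ^ 2 + ‖e.snd‖ ^ 2 :=
  WithLp.prod_norm_sq_eq_of_L2 e

theorem exists_trace_eq_of_isEigB (hL : 0 < L) {ξ : ℝ} (hξ : 2 ≤ |ξ|) {f : L2 L}
    (h : IsEigB L (ξ ^ 3 - ξ) f) {e : X0 L} {s : ℂ} (hs : ‖s‖ = 1) (he1 : e.fst = f)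
    (he2 : e.snd = s • refl L f) (he : ‖e‖ = 1) :
    charH L ξ = 0 ∧ ‖trace L (weakDeriv L e.fst) L‖ = |ξ| * (traceRatio L ξ / √2) ∧
      ‖trace L (weakDeriv L e.snd) 0‖ = |ξ| * (traceRatio L ξ / √2) := by
  have m0 : (0 : ℝ) ∈ Set.Icc 0 L := ⟨le_rfl, hL.le⟩
  have mL : L ∈ Set.Icc 0 L := ⟨hL.le, le_rfl⟩
  have hn := norm_sq_X0 e
  rw [he, he1, he2, norm_smul, hs, one_mul, LinearIsometry.norm_map] at hn
  -- The two components have the same norm, so each carries half of `‖e‖² = 1`.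
  have hfn : ‖f‖ = 1 / √2 := by
    have h2 : √2 ^ 2 = 2 := Real.sq_sqrt (by norm_num)
    rw [← Real.sqrt_sq (norm_nonneg f), show ‖f‖ ^ 2 = 1 / 2 by linarith, Real.sqrt_div (by norm_num),
      Real.sqrt_one]
  have hf0 : f ≠ 0 := by
    rintro rfl
    rw [norm_zero] at hfn
    have : (0 : ℝ) < 1 / √2 := by positivity
    linarith
  obtain ⟨hc, c, ht, hcn⟩ := trace_smul_eq hL hξ h hf0
  have hval : ‖c‖ = |ξ| * (traceRatio L ξ / √2) := by
    rw [hcn, hfn]; ring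
  refine ⟨hc, ?_, ?_⟩
  · rw [he1, ht.trace_eq hL mL, hval]
  · have ht2 : HasTrace L (weakDeriv L e.snd) 0 (s * -c) := by
      rw [he2, h.1.1.refl.weakDeriv_smul, h.1.1.weakDeriv_refl]
      have := ht.refl.neg.smul s
      rwa [sub_self] at this
    rw [ht2.trace_eq hL m0, norm_mul, hs, one_mul, norm_neg, hval]

/-- The two parts of `e` are eigenvectors of `B` with parameters `ζ` and `-ζ`, where `ζ = ±s`. Were
both nonzero, `charH` would vanish at `s` and at `-s`; so `e` is a single pair. -/
theorem IsEigenvectorA.exists_trace_eq (hL : 0 < L) {s : ℝ} (hs : 2 ≤ s)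
    (hnot : ¬(charH L s = 0 ∧ charH L (-s) = 0)) {lam : ℝ} (hlam : |lam| = s ^ 3 - s) {e : X0 L}
    (he : ‖e‖ = 1) (h : IsEigenvectorA L (Complex.I * lam) e) :
    ∃ ξ, |ξ| = s ∧ ‖trace L (weakDeriv L e.fst) L‖ = s * (traceRatio L ξ / √2) ∧
      ‖trace L (weakDeriv L e.snd) 0‖ = s * (traceRatio L ξ / √2) := by
  obtain ⟨ζ, hζ, hζl, hnot'⟩ : ∃ ζ, |ζ| = s ∧ lam = ζ ^ 3 - ζ ∧
      ¬(charH L ζ = 0 ∧ charH L (-ζ) = 0) := by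
    have hpos : 0 ≤ s ^ 3 - s := hlam ▸ abs_nonneg _
    rcases (abs_eq hpos).mp hlam with h' | h'
    · exact ⟨s, abs_of_nonneg (by linarith), h', hnot⟩
    · exact ⟨-s, by rw [abs_neg, abs_of_nonneg (by linarith)], by rw [h']; ring,
        fun ⟨a, b⟩ => hnot ⟨by rwa [neg_neg] at b, a⟩⟩
  obtain ⟨f, g, hf, hg, e1, e2⟩ := h.exists_split
  have hζ2 : 2 ≤ |ζ| := hζ ▸ hs
  have hζ2' : 2 ≤ |-ζ| := by rwa [abs_neg]
  rw [hζl] at hf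
  rw [hζl, show -(ζ ^ 3 - ζ) = (-ζ) ^ 3 - -ζ by ring] at hg
  have h0 : f = 0 ∨ g = 0 := by
    by_contra hn
    push Not at hn
    exact hnot' ⟨(trace_smul_eq hL hζ2 hf hn.1).1, (trace_smul_eq hL hζ2' hg hn.2).1⟩
  rcases h0 with rfl | rfl
  · have := exists_trace_eq_of_isEigB hL hζ2' hg (e := e) (s := -Complex.I) (by simp)
      (by simpa using e1) (by simpa using e2) he
    refine ⟨-ζ, by rw [abs_neg, hζ], ?_⟩
    rw [abs_neg, hζ] at this
    exact this.2
  · have := exists_trace_eq_of_isEigB hL hζ2 hf (e := e) (s := Complex.I) (by simp)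
      (by simpa using e1) (by simpa using e2) he
    refine ⟨ζ, hζ, ?_⟩
    rw [hζ] at this
    exact this.2

theorem exists_cubic_root {t : ℝ} (ht : 6 ≤ t) : ∃ s, 2 ≤ s ∧ t = s ^ 3 - s := by
  have hc : ContinuousOn (fun s : ℝ => s ^ 3 - s) (Set.Icc 2 t) := by fun_prop
  obtain ⟨s, hs, h⟩ := intermediate_value_Icc (by linarith) hc (show t ∈ Set.Icc _ _ from
    ⟨by norm_num; linarith, by nlinarith [sq_nonneg t]⟩)
  exact ⟨s, hs.1, h.symm⟩

end NormAsymptotics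

/-! ### Passage to the limit in the boundary derivatives -/

section TraceLimit

variable {L : ℝ}

/-- The filter of large `|n|`. -/
abbrev absTopInt : Filter ℤ := comap (fun n : ℤ => |n|) atTop

theorem tendsto_abs_cast_int : Tendsto (fun n : ℤ => |(n : ℝ)|) absTopInt atTop := by
  have : Tendsto (fun n : ℤ => ((|n| : ℤ) : ℝ)) absTopInt atTop :=
    tendsto_intCast_atTop_atTop.comp tendsto_comap
  simpa using this

theorem tendsto_of_pow_three {ι : Type*} {F : Filter ι} {x : ι → ℝ} {a : ℝ} (hx : ∀ᶠ i in F, 0 ≤ x i)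
    (ha : 0 ≤ a) (h : Tendsto (fun i => x i ^ 3) F (𝓝 (a ^ 3))) : Tendsto x F (𝓝 a) := by
  have h1 := h.rpow_const (p := ((3 : ℕ) : ℝ)⁻¹) (Or.inr (by norm_num))
  rw [Real.pow_rpow_inv_natCast ha (by norm_num)] at h1
  refine h1.congr' ?_
  filter_upwards [hx] with i hi
  rw [Real.pow_rpow_inv_natCast hi (by norm_num)]

theorem tendsto_cubic_root {ι : Type*} {F : Filter ι} {t s N : ι → ℝ} {a : ℝ} (ha : 0 < a)
    (hN : Tendsto N F atTop) (ht : Tendsto (fun i => t i / N i ^ 3) F (𝓝 (a ^ 3)))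
    (hs : ∀ᶠ i in F, 2 ≤ s i ∧ t i = s i ^ 3 - s i) :
    Tendsto s F atTop ∧ Tendsto (fun i => s i / N i) F (𝓝 a) := by
  have htop : Tendsto t F atTop := by
    have h1 : Tendsto (fun i => t i / N i ^ 3 * N i ^ 3) F atTop :=
      ht.pos_mul_atTop (by positivity) ((tendsto_pow_atTop (by norm_num)).comp hN)
    refine h1.congr' ?_
    filter_upwards [hN.eventually_gt_atTop 0] with i hi
    field_simp
  have hs_lim : Tendsto s F atTop := by
    rw [tendsto_atTop]
    intro b
    filter_upwards [hs, htop.eventually_gt_atTop (max b 2 ^ 3)] with i hi hti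
    by_contra hn
    push Not at hn
    have h1 : s i ≤ max b 2 := hn.le.trans (le_max_left _ _)
    have h2 : s i ^ 3 ≤ max b 2 ^ 3 := pow_le_pow_left₀ (by linarith) h1 3
    linarith
  refine ⟨hs_lim, tendsto_of_pow_three ?_ ha.le ?_⟩
  · filter_upwards [hs, hN.eventually_gt_atTop 0] with i hi hNi
    have : 0 < s i := by linarith
    positivity
  · have h1 : Tendsto (fun i => 1 - (s i ^ 2)⁻¹) F (𝓝 1) := by
      have := (tendsto_inv_atTop_zero.comp ((tendsto_pow_atTop two_ne_zero).comp hs_lim))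
      simpa using this.const_sub 1
    have h2 := ht.div h1 one_ne_zero
    rw [div_one] at h2
    refine h2.congr' ?_
    filter_upwards [hs, hN.eventually_gt_atTop 0] with i hi hNi
    have hp : 0 < s i := by linarith
    have h4 : s i ^ 2 - 1 ≠ 0 := by nlinarith
    simp only [Pi.div_apply]
    rw [hi.2]
    field_simp

/-- The growth hypothesis involves only `|lam n|`, so the statement serves both families, the second
with `-lam`. -/
theorem tendsto_trace (hL : 0 < L) {lam : ℤ → ℝ} {a : ℝ} (ha : 0 < a)
    (hlam : Tendsto (fun n => |lam n| / |(n : ℝ)| ^ 3) absTopInt (𝓝 (a ^ 3)))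
    {e : ℤ → X0 L} (he : ∀ n, ‖e n‖ = 1)
    (h : ∀ n, IsEigenvectorA L (Complex.I * lam n) (e n)) :
    Tendsto (fun n : ℤ => ‖trace L (weakDeriv L (e n).fst) L‖ / |(n : ℝ)|) absTopInt
        (𝓝 (a * (√3 / √(L / 2) / √2))) ∧
      Tendsto (fun n : ℤ => ‖trace L (weakDeriv L (e n).snd) 0‖ / |(n : ℝ)|) absTopInt
        (𝓝 (a * (√3 / √(L / 2) / √2))) := by
  have hN := tendsto_abs_cast_int
  have htop : Tendsto (fun n => |lam n|) absTopInt atTop := by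
    have h1 : Tendsto (fun n => |lam n| / |(n : ℝ)| ^ 3 * |(n : ℝ)| ^ 3) absTopInt atTop :=
      hlam.pos_mul_atTop (by positivity) ((tendsto_pow_atTop (by norm_num)).comp hN)
    refine h1.congr' ?_
    filter_upwards [hN.eventually_gt_atTop 0] with i hi
    field_simp
  -- For the remaining `n` the parameter is a dummy `0`, which does not affect the limit; `6 = 2³ -
  -- 2`.
  have hex : ∀ n, ∃ s, 6 ≤ |lam n| → 2 ≤ s ∧ |lam n| = s ^ 3 - s := fun n => by
    by_cases h6 : 6 ≤ |lam n|
    · obtain ⟨s, hs⟩ := exists_cubic_root h6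
      exact ⟨s, fun _ => hs⟩
    · exact ⟨0, fun h' => absurd h' h6⟩
  choose s hs using hex
  have hs' : ∀ᶠ n in absTopInt, 2 ≤ s n ∧ |lam n| = s n ^ 3 - s n := by
    filter_upwards [htop.eventually_ge_atTop 6] with n hn using hs n hn
  obtain ⟨hs_lim, hsN⟩ := tendsto_cubic_root ha hN hlam hs'
  have hex2 : ∀ n, ∃ ξ, (2 ≤ s n ∧ |lam n| = s n ^ 3 - s n ∧
      ¬(charH L (s n) = 0 ∧ charH L (-s n) = 0)) → |ξ| = s n ∧
      ‖trace L (weakDeriv L (e n).fst) L‖ = s n * (traceRatio L ξ / √2) ∧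
      ‖trace L (weakDeriv L (e n).snd) 0‖ = s n * (traceRatio L ξ / √2) := fun n => by
    by_cases hc : 2 ≤ s n ∧ |lam n| = s n ^ 3 - s n ∧ ¬(charH L (s n) = 0 ∧ charH L (-s n) = 0)
    · obtain ⟨ξ, hξ⟩ := (h n).exists_trace_eq hL hc.1 hc.2.2 hc.2.1 (he n)
      exact ⟨ξ, fun _ => hξ⟩
    · exact ⟨0, fun h' => absurd h' hc⟩
  choose ξ hξ using hex2
  have hξ' : ∀ᶠ n in absTopInt, |ξ n| = s n ∧
      ‖trace L (weakDeriv L (e n).fst) L‖ = s n * (traceRatio L (ξ n) / √2) ∧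
      ‖trace L (weakDeriv L (e n).snd) 0‖ = s n * (traceRatio L (ξ n) / √2) := by
    filter_upwards [hs', hs_lim.eventually (eventually_not_charH_both hL)] with n h1 h2
    exact hξ n ⟨h1.1, h1.2, h2⟩
  have hξtop : Tendsto ξ absTopInt absTop := by
    rw [tendsto_comap_iff]
    refine hs_lim.congr' ?_
    filter_upwards [hξ'] with n hn using hn.1.symm
  have hlim := hsN.mul (((tendsto_traceRatio hL).comp hξtop).div_const √2)
  constructor
  · refine hlim.congr' ?_
    filter_upwards [hξ'] with n hn
    rw [hn.2.1, Function.comp_apply]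
    ring
  · refine hlim.congr' ?_
    filter_upwards [hξ'] with n hn
    rw [hn.2.2, Function.comp_apply]
    ring

end TraceLimit

/-! ### Cubic growth of the eigenvalues -/

section SpectralAsymptotics

open Asymptotics

variable {L : ℝ}

theorem tendsto_affine_div {ι : Type*} {F : Filter ι} {N : ι → ℝ} (hN : Tendsto N F atTop)
    (p q : ℝ) : Tendsto (fun i => (p + q * N i) / N i) F (𝓝 q) := by
  have h1 : Tendsto (fun i => p / N i + q) F (𝓝 (0 + q)) := (hN.const_div_atTop p).add_const q
  rw [zero_add] at h1
  refine h1.congr' ?_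
  filter_upwards [hN.eventually_gt_atTop 0] with i hi
  field_simp

theorem tendsto_div_pow_three {ι : Type*} {F : Filter ι} {N x : ι → ℝ} {p q : ℝ}
    (hN : Tendsto N F atTop) (h : (fun i => x i - (p + q * N i) ^ 3) =O[F] N) :
    Tendsto (fun i => x i / N i ^ 3) F (𝓝 (q ^ 3)) := by
  have h1 : Tendsto (fun i => (x i - (p + q * N i) ^ 3) / N i ^ 3) F (𝓝 0) := by
    have ho : N =o[F] fun i => N i ^ 3 := by
      have := (isLittleO_pow_pow_atTop_of_lt (𝕜 := ℝ) (show 1 < 3 by norm_num)).comp_tendsto hN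
      simpa [Function.comp_def] using this
    exact (h.trans_isLittleO ho).tendsto_div_nhds_zero
  have h2 := h1.add ((tendsto_affine_div hN p q).pow 3)
  rw [zero_add] at h2
  refine h2.congr fun i => ?_
  rw [div_pow]
  ring

theorem HasSpectralAsymptotics.tendsto_abs (hL : 0 < L) {lam : ℤ → ℝ}
    (h : HasSpectralAsymptotics L lam) :
    Tendsto (fun n => |lam n| / |(n : ℝ)| ^ 3) absTopInt (𝓝 ((2 * Real.pi / L) ^ 3)) := by
  obtain ⟨k₁, k₂, h1, h2⟩ := h
  have hpos : 0 ≤ (2 * Real.pi / L) ^ 3 := by positivity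
  -- Both asymptotic forms are cubes of affine functions of `|n|` with slope `12π/(6L) = 2π/L`; the
  -- integers `k₁`, `k₂` do not affect the limit.
  rw [absTopInt, comap_abs_atTop, tendsto_sup]
  constructor
  · have hN : Tendsto (fun n : ℤ => -(n : ℝ)) atBot atTop :=
      tendsto_neg_atBot_atTop.comp (tendsto_intCast_atBot_iff.mpr tendsto_id)
    have h3 : (fun n : ℤ => -lam n - ((7 * Real.pi + 12 * Real.pi * k₂) / (6 * L) +
        2 * Real.pi / L * -(n : ℝ)) ^ 3) =O[atBot] fun n : ℤ => -(n : ℝ) := by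
      refine (h2.neg_left.neg_right).congr_left fun n => ?_
      have : (7 * Real.pi + 12 * Real.pi * (k₂ - n)) / (6 * L) =
        (7 * Real.pi + 12 * Real.pi * k₂) / (6 * L) + 2 * Real.pi / L * -(n : ℝ) := by
        field_simp; ring
      rw [this]; ring
    have h4 := (tendsto_div_pow_three hN h3).abs
    rw [abs_of_nonneg hpos] at h4
    refine h4.congr fun n => ?_
    rw [abs_div, abs_pow, abs_neg, abs_neg]
  · have hN : Tendsto (fun n : ℤ => (n : ℝ)) atTop atTop := tendsto_intCast_atTop_atTop
    have h3 : (fun n : ℤ => lam n - ((Real.pi + 12 * Real.pi * k₁) / (6 * L) +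
        2 * Real.pi / L * (n : ℝ)) ^ 3) =O[atTop] fun n : ℤ => (n : ℝ) := by
      refine h1.congr_left fun n => ?_
      have : (Real.pi + 12 * Real.pi * (k₁ + n)) / (6 * L) =
        (Real.pi + 12 * Real.pi * k₁) / (6 * L) + 2 * Real.pi / L * (n : ℝ) := by
        field_simp; ring
      rw [this]
    have h4 := (tendsto_div_pow_three hN h3).abs
    rw [abs_of_nonneg hpos] at h4
    refine h4.congr fun n => ?_
    rw [abs_div, abs_pow]

end SpectralAsymptotics

/-! ### Compactness of the Volterra operator -/

section CompactPrimitive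

variable {L : ℝ}

theorem coeFn_finset_sum {ι : Type*} (s : Finset ι) (F : ι → L2 L) :
    ⇑(∑ i ∈ s, F i) =ᵐ[vol L] fun x => ∑ i ∈ s, F i x := by
  classical
  induction s using Finset.induction_on with
  | empty =>
    filter_upwards [Lp.coeFn_zero ℂ 2 (vol L)] with x hx
    rw [Finset.sum_empty, Finset.sum_empty, hx, Pi.zero_apply]
  | insert a s ha ih =>
    rw [Finset.sum_insert ha]
    filter_upwards [Lp.coeFn_add (F a) (∑ i ∈ s, F i), ih] with x h1 h2
    rw [h1, Pi.add_apply, h2, Finset.sum_insert ha]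

/-- The indicator function of `s` as an element of `L²(0,L)`. -/
def indL2 (L : ℝ) {s : Set ℝ} (hs : MeasurableSet s) : L2 L :=
  indicatorConstLp 2 hs (measure_ne_top (vol L) s) 1

theorem coeFn_indL2 {s : Set ℝ} (hs : MeasurableSet s) :
    indL2 L hs =ᵐ[vol L] s.indicator fun _ => (1 : ℂ) :=
  indicatorConstLp_coeFn

theorem inner_indL2_Iic (x : ℝ) (f : L2 L) :
    inner ℂ (indL2 L (measurableSet_Iic (a := x))) f = primFun f x :=
  L2.inner_indicatorConstLp_one _ _ f

/-- The step function approximation of the Volterra operator. -/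
def stepOp (L : ℝ) (n : ℕ) : L2 L →L[ℂ] L2 L :=
  ∑ k ∈ Finset.range n, (innerSL ℂ (indL2 L (measurableSet_Iic (a := k * (L / n))))).smulRight
    (indL2 L (measurableSet_Ico (a := k * (L / n)) (b := (k + 1) * (L / n))))

theorem isCompactOperator_stepOp (n : ℕ) : IsCompactOperator (stepOp L n) := by
  have : ∀ s : Finset ℕ, IsCompactOperator ⇑(∑ k ∈ s,
      (innerSL ℂ (indL2 L (measurableSet_Iic (a := k * (L / n))))).smulRight
        (indL2 L (measurableSet_Ico (a := k * (L / n)) (b := (k + 1) * (L / n))))) := by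
    intro s
    induction s using Finset.induction_on with
    | empty => simpa using isCompactOperator_zero
    | insert a s ha ih =>
      rw [Finset.sum_insert ha]
      refine IsCompactOperator.add ?_ ih
      have h1 : IsCompactOperator (innerSL ℂ (indL2 L (measurableSet_Iic (a := a * (L / n))))) :=
        isCompactOperator_of_locallyCompactSpace_dom _
      exact h1.clm_comp ((ContinuousLinearMap.id ℂ ℂ).smulRight _)
  exact this _

theorem coeFn_stepOp (n : ℕ) (f : L2 L) : stepOp L n f =ᵐ[vol L] fun x =>
    ∑ k ∈ Finset.range n, primFun f (k * (L / n)) *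
      (Set.Ico (k * (L / n)) ((k + 1) * (L / n))).indicator (fun _ => (1 : ℂ)) x := by
  rw [stepOp, _root_.sum_apply]
  refine (coeFn_finset_sum _ _).trans ?_
  have h : ∀ k : ℕ, ∀ᵐ x ∂(vol L), ((innerSL ℂ (indL2 L (measurableSet_Iic
      (a := k * (L / n))))).smulRight (indL2 L (measurableSet_Ico (a := k * (L / n))
        (b := (k + 1) * (L / n)))) f : L2 L) x = primFun f (k * (L / n)) *
      (Set.Ico (k * (L / n)) ((k + 1) * (L / n))).indicator (fun _ => (1 : ℂ)) x := by
    intro k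
    rw [ContinuousLinearMap.smulRight_apply, innerSL_apply_apply, inner_indL2_Iic]
    filter_upwards [Lp.coeFn_smul (primFun f (k * (L / n))) (indL2 L (measurableSet_Ico
      (a := k * (L / n)) (b := (k + 1) * (L / n)))), coeFn_indL2 (L := L) (measurableSet_Ico
      (a := k * (L / n)) (b := (k + 1) * (L / n)))] with x h1 h2
    rw [h1, Pi.smul_apply, h2, smul_eq_mul]
  filter_upwards [ae_all_iff.mpr h] with x hx
  exact Finset.sum_congr rfl fun k _ => hx k

/-- On each cell of length `L/n` the step function takes the value of the primitive at the left end,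
so the Hölder bound applies. -/
theorem norm_primOp_sub_stepOp_le (hL : 0 < L) {n : ℕ} (hn : 0 < n) :
    ‖stepOp L n - primOp hL‖ ≤ √L * √(L / n) := by
  have hn' : (0 : ℝ) < n := by exact_mod_cast hn
  have hd : 0 < L / n := by positivity
  refine ContinuousLinearMap.opNorm_le_bound _ (by positivity) fun f => ?_
  rw [mul_assoc]
  refine norm_le_of_forall_bound hL (by positivity) ?_
  rw [_root_.sub_apply, primOp_apply]
  filter_upwards [Lp.coeFn_sub (stepOp L n f) (ofCont L (primFun f) (continuous_primFun f)),
    coeFn_stepOp n f, coeFn_ofCont (L := L) (continuous_primFun f),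
    ae_restrict_mem measurableSet_Ioo] with x h1 h2 h3 hx
  rw [h1, Pi.sub_apply, h2, h3]
  set k := ⌊x / (L / n)⌋₊ with hk
  have hxd : 0 ≤ x / (L / n) := div_nonneg hx.1.le hd.le
  have hk1 : (k : ℝ) * (L / n) ≤ x := by
    rw [← le_div_iff₀ hd]; exact Nat.floor_le hxd
  have hk2 : x < (k + 1) * (L / n) := by
    rw [← div_lt_iff₀ hd]; exact Nat.lt_floor_add_one _
  have hkn : k < n := by
    rw [hk, Nat.floor_lt hxd, div_lt_iff₀ hd, mul_div_cancel₀ _ hn'.ne']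
    exact hx.2
  rw [Finset.sum_eq_single k]
  · rw [Set.indicator_of_mem (show x ∈ Set.Ico _ _ from ⟨hk1, hk2⟩), mul_one, norm_sub_rev]
    refine (norm_primFun_sub_le f hk1).trans ?_
    gcongr
    linarith
  · intro j _ hj
    rw [Set.indicator_of_notMem, mul_zero]
    rintro ⟨h4, h5⟩
    refine hj ?_
    rw [hk]
    symm
    rw [Nat.floor_eq_iff hxd, le_div_iff₀ hd, div_lt_iff₀ hd]
    exact ⟨h4, h5⟩
  · exact fun h => absurd (Finset.mem_range.mpr hkn) h

theorem isCompactOperator_primOp (hL : 0 < L) : IsCompactOperator (primOp hL) := by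
  refine isCompactOperator_of_tendsto (l := atTop) (F := fun n : ℕ => stepOp L n) ?_
    (Eventually.of_forall isCompactOperator_stepOp)
  rw [tendsto_iff_norm_sub_tendsto_zero]
  refine squeeze_zero' (Eventually.of_forall fun _ => norm_nonneg _)
    ((eventually_gt_atTop 0).mono fun n hn => norm_primOp_sub_stepOp_le hL hn) ?_
  have h1 : Tendsto (fun n : ℕ => L / (n : ℝ)) atTop (𝓝 0) := tendsto_const_div_atTop_nhds_zero_nat L
  have h2 := (h1.sqrt).const_mul (√L)
  simpa using h2

end CompactPrimitive

/-! ### Multiplication by the sine and the cosine -/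

section Multiplication

variable {L : ℝ}

theorem memLp_mul_of_bound {m : ℝ → ℝ} (hm : Continuous m) (hb : ∀ x, |m x| ≤ 1) (f : L2 L) :
    MemLp (fun x => (m x : ℂ) * f x) 2 (vol L) := by
  refine (Lp.memLp f).of_le ?_ (Eventually.of_forall fun x => ?_)
  · exact (by fun_prop : Continuous fun x => (m x : ℂ)).aestronglyMeasurable.mul
      (Lp.aestronglyMeasurable f)
  · rw [norm_mul, Complex.norm_real, Real.norm_eq_abs]
    exact mul_le_of_le_one_left (norm_nonneg _) (hb x)

/-- Multiplication by a continuous function bounded by `1`. -/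
def mulOp (L : ℝ) (m : ℝ → ℝ) (hm : Continuous m) (hb : ∀ x, |m x| ≤ 1) : L2 L →L[ℂ] L2 L :=
  LinearMap.mkContinuous
    { toFun := fun f => (memLp_mul_of_bound hm hb f).toLp _
      map_add' := fun f g => by
        refine Lp.ext ((MemLp.coeFn_toLp _).trans ?_)
        filter_upwards [Lp.coeFn_add ((memLp_mul_of_bound hm hb f).toLp _)
          ((memLp_mul_of_bound hm hb g).toLp _), MemLp.coeFn_toLp (memLp_mul_of_bound hm hb f),
          MemLp.coeFn_toLp (memLp_mul_of_bound hm hb g), Lp.coeFn_add f g] with x h1 h2 h3 h4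
        rw [h1, Pi.add_apply, h2, h3, h4, Pi.add_apply, mul_add]
      map_smul' := fun c f => by
        refine Lp.ext ((MemLp.coeFn_toLp _).trans ?_)
        simp only [RingHom.id_apply]
        filter_upwards [Lp.coeFn_smul c ((memLp_mul_of_bound hm hb f).toLp _),
          MemLp.coeFn_toLp (memLp_mul_of_bound hm hb f), Lp.coeFn_smul c f] with x h1 h2 h3
        rw [h1, Pi.smul_apply, h2, h3, Pi.smul_apply, smul_eq_mul, smul_eq_mul]
        ring } 1 (fun f => by
      rw [one_mul]
      refine Lp.norm_le_norm_of_ae_le ?_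
      filter_upwards [MemLp.coeFn_toLp (memLp_mul_of_bound hm hb f)] with x hx
      simp only [LinearMap.coe_mk, AddHom.coe_mk]
      rw [hx, norm_mul, Complex.norm_real, Real.norm_eq_abs]
      exact mul_le_of_le_one_left (norm_nonneg _) (hb x))

theorem coeFn_mulOp {m : ℝ → ℝ} (hm : Continuous m) (hb : ∀ x, |m x| ≤ 1) (f : L2 L) :
    mulOp L m hm hb f =ᵐ[vol L] fun x => (m x : ℂ) * f x :=
  MemLp.coeFn_toLp (memLp_mul_of_bound hm hb f)

/-- Multiplication by the cosine. -/
def cosOp (L : ℝ) : L2 L →L[ℂ] L2 L := mulOp L Real.cos Real.continuous_cos Real.abs_cos_le_one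

/-- Multiplication by the sine. -/
def sinOp (L : ℝ) : L2 L →L[ℂ] L2 L := mulOp L Real.sin Real.continuous_sin Real.abs_sin_le_one

theorem coeFn_cosOp (f : L2 L) : cosOp L f =ᵐ[vol L] fun x => (Real.cos x : ℂ) * f x :=
  coeFn_mulOp _ _ f

theorem coeFn_sinOp (f : L2 L) : sinOp L f =ᵐ[vol L] fun x => (Real.sin x : ℂ) * f x :=
  coeFn_mulOp _ _ f

theorem cosOp_cosOp_add_sinOp_sinOp (f : L2 L) : cosOp L (cosOp L f) + sinOp L (sinOp L f) = f := by
  refine Lp.ext ?_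
  filter_upwards [Lp.coeFn_add (cosOp L (cosOp L f)) (sinOp L (sinOp L f)),
    coeFn_cosOp (cosOp L f), coeFn_cosOp f, coeFn_sinOp (sinOp L f), coeFn_sinOp f]
    with x h1 h2 h3 h4 h5
  rw [h1, Pi.add_apply, h2, h3, h4, h5]
  have : (Real.cos x : ℂ) * Real.cos x + (Real.sin x : ℂ) * Real.sin x = 1 := by
    exact_mod_cast by nlinarith [Real.sin_sq_add_cos_sq x]
  linear_combination f x * this

theorem sinOp_cosOp (f : L2 L) : sinOp L (cosOp L f) = cosOp L (sinOp L f) := by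
  refine Lp.ext ?_
  filter_upwards [coeFn_sinOp (cosOp L f), coeFn_cosOp f, coeFn_cosOp (sinOp L f), coeFn_sinOp f]
    with x h2 h3 h4 h5
  rw [h2, h3, h4, h5]
  ring

theorem HasWeakDeriv.cosOp {f g : L2 L} (h : HasWeakDeriv L f g) :
    HasWeakDeriv L (cosOp L f) (cosOp L g - sinOp L f) := by
  refine h.mul_smooth (m := Real.cos) Real.contDiff_cos ?_ ?_
  · filter_upwards [coeFn_cosOp f] with x hx
    rw [hx, Complex.real_smul]
  · filter_upwards [Lp.coeFn_sub (KdVKdV.cosOp L g) (KdVKdV.sinOp L f), coeFn_cosOp g,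
      coeFn_sinOp f] with x h1 h2 h3
    rw [h1, Pi.sub_apply, h2, h3, Real.deriv_cos, Complex.real_smul, Complex.real_smul]
    push_cast
    ring

theorem HasWeakDeriv.sinOp {f g : L2 L} (h : HasWeakDeriv L f g) :
    HasWeakDeriv L (sinOp L f) (sinOp L g + KdVKdV.cosOp L f) := by
  refine h.mul_smooth (m := Real.sin) Real.contDiff_sin ?_ ?_
  · filter_upwards [coeFn_sinOp f] with x hx
    rw [hx, Complex.real_smul]
  · filter_upwards [Lp.coeFn_add (KdVKdV.sinOp L g) (KdVKdV.cosOp L f), coeFn_sinOp g,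
      coeFn_cosOp f] with x h1 h2 h3
    rw [h1, Pi.add_apply, h2, h3, Real.deriv_sin, Complex.real_smul, Complex.real_smul]
    ring

theorem hasWeakDeriv_primOp (hL : 0 < L) (f : L2 L) : HasWeakDeriv L (primOp hL f) f := by
  refine hasWeakDeriv_of_ae_eq hL (c := 0) ?_
  filter_upwards [coeFn_ofCont (L := L) (continuous_primFun f)] with x hx
  rw [primOp_apply, hx, zero_add]

theorem hasTrace_primOp (hL : 0 < L) (f : L2 L) (a : ℝ) :
    HasTrace L (primOp hL f) a (primFun f a) :=
  hasTrace_ofCont (continuous_primFun f) a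

theorem HasTrace.mulOp {f : L2 L} {a : ℝ} {c : ℂ} (h : HasTrace L f a c) {m : ℝ → ℝ}
    (hm : Continuous m) (hb : ∀ x, |m x| ≤ 1) : HasTrace L (mulOp L m hm hb f) a (m a * c) := by
  obtain ⟨F, hF, hfF, rfl⟩ := h
  refine ⟨fun x => m x * F x, (by fun_prop : Continuous fun x => (m x : ℂ)).continuousOn.mul hF,
    ?_, rfl⟩
  filter_upwards [coeFn_mulOp hm hb f, hfF] with x h1 h2
  rw [h1, h2]

end Multiplication

/-! ### Eigenbases of compact symmetric operators -/

section Spectral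

universe u

variable {H : Type u} [NormedAddCommGroup H] [InnerProductSpace ℂ H]

/-- Vectors `T (b j)` with `|ν j| ≥ ε` are pairwise at distance at least `ε`, seen by pairing with
`b j`, so an infinite family would have no convergent subsequence. -/
theorem finite_large_eigenvalues {J : Type*} {T : H →L[ℂ] H} (hT : IsCompactOperator T) {b : J → H}
    (hb : Orthonormal ℂ b) {ν : J → ℝ} (h : ∀ j, T (b j) = (ν j : ℂ) • b j) {ε : ℝ} (hε : 0 < ε) :
    {j | ε ≤ |ν j|}.Finite := by
  by_contra hinf
  obtain ⟨K, hK, hKs⟩ := hT.image_closedBall_subset_compact 1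
  let s := Set.Infinite.natEmbedding _ hinf
  have hmem : ∀ n, T (b (s n)) ∈ K := fun n => hKs ⟨b (s n), by simp [hb.1], rfl⟩
  obtain ⟨a, -, φ, hφ, hlim⟩ := hK.tendsto_subseq hmem
  obtain ⟨N, hN⟩ := Metric.cauchySeq_iff'.mp hlim.cauchySeq ε hε
  have h1 := hN (N + 1) (by omega)
  set i := s (φ (N + 1)) with hi
  set k := s (φ N) with hk
  have hik : (i : J) ≠ k := by
    intro he
    have := hφ.injective (s.injective (Subtype.ext he))
    omega
  have h2 : inner ℂ (b i) (T (b i) - T (b k)) = ν i := by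
    rw [inner_sub_right, h, h, inner_smul_right, inner_smul_right, hb.2 hik,
      inner_self_eq_norm_sq_to_K, hb.1]
    simp
  have h3 := norm_inner_le_norm (𝕜 := ℂ) (b i) (T (b i) - T (b k))
  rw [h2, hb.1, one_mul, Complex.norm_real, Real.norm_eq_abs, ← dist_eq_norm] at h3
  exact absurd (i.2.trans h3) (not_le.mpr h1)

theorem apply_eq_re_smul {T : H →L[ℂ] H} (hs : (T : H →ₗ[ℂ] H).IsSymmetric) {μ : ℂ} {x : H}
    (hx : x ∈ Module.End.eigenspace (T : H →ₗ[ℂ] H) μ) : T x = (μ.re : ℂ) • x := by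
  have h1 : T x = μ • x := Module.End.mem_eigenspace_iff.mp hx
  by_cases h0 : x = 0
  · simp [h0]
  · have h2 : Module.End.HasEigenvalue (T : H →ₗ[ℂ] H) μ :=
      Module.End.hasEigenvalue_of_hasEigenvector ⟨hx, h0⟩
    rw [h1, Complex.conj_eq_iff_re.mp (hs.conj_eigenvalue_eq_self h2)]

theorem exists_hilbertBasis_of_orthonormal [CompleteSpace H] {T : H →L[ℂ] H}
    (hT : IsCompactOperator T) {J : Type u} {v : J → H} (hv : Orthonormal ℂ v)
    (hbot : (Submodule.span ℂ (Set.range v))ᗮ = ⊥) {ν : J → ℝ}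
    (h : ∀ j, T (v j) = (ν j : ℂ) • v j) :
    ∃ (J : Type u) (b : HilbertBasis J ℂ H) (ν : J → ℝ), (∀ j, T (b j) = (ν j : ℂ) • b j) ∧
      ∀ ε > 0, {j | ε ≤ |ν j|}.Finite := by
  refine ⟨J, HilbertBasis.mkOfOrthogonalEqBot hv hbot, ν, fun j => ?_, fun ε hε => ?_⟩
  · rw [HilbertBasis.coe_mkOfOrthogonalEqBot]
    exact h j
  · exact finite_large_eigenvalues hT hv h hε

theorem exists_hilbertBasis_eigenvectors [CompleteSpace H] {T : H →L[ℂ] H} (hT : IsCompactOperator T)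
    (hs : (T : H →ₗ[ℂ] H).IsSymmetric) :
    ∃ (J : Type u) (b : HilbertBasis J ℂ H) (ν : J → ℝ), (∀ j, T (b j) = (ν j : ℂ) • b j) ∧
      ∀ ε > 0, {j | ε ≤ |ν j|}.Finite := by
  have hcl : ∀ μ : ℂ, CompleteSpace (Module.End.eigenspace (T : H →ₗ[ℂ] H) μ) := by
    intro μ
    have : IsClosed ((Module.End.eigenspace (T : H →ₗ[ℂ] H) μ : Submodule ℂ H) : Set H) := by
      have h1 : ((Module.End.eigenspace (T : H →ₗ[ℂ] H) μ : Submodule ℂ H) : Set H) =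
          {x | T x = μ • x} := by
        ext x; simp
      rw [h1]
      exact isClosed_eq T.continuous (by fun_prop)
    exact this.completeSpace_coe
  have hex : ∀ μ : ℂ, ∃ w : Set (Module.End.eigenspace (T : H →ₗ[ℂ] H) μ),
      Nonempty (HilbertBasis w ℂ (Module.End.eigenspace (T : H →ₗ[ℂ] H) μ)) := fun μ => by
    obtain ⟨w, B, -⟩ := exists_hilbertBasis ℂ (Module.End.eigenspace (T : H →ₗ[ℂ] H) μ)
    exact ⟨w, ⟨B⟩⟩
  choose w hw using hex
  have B := fun μ => (hw μ).some
  have ho := hs.orthogonalFamily_eigenspaces.orthonormal_sigma_orthonormal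
    fun μ => (B μ).orthonormal
  -- The eigenspaces are total, so it suffices that a vector orthogonal to all the basis vectors is
  -- orthogonal to each eigenspace; its projection there has zero coordinates.
  have hbot : (Submodule.span ℂ (Set.range fun a : Σ μ, w μ =>
      ((B a.1 a.2 : Module.End.eigenspace (T : H →ₗ[ℂ] H) a.1) : H)))ᗮ = ⊥ := by
    rw [← ContinuousLinearMap.orthogonalComplement_iSup_eigenspaces_eq_bot hT hs]
    refine le_antisymm ?_ (Submodule.orthogonal_le ?_)
    · rw [← Submodule.iInf_orthogonal]
      refine le_iInf fun μ x hx => ?_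
      rw [← Submodule.orthogonalProjectionOnto_eq_zero_iff]
      refine (B μ).repr.injective ?_
      rw [map_zero]
      ext k
      rw [HilbertBasis.repr_apply_apply, lp.coeFn_zero, Pi.zero_apply,
        Submodule.inner_orthogonalProjectionOnto_eq_of_mem_left]
      have h1 := (Submodule.mem_orthogonal _ _).mp hx _ (Submodule.subset_span ⟨⟨μ, k⟩, rfl⟩)
      exact h1
    · rw [Submodule.span_le]
      rintro _ ⟨a, rfl⟩
      exact Submodule.mem_iSup_of_mem a.1 (B a.1 a.2).2
  have hT' : ∀ a : Σ μ, w μ, T (B a.1 a.2) = (a.1.re : ℂ) •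
      ((B a.1 a.2 : Module.End.eigenspace (T : H →ₗ[ℂ] H) a.1) : H) := by
    intro a
    exact apply_eq_re_smul hs (B a.1 a.2).2
  exact exists_hilbertBasis_of_orthonormal hT ho hbot (ν := fun a => a.1.re) hT'

end Spectral

/-! ### The Green operator and an eigenbasis of the scalar operator -/

section Green

variable {L : ℝ}

/-- The solution operator `g ↦ u` of the Cauchy problem `u''' + u' = g`,
`u(0) = u'(0) = u''(0) = 0`. -/
def cauchyOp (hL : 0 < L) : L2 L →L[ℂ] L2 L :=
  primOp hL - (cosOp L ∘L primOp hL ∘L cosOp L + sinOp L ∘L primOp hL ∘L sinOp L)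

theorem cauchyOp_apply (hL : 0 < L) (g : L2 L) : cauchyOp hL g =
    primOp hL g - (cosOp L (primOp hL (cosOp L g)) + sinOp L (primOp hL (sinOp L g))) := rfl

/-- The kernel of `cauchyOp` is `1 - cos(x - t)` for `t ≤ x`. Expanding the cosine leaves only
`primOp` between bounded multiplications, so compactness is inherited. -/
theorem isCompactOperator_cauchyOp (hL : 0 < L) : IsCompactOperator (cauchyOp hL) := by
  have h := isCompactOperator_primOp hL
  exact h.sub (((h.comp_clm (cosOp L)).clm_comp (cosOp L)).add
    ((h.comp_clm (sinOp L)).clm_comp (sinOp L)))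

theorem HasWeakDeriv.sub {f₁ f₂ g₁ g₂ : L2 L} (h₁ : HasWeakDeriv L f₁ g₁)
    (h₂ : HasWeakDeriv L f₂ g₂) : HasWeakDeriv L (f₁ - f₂) (g₁ - g₂) := by
  rw [sub_eq_add_neg, sub_eq_add_neg]
  exact h₁.add h₂.neg

theorem HasTrace.sub {f g : L2 L} {a : ℝ} {c d : ℂ}
    (hc : HasTrace L f a c) (hd : HasTrace L g a d) : HasTrace L (f - g) a (c - d) := by
  rw [sub_eq_add_neg, sub_eq_add_neg]
  exact hc.add hd.neg

theorem hasWeakDeriv_cauchyOp (hL : 0 < L) (g : L2 L) : HasWeakDeriv L (cauchyOp hL g)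
    (sinOp L (primOp hL (cosOp L g)) - cosOp L (primOp hL (sinOp L g))) := by
  have h := (hasWeakDeriv_primOp hL g).sub ((hasWeakDeriv_primOp hL (cosOp L g)).cosOp.add
    (hasWeakDeriv_primOp hL (sinOp L g)).sinOp)
  rw [cauchyOp_apply]
  convert h using 1
  have e := cosOp_cosOp_add_sinOp_sinOp g
  generalize cosOp L (cosOp L g) = a, sinOp L (sinOp L g) = b at e
  generalize sinOp L (primOp hL (cosOp L g)) = p, cosOp L (primOp hL (sinOp L g)) = q
  rw [← e]
  abel

theorem hasWeakDeriv_cauchyOp_deriv (hL : 0 < L) (g : L2 L) :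
    HasWeakDeriv L (sinOp L (primOp hL (cosOp L g)) - cosOp L (primOp hL (sinOp L g)))
      (cosOp L (primOp hL (cosOp L g)) + sinOp L (primOp hL (sinOp L g))) := by
  have h := (hasWeakDeriv_primOp hL (cosOp L g)).sinOp.sub
    (hasWeakDeriv_primOp hL (sinOp L g)).cosOp
  convert h using 1
  rw [sinOp_cosOp]
  abel

theorem hasWeakDeriv_cauchyOp_deriv_deriv (hL : 0 < L) (g : L2 L) :
    HasWeakDeriv L (cosOp L (primOp hL (cosOp L g)) + sinOp L (primOp hL (sinOp L g)))
      (g - (sinOp L (primOp hL (cosOp L g)) - cosOp L (primOp hL (sinOp L g)))) := by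
  have h := (hasWeakDeriv_primOp hL (cosOp L g)).cosOp.add
    (hasWeakDeriv_primOp hL (sinOp L g)).sinOp
  convert h using 1
  nth_rewrite 1 [← cosOp_cosOp_add_sinOp_sinOp g]
  abel

theorem memSobolev_cauchyOp (hL : 0 < L) (g : L2 L) : MemSobolev L 3 (cauchyOp hL g) :=
  ⟨_, hasWeakDeriv_cauchyOp hL g, _, hasWeakDeriv_cauchyOp_deriv hL g, _,
    hasWeakDeriv_cauchyOp_deriv_deriv hL g, trivial⟩

theorem minusD_cauchyOp (hL : 0 < L) (g : L2 L) : minusD L (cauchyOp hL g) = -g := by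
  rw [minusD, (hasWeakDeriv_cauchyOp hL g).weakDeriv_eq,
    (hasWeakDeriv_cauchyOp_deriv hL g).weakDeriv_eq,
    (hasWeakDeriv_cauchyOp_deriv_deriv hL g).weakDeriv_eq]
  abel

theorem hasTrace_cauchyOp (hL : 0 < L) (g : L2 L) (a : ℝ) : HasTrace L (cauchyOp hL g) a
    (primFun g a - (Real.cos a * primFun (cosOp L g) a + Real.sin a * primFun (sinOp L g) a)) :=
  (hasTrace_primOp hL g a).sub
    (((hasTrace_primOp hL (cosOp L g) a).mulOp Real.continuous_cos Real.abs_cos_le_one).add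
      ((hasTrace_primOp hL (sinOp L g) a).mulOp Real.continuous_sin Real.abs_sin_le_one))

theorem hasTrace_cauchyOp_zero (hL : 0 < L) (g : L2 L) : HasTrace L (cauchyOp hL g) 0 0 := by
  simpa [primFun_of_nonpos] using hasTrace_cauchyOp hL g 0

theorem hasTrace_weakDeriv_cauchyOp_zero (hL : 0 < L) (g : L2 L) :
    HasTrace L (weakDeriv L (cauchyOp hL g)) 0 0 := by
  rw [(hasWeakDeriv_cauchyOp hL g).weakDeriv_eq]
  have h := ((hasTrace_primOp hL (cosOp L g) 0).mulOp Real.continuous_sin Real.abs_sin_le_one).sub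
    ((hasTrace_primOp hL (sinOp L g) 0).mulOp Real.continuous_cos Real.abs_cos_le_one)
  rw [primFun_of_nonpos _ le_rfl, primFun_of_nonpos _ le_rfl, mul_zero, mul_zero, sub_zero] at h
  exact h

/-- The solution `1 - cos x` of `u''' + u' = 0`, `u(0) = u'(0) = 0`. -/
def versine (L : ℝ) : L2 L := ofCont L (fun x => 1 - (Real.cos x : ℂ)) (by fun_prop)

theorem hasWeakDeriv_versine (hL : 0 < L) :
    HasWeakDeriv L (versine L) (ofCont L (fun x => (Real.sin x : ℂ)) (by fun_prop)) :=
  hasWeakDeriv_ofCont hL (fun x => by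
    simpa using (((Real.hasDerivAt_cos x).ofReal_comp).const_sub (1 : ℂ))) _ _

theorem hasWeakDeriv_sin (hL : 0 < L) :
    HasWeakDeriv L (ofCont L (fun x => (Real.sin x : ℂ)) (by fun_prop))
      (ofCont L (fun x => (Real.cos x : ℂ)) (by fun_prop)) :=
  hasWeakDeriv_ofCont hL (fun x => (Real.hasDerivAt_sin x).ofReal_comp) _ _

theorem hasWeakDeriv_cos (hL : 0 < L) :
    HasWeakDeriv L (ofCont L (fun x => (Real.cos x : ℂ)) (by fun_prop))
      (-ofCont L (fun x => (Real.sin x : ℂ)) (by fun_prop)) := by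
  have h := hasWeakDeriv_ofCont hL (F := fun x => (Real.cos x : ℂ))
    (F' := fun x => ((-Real.sin x : ℝ) : ℂ)) (fun x => (Real.hasDerivAt_cos x).ofReal_comp)
    (by fun_prop) (by fun_prop)
  convert h using 1
  refine eq_ofCont _ ?_
  filter_upwards [Lp.coeFn_neg (ofCont L (fun x => (Real.sin x : ℂ)) (by fun_prop)),
    coeFn_ofCont (L := L) (F := fun x => (Real.sin x : ℂ)) (by fun_prop)] with x h1 h2
  rw [h1, Pi.neg_apply, h2, Complex.ofReal_neg]

theorem memSobolev_versine (hL : 0 < L) : MemSobolev L 3 (versine L) :=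
  ⟨_, hasWeakDeriv_versine hL, _, hasWeakDeriv_sin hL, _, hasWeakDeriv_cos hL, trivial⟩

theorem minusD_versine (hL : 0 < L) : minusD L (versine L) = 0 := by
  rw [minusD, (hasWeakDeriv_versine hL).weakDeriv_eq, (hasWeakDeriv_sin hL).weakDeriv_eq,
    (hasWeakDeriv_cos hL).weakDeriv_eq, sub_neg_eq_add, neg_add_cancel]

theorem hasTrace_versine (a : ℝ) : HasTrace L (versine L) a (1 - Real.cos a) :=
  hasTrace_ofCont _ a

theorem hasTrace_weakDeriv_versine_zero (hL : 0 < L) :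
    HasTrace L (weakDeriv L (versine L)) 0 0 := by
  rw [(hasWeakDeriv_versine hL).weakDeriv_eq]
  simpa using hasTrace_ofCont (L := L) (F := fun x => (Real.sin x : ℂ)) (by fun_prop) 0

/-- The value at `L` is the integral of `1 - cos(L - t)` against `f(L - t)`; substitute `t ↦ L - t`.
-/
theorem hasTrace_cauchyOp_refl (hL : 0 < L) (f : L2 L) :
    HasTrace L (cauchyOp hL (refl L f)) L (inner ℂ (versine L) f) := by
  set g := refl L f with hg
  have hf : f = refl L g := (refl_refl f).symm
  have h := hasTrace_cauchyOp hL g L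
  convert h using 1
  rw [hf, ← inner_refl, versine, refl_ofCont, L2.inner_def, primFun_of_ge _ le_rfl,
    primFun_of_ge _ le_rfl, primFun_of_ge _ le_rfl, ← integral_const_mul, ← integral_const_mul,
    ← integral_add ((integrable_coe _).const_mul _) ((integrable_coe _).const_mul _),
    ← integral_sub (integrable_coe _)]
  rotate_left
  · exact ((integrable_coe _).const_mul _).add ((integrable_coe _).const_mul _)
  refine integral_congr_ae ?_
  filter_upwards [coeFn_ofCont (L := L) (F := fun x => 1 - (Real.cos (L - x) : ℂ)) (by fun_prop),
    coeFn_cosOp g, coeFn_sinOp g] with x h1 h2 h3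
  rw [h1, h2, h3, Real.cos_sub, RCLike.inner_apply', map_sub, Complex.conj_ofReal, map_one]
  push_cast
  ring

/-- `cauchyOp` meets every condition except the one at `L`. If `cos L ≠ 1`, a multiple of `versine`
corrects this. If `cos L = 1`, `versine` is in the kernel of `B`, and the condition at `L` holds
exactly on its orthogonal complement. -/
theorem exists_green_operator (hL : 0 < L) : ∃ (N : Submodule ℂ (L2 L)) (G : L2 L →L[ℂ] L2 L),
    FiniteDimensional ℂ N ∧ (∀ f ∈ N, IsEigB L 0 f) ∧ IsCompactOperator G ∧
      ∀ f ∈ Nᗮ, G f ∈ compDomain L 0 ∧ minusD L (G f) = -refl L f := by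
  have hK : IsCompactOperator (cauchyOp hL ∘L (refl L).toContinuousLinearMap) :=
    (isCompactOperator_cauchyOp hL).comp_clm _
  by_cases hc : Real.cos L = 1
  · refine ⟨ℂ ∙ versine L, cauchyOp hL ∘L (refl L).toContinuousLinearMap, inferInstance, ?_, hK, ?_⟩
    · intro f hf
      obtain ⟨c, rfl⟩ := Submodule.mem_span_singleton.mp hf
      refine IsEigB.smul ⟨⟨memSobolev_versine hL, ?_, ?_, hasTrace_weakDeriv_versine_zero hL⟩, ?_⟩ c
      · simpa using hasTrace_versine (L := L) 0
      · simpa [hc] using hasTrace_versine (L := L) L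
      · simp [minusD_versine hL]
    · intro f hf
      have h0 : inner ℂ (versine L) f = 0 := Submodule.mem_orthogonal_singleton_iff_inner_right.mp hf
      refine ⟨⟨memSobolev_cauchyOp hL _, hasTrace_cauchyOp_zero hL _, ?_,
        hasTrace_weakDeriv_cauchyOp_zero hL _⟩, minusD_cauchyOp hL _⟩
      simpa [h0] using hasTrace_cauchyOp_refl hL f
  · have hc' : (1 - Real.cos L : ℂ) ≠ 0 := by
      rw [← Complex.ofReal_one, ← Complex.ofReal_sub, Complex.ofReal_ne_zero]
      exact sub_ne_zero.mpr (Ne.symm hc)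
    have hF : IsCompactOperator ((innerSL ℂ (versine L)).smulRight
        ((-(1 - Real.cos L : ℂ)⁻¹) • versine L)) := by
      have h1 : IsCompactOperator (innerSL ℂ (versine L)) :=
        isCompactOperator_of_locallyCompactSpace_dom _
      exact h1.clm_comp ((ContinuousLinearMap.id ℂ ℂ).smulRight _)
    refine ⟨⊥, cauchyOp hL ∘L (refl L).toContinuousLinearMap + (innerSL ℂ (versine L)).smulRight
      ((-(1 - Real.cos L : ℂ)⁻¹) • versine L), inferInstance, ?_, hK.add hF, fun f _ => ?_⟩
    · intro f hf
      rw [(Submodule.mem_bot ℂ).mp hf]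
      refine ⟨zero_mem _, ?_⟩
      have := minusD_smul (L := L) 0 (MemSobolev.zero L 3)
      rw [zero_smul, zero_smul] at this
      rw [this, map_zero, smul_zero, neg_zero]
    · set k : ℂ := inner ℂ (versine L) f * -(1 - Real.cos L : ℂ)⁻¹ with hk
      have hG : (cauchyOp hL ∘L (refl L).toContinuousLinearMap + (innerSL ℂ (versine L)).smulRight
          ((-(1 - Real.cos L : ℂ)⁻¹) • versine L)) f =
          cauchyOp hL (refl L f) + k • versine L := by
        rw [hk, mul_smul]; rfl
      have h1 := memSobolev_cauchyOp hL (refl L f)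
      have h2 := (memSobolev_versine hL).smul k
      rw [hG]
      refine ⟨⟨h1.add h2, ?_, ?_, ?_⟩, ?_⟩
      · simpa using (hasTrace_cauchyOp_zero hL _).add ((hasTrace_versine 0).smul k)
      · have h := (hasTrace_cauchyOp_refl hL f).add ((hasTrace_versine L).smul k)
        convert h using 1
        rw [hk]
        field_simp
        ring
      · rw [h1.weakDeriv_add h2, (memSobolev_versine hL).weakDeriv_smul]
        simpa using (hasTrace_weakDeriv_cauchyOp_zero hL _).add
          ((hasTrace_weakDeriv_versine_zero hL).smul k)
      · rw [minusD_add h1 h2, minusD_smul k (memSobolev_versine hL), minusD_versine,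
          minusD_cauchyOp, smul_zero, add_zero]
        exact hL

/-- With `P` the projection onto `Nᗮ`, the operator `P G P` is compact, and symmetric because `B`
is. Its eigenvectors for `ν ≠ 0` belong to the eigenvalue `1/ν` of `B`, those for `ν = 0` to the
kernel. -/
theorem exists_eigenbasis (hL : 0 < L) :
    ∃ (J : Type) (b : HilbertBasis J ℂ (L2 L)) (lam : J → ℝ), (∀ j, IsEigB L (lam j) (b j)) ∧
      ∀ M : ℝ, {j | |lam j| ≤ M}.Finite := by
  obtain ⟨N, G, hN, hNe, hGc, hG⟩ := exists_green_operator hL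
  set P := Nᗮ.starProjection with hP
  have hPm : ∀ f, P f ∈ Nᗮ := fun f => Submodule.starProjection_apply_mem _ f
  have hPf : ∀ f, f - P f ∈ N := fun f => by
    have := Submodule.sub_starProjection_mem_orthogonal (K := Nᗮ) f
    rwa [Submodule.orthogonal_orthogonal] at this
  have hT : IsCompactOperator (P ∘L G ∘L P) := (hGc.comp_clm P).clm_comp P
  have hs : ((P ∘L G ∘L P : L2 L →L[ℂ] L2 L) : L2 L →ₗ[ℂ] L2 L).IsSymmetric := by
    intro f g
    change inner ℂ (P (G (P f))) g = inner ℂ f (P (G (P g)))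
    rw [hP, Submodule.inner_starProjection_left_eq_right,
      ← Submodule.inner_starProjection_left_eq_right Nᗮ f, ← hP]
    have h := inner_refl_minusD hL (hG _ (hPm f)).1 (hG _ (hPm g)).1
    rw [(hG _ (hPm f)).2, (hG _ (hPm g)).2, map_neg, map_neg, refl_refl, refl_refl,
      inner_neg_left, inner_neg_right, neg_inj] at h
    exact h.symm
  obtain ⟨J, b, ν, hb, hfin⟩ := exists_hilbertBasis_eigenvectors hT hs
  -- If `P G P b = 0`, then `G P b` lies in `N`, so `B` annihilates it; but `B G P b = P b`.
  have h0 : ∀ j, ν j = 0 → b j ∈ N := by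
    intro j hj
    have h1 : P (G (P (b j))) = 0 := by
      have := hb j
      rw [hj, Complex.ofReal_zero, zero_smul] at this
      exact this
    have h2 := hPf (G (P (b j)))
    rw [h1, sub_zero] at h2
    have h3 := (hNe _ h2).2
    rw [(hG _ (hPm (b j))).2, Complex.ofReal_zero, zero_smul, neg_inj] at h3
    have h4 : P (b j) = 0 := by rw [← refl_refl (P (b j)), h3, map_zero]
    simpa [h4] using hPf (b j)
  have h1 : ∀ j, ν j ≠ 0 → IsEigB L (ν j)⁻¹ (b j) := by
    intro j hj
    have hj' : (ν j : ℂ) ≠ 0 := Complex.ofReal_ne_zero.mpr hj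
    have e1 : P (G (P (b j))) = (ν j : ℂ) • b j := hb j
    have e2 : b j = (ν j : ℂ)⁻¹ • P (G (P (b j))) := by rw [e1, inv_smul_smul₀ hj']
    have e3 : P (b j) = b j := by
      refine Submodule.starProjection_eq_self_iff.mpr ?_
      rw [e2]
      exact Submodule.smul_mem _ _ (hPm _)
    rw [e3] at e1
    have hGd := hG (b j) (by rw [← e3]; exact hPm _)
    -- `G b` itself need not be a multiple of `b`, but it differs from `ν b` by an element of the
    -- kernel of `B`.
    set n := G (b j) - P (G (b j)) with hn
    have hnN := hNe n (hPf _)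
    have e4 : b j = (ν j : ℂ)⁻¹ • (G (b j) + (-1 : ℂ) • n) := by
      rw [hn, neg_one_smul, neg_sub, add_sub_cancel, e1, inv_smul_smul₀ hj']
    have hm : G (b j) + (-1 : ℂ) • n ∈ compDomain L 0 :=
      add_mem hGd.1 (Submodule.smul_mem _ _ hnN.1)
    refine ⟨?_, ?_⟩
    · rw [e4]; exact Submodule.smul_mem _ _ hm
    · have e5 : minusD L (b j) = (ν j : ℂ)⁻¹ • minusD L (G (b j) + (-1 : ℂ) • n) := by
        rw [← minusD_smul _ hm.1, ← e4]
      rw [e5, minusD_add hGd.1.1 (hnN.1.1.smul _), minusD_smul _ hnN.1.1, hnN.2, hGd.2,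
        Complex.ofReal_zero, zero_smul, neg_zero, smul_zero, add_zero, smul_neg, Complex.ofReal_inv]
  have hfin0 : {j | ν j = 0}.Finite := by
    let v : {j | ν j = 0} → N := fun j => ⟨b j, h0 j j.2⟩
    have hv : LinearIndependent ℂ v := by
      refine LinearIndependent.of_comp N.subtype ?_
      exact b.orthonormal.linearIndependent.comp _ Subtype.val_injective
    have := hv.finite_of_isNoetherian
    exact Set.toFinite _
  -- The convention `0⁻¹ = 0` gives the right eigenvalue on the kernel.
  refine ⟨J, b, fun j => (ν j)⁻¹, fun j => ?_, fun M => ?_⟩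
  · by_cases hj : ν j = 0
    · simp only [hj, inv_zero]
      exact hNe _ (h0 j hj)
    · exact h1 j hj
  · refine (hfin0.union (hfin (|M| + 1)⁻¹ (by positivity))).subset fun j hj => ?_
    by_cases hν : ν j = 0
    · exact Or.inl hν
    · right
      have h2 : 0 < |ν j| := abs_pos.mpr hν
      simp only [Set.mem_ofPred_eq, abs_inv] at hj ⊢
      rw [inv_le_comm₀ (by positivity) h2]
      linarith [le_abs_self M]

end Green

/-! ### Labelling the eigenvalues by the integers -/

section Enumeration

variable {L : ℝ}

theorem exists_forall_etaL2_ne_zero (hL : 0 < L) : ∃ S, 2 ≤ S ∧ ∀ ξ, S < |ξ| → etaL2 L ξ ≠ 0 := by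
  have h : ∀ᶠ ξ in absTop, 0 < ‖etaL2 L ξ‖ :=
    (tendsto_norm_etaL2 hL).eventually (lt_mem_nhds (by positivity))
  rw [absTop, eventually_comap, eventually_atTop] at h
  obtain ⟨S, hS⟩ := h
  exact ⟨max 2 S, le_max_left _ _, fun ξ hξ =>
    norm_pos_iff.mp (hS _ ((le_max_right _ _).trans hξ.le) ξ rfl)⟩

theorem cube_sub_lt_cube_sub {s t : ℝ} (hs : 1 ≤ s) (h : s < t) : s ^ 3 - s < t ^ 3 - t := by
  nlinarith [mul_pos (sub_pos.mpr h) (by nlinarith : (0 : ℝ) < s ^ 2 + s * t + t ^ 2 - 1)]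

/-- `ε = ±1` selects the sign of `λ`. Each zero of `charH` is attained, since otherwise the nonzero
`etaL2` would be orthogonal to the whole basis; it is attained once, since the eigenspace is a line.
-/
theorem exists_enumeration (hL : 0 < L) {J : Type*} (b : HilbertBasis J ℂ (L2 L)) {lam : J → ℝ}
    (hb : ∀ j, IsEigB L (lam j) (b j)) {ε : ℝ} (hε : ε ^ 2 = 1) {S : ℝ} (hS : 2 ≤ S)
    (hne : ∀ ξ, S < |ξ| → etaL2 L ξ ≠ 0) {r : ℕ → ℝ}
    (hr : ∀ n, S < r n ∧ charH L (ε * r n) = 0)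
    (hr' : ∀ s, S < s → charH L (ε * s) = 0 → ∃ n, r n = s) (hinj : Function.Injective r) :
    ∃ φ : ℕ → J, Function.Injective φ ∧ (∀ n, lam (φ n) = ε * (r n ^ 3 - r n)) ∧
      ∀ j, S ^ 3 - S < ε * lam j → ∃ n, φ n = j := by
  have hε' : |ε| = 1 := by
    nlinarith [sq_abs ε, abs_nonneg ε]
  have habs : ∀ {s : ℝ}, 0 < s → |ε * s| = s := fun hs => by
    rw [abs_mul, hε', one_mul, abs_of_pos hs]
  have hcube : ∀ s : ℝ, (ε * s) ^ 3 - ε * s = ε * (s ^ 3 - s) := fun s => by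
    linear_combination ε * s ^ 3 * hε
  have hex : ∀ n, ∃ j, lam j = ε * (r n ^ 3 - r n) := by
    intro n
    have hp : |ε * r n| = r n := habs (by linarith [(hr n).1])
    have he := isEigB_etaL2 hL (ξ := ε * r n) (by rw [hp]; linarith [(hr n).1]) (hr n).2
    by_contra! hcon
    refine hne (ε * r n) (by rw [hp]; exact (hr n).1) (b.repr.injective ?_)
    rw [map_zero]
    ext j
    rw [HilbertBasis.repr_apply_apply, lp.coeFn_zero, Pi.zero_apply]
    exact (hb j).inner_eq_zero hL he (by rw [hcube]; exact hcon j)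
  choose φ hφ using hex
  refine ⟨φ, fun n m hnm => hinj ?_, hφ, fun j hj => ?_⟩
  · have h1 : ε * (r n ^ 3 - r n) = ε * (r m ^ 3 - r m) := by rw [← hφ, ← hφ, hnm]
    have hε0 : ε ≠ 0 := by rintro rfl; norm_num at hε
    have h2 := mul_left_cancel₀ hε0 h1
    rcases lt_trichotomy (r n) (r m) with h | h | h
    · linarith [cube_sub_lt_cube_sub (by linarith [(hr n).1]) h]
    · exact h
    · linarith [cube_sub_lt_cube_sub (by linarith [(hr m).1]) h]
  · have h6 : 6 ≤ S ^ 3 - S := by nlinarith [mul_nonneg (sub_nonneg.mpr hS) (sq_nonneg S)]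
    obtain ⟨s, hs, hst⟩ := exists_cubic_root (h6.trans hj.le)
    have hSs : S < s := by
      by_contra! h
      rcases h.eq_or_lt with h | h
      · rw [h] at hst; linarith
      · linarith [cube_sub_lt_cube_sub (by linarith) h]
    have hp : |ε * s| = s := habs (by linarith)
    have hlam : lam j = (ε * s) ^ 3 - ε * s := by
      rw [hcube, ← hst]; linear_combination -lam j * hε
    have hj' := hb j
    rw [hlam] at hj'
    obtain ⟨A, hA, hA', -⟩ := hj'.eq_smul_etaL2 hL (by rw [hp]; exact hs)
    have hb0 : ∀ j, b j ≠ 0 := fun j h => by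
      have := b.orthonormal.1 j
      rw [h, norm_zero] at this
      exact zero_ne_one this
    have hA0 : A ≠ 0 := by
      rintro rfl
      exact hb0 j (by rw [hA, zero_smul])
    have hc : charH L (ε * s) = 0 := by
      have := (mul_eq_zero.mp hA').resolve_left hA0
      exact_mod_cast this
    obtain ⟨n, rfl⟩ := hr' s hSs hc
    refine ⟨n, ?_⟩
    have hn := hb (φ n)
    rw [hφ, ← hcube] at hn
    obtain ⟨B, hB, -⟩ := hn.eq_smul_etaL2 hL (by rw [hp]; exact hs)
    have hB0 : B ≠ 0 := by
      rintro rfl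
      exact hb0 (φ n) (by rw [hB, zero_smul])
    by_contra hne'
    have h0 := b.orthonormal.2 hne'
    simp only at h0
    rw [hA, hB, inner_smul_left, inner_smul_right] at h0
    have h1 : inner ℂ (etaL2 L (ε * r n)) (etaL2 L (ε * r n)) ≠ 0 :=
      inner_self_ne_zero.mpr (hne _ (by rw [hp]; exact hSs))
    exact mul_ne_zero ((map_ne_zero _).mpr hB0) (mul_ne_zero hA0 h1) h0

/-- The `d` leftover indices go to `0, …, d - 1`, followed by `φ₁`, while `φ₂` fills the negative
integers. -/
theorem exists_int_equiv {J : Type*} {φ₁ φ₂ : ℕ → J} (h₁ : Function.Injective φ₁)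
    (h₂ : Function.Injective φ₂) (hd : ∀ n m, φ₁ n ≠ φ₂ m)
    (hf : {j | (∀ n, φ₁ n ≠ j) ∧ ∀ n, φ₂ n ≠ j}.Finite) :
    ∃ (d : ℕ) (ψ : ℤ ≃ J), (∀ n : ℕ, ψ (n + d) = φ₁ n) ∧ ∀ n : ℕ, ψ (-n - 1) = φ₂ n := by
  have := hf.fintype
  let e := Fintype.equivFin {j | (∀ n, φ₁ n ≠ j) ∧ ∀ n, φ₂ n ≠ j}
  set d := Fintype.card {j | (∀ n, φ₁ n ≠ j) ∧ ∀ n, φ₂ n ≠ j}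
  let g : (Fin d ⊕ ℕ) ⊕ ℕ → J := Sum.elim (Sum.elim (fun i => (e.symm i : J)) φ₁) φ₂
  have hg : Function.Bijective g := by
    refine ⟨?_, fun j => ?_⟩
    · refine Function.Injective.sumElim (Function.Injective.sumElim
        (Subtype.val_injective.comp e.symm.injective) h₁ fun i n => ?_) h₂ ?_
      · exact ((e.symm i).2.1 n).symm
      · rintro (i | n) m
        · exact ((e.symm i).2.2 m).symm
        · exact hd n m
    · by_cases hj : (∀ n, φ₁ n ≠ j) ∧ ∀ n, φ₂ n ≠ j
      · exact ⟨Sum.inl (Sum.inl (e ⟨j, hj⟩)), by simp [g]⟩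
      · rw [not_and_or] at hj
        push Not at hj
        rcases hj with ⟨n, hn⟩ | ⟨n, hn⟩
        · exact ⟨Sum.inl (Sum.inr n), hn⟩
        · exact ⟨Sum.inr n, hn⟩
  let σ : ℤ ≃ (Fin d ⊕ ℕ) ⊕ ℕ :=
    Equiv.intEquivNatSumNat.trans ((finSumNatEquiv d).symm.sumCongr (Equiv.refl ℕ))
  refine ⟨d, σ.trans (Equiv.ofBijective g hg), fun n => ?_, fun n => ?_⟩
  · have : ((n : ℤ) + d) = σ.symm (Sum.inl (Sum.inr n)) := by
      change ((n : ℤ) + d) = ((d + n : ℕ) : ℤ)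
      push_cast; ring
    rw [Equiv.trans_apply, this, Equiv.apply_symm_apply]
    rfl
  · have : (-(n : ℤ) - 1) = σ.symm (Sum.inr n) := by
      change (-(n : ℤ) - 1) = Int.negSucc n
      rw [Int.negSucc_eq]; ring
    rw [Equiv.trans_apply, this, Equiv.apply_symm_apply]
    rfl

/-- The dominant term `3c²(r - c)` has size `N² · N⁻¹`, so an error `O(1/N)` in the root costs
`O(N)` in the cube. -/
theorem abs_cube_sub_sub_cube_le {r c K Q : ℝ} {N : ℝ} (hN : 1 ≤ N) (hr : |r - c| ≤ K / N)
    (hc : |c| ≤ Q * N) :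
    |r ^ 3 - r - c ^ 3| ≤ (3 * Q ^ 2 * K + 3 * Q * K ^ 2 + K ^ 3 + Q + K) * N := by
  have hN0 : 0 < N := by linarith
  have hK : 0 ≤ K := by
    have := (abs_nonneg _).trans hr
    by_contra! h
    linarith [div_neg_of_neg_of_pos h hN0]
  have hQ : 0 ≤ Q := by
    have := (abs_nonneg _).trans hc
    by_contra! h
    linarith [mul_neg_of_neg_of_pos h hN0]
  set δ := r - c with hδ
  have hδ1 : |δ| ≤ K := hr.trans (div_le_self hK hN)
  have hδN : |δ| * N ≤ K := by rwa [le_div_iff₀ hN0] at hr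
  have e : r ^ 3 - r - c ^ 3 = 3 * c ^ 2 * δ + 3 * c * δ ^ 2 + δ ^ 3 - c - δ := by
    rw [hδ]; ring
  have h1 : |r ^ 3 - r - c ^ 3| ≤ 3 * |c| ^ 2 * |δ| + 3 * |c| * |δ| ^ 2 + |δ| ^ 3 + |c| + |δ| := by
    rw [e]
    refine (abs_sub _ _).trans ?_
    gcongr
    refine (abs_sub _ _).trans ?_
    gcongr
    refine (abs_add_three _ _ _).trans (le_of_eq ?_)
    simp [abs_mul, abs_pow]
  have a0 := abs_nonneg δ
  have b0 := abs_nonneg c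
  have t1 : |c| ^ 2 * |δ| ≤ Q ^ 2 * K * N := by
    calc |c| ^ 2 * |δ| ≤ (Q * N) ^ 2 * |δ| := by gcongr
      _ = Q ^ 2 * N * (|δ| * N) := by ring
      _ ≤ Q ^ 2 * N * K := by gcongr
      _ = Q ^ 2 * K * N := by ring
  have t2 : |c| * |δ| ^ 2 ≤ Q * K ^ 2 * N := by
    calc |c| * |δ| ^ 2 ≤ (Q * N) * K ^ 2 := by gcongr
      _ = Q * K ^ 2 * N := by ring
  have t3 : |δ| ^ 3 ≤ K ^ 3 * N := by
    calc |δ| ^ 3 ≤ K ^ 3 := by gcongr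
      _ ≤ K ^ 3 * N := le_mul_of_one_le_right (by positivity) hN
  have t4 : |δ| ≤ K * N := hδ1.trans (le_mul_of_one_le_right hK hN)
  linarith

theorem abs_cube_sub_sub_cube_root_le {l θ K : ℝ} (m₀ : ℤ) {r : ℕ → ℝ}
    (hr : ∀ n : ℕ, |r n - (θ + Real.pi * (m₀ + n)) / l| ≤ K / (n + 1)) :
    ∃ C, 0 ≤ C ∧
      ∀ n : ℕ, |r n ^ 3 - r n - ((θ + Real.pi * (m₀ + n)) / l) ^ 3| ≤ C * (n + 1) := by
  have h : ∀ n : ℕ, |(θ + Real.pi * (m₀ + n)) / l| ≤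
      ((|θ| + Real.pi * (|(m₀ : ℝ)| + 1)) / |l|) * (n + 1) := by
    intro n
    rw [abs_div, div_mul_eq_mul_div]
    gcongr
    have hn : (0 : ℝ) ≤ n := n.cast_nonneg
    have hpi := Real.pi_pos
    have h1 : |(m₀ : ℝ) + n| ≤ |(m₀ : ℝ)| + n := (abs_add_le _ _).trans (by rw [abs_of_nonneg hn])
    calc |θ + Real.pi * (m₀ + n)| ≤ |θ| + |Real.pi * (m₀ + n)| := abs_add_le _ _
      _ = |θ| + Real.pi * |(m₀ : ℝ) + n| := by rw [abs_mul, abs_of_pos hpi]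
      _ ≤ |θ| + Real.pi * (|(m₀ : ℝ)| + n) := by gcongr
      _ ≤ _ := by
        have e1 : 0 ≤ |θ| * n := by positivity
        have e2 : 0 ≤ Real.pi * (|(m₀ : ℝ)| * n) := by positivity
        linarith
  have hC := fun n : ℕ => abs_cube_sub_sub_cube_le (N := (n : ℝ) + 1)
    (by linarith [n.cast_nonneg (α := ℝ)]) (hr n) (h n)
  refine ⟨_, ?_, hC⟩
  have := (abs_nonneg _).trans (hC 0)
  simpa using this

theorem hasSpectralAsymptotics_of_enumeration {lam : ℤ → ℝ} {r₁ r₂ : ℕ → ℝ} {m₁ m₂ : ℤ}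
    {K₁ K₂ : ℝ} {d : ℕ}
    (h₁ : ∀ n : ℕ, |r₁ n - (Real.pi / 12 + Real.pi * (m₁ + n)) / (L / 2)| ≤ K₁ / (n + 1))
    (h₂ : ∀ n : ℕ, |r₂ n - (-(5 * Real.pi / 12) + Real.pi * (m₂ + n)) / (L / 2)| ≤ K₂ / (n + 1))
    (hl₁ : ∀ n : ℕ, lam (n + d) = r₁ n ^ 3 - r₁ n)
    (hl₂ : ∀ n : ℕ, lam (-n - 1) = -(r₂ n ^ 3 - r₂ n)) : HasSpectralAsymptotics L lam := by
  obtain ⟨C₁, hC₁0, hC₁⟩ := abs_cube_sub_sub_cube_root_le m₁ h₁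
  obtain ⟨C₂, hC₂0, hC₂⟩ := abs_cube_sub_sub_cube_root_le m₂ h₂
  -- The shift `d` is that of the labelling. The shift `2` is `1` from `-5π/12 = 7π/12 - π` plus `1`
  -- from the label `-n - 1`.
  refine ⟨m₁ - d, m₂ - 2, ?_, ?_⟩
  · refine Asymptotics.IsBigO.of_bound (2 * C₁) ?_
    filter_upwards [eventually_ge_atTop ((d : ℤ) + 1)] with m hm
    obtain ⟨n, rfl⟩ : ∃ n : ℕ, m = n + d := ⟨(m - d).toNat, by omega⟩
    have hn : (1 : ℝ) ≤ n + d := by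
      have : (1 : ℤ) ≤ n + d := by omega
      exact_mod_cast this
    have e : (Real.pi + 12 * Real.pi * (((m₁ - d : ℤ) : ℝ) + ((n + d : ℤ) : ℝ))) / (6 * L) =
        (Real.pi / 12 + Real.pi * (m₁ + n)) / (L / 2) := by
      push_cast
      rcases eq_or_ne L 0 with rfl | hL
      · simp
      · field_simp
        ring
    rw [hl₁, e, Real.norm_eq_abs, Real.norm_eq_abs]
    refine (hC₁ n).trans ?_
    push_cast
    rw [abs_of_nonneg (by linarith : (0 : ℝ) ≤ n + d), mul_comm 2 C₁, mul_assoc]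
    gcongr
    have : (0 : ℝ) ≤ d := d.cast_nonneg
    linarith
  · refine Asymptotics.IsBigO.of_bound C₂ ?_
    filter_upwards [eventually_le_atBot (-1 : ℤ)] with m hm
    obtain ⟨n, rfl⟩ : ∃ n : ℕ, m = -n - 1 := ⟨(-m - 1).toNat, by omega⟩
    have e : (7 * Real.pi + 12 * Real.pi * (((m₂ - 2 : ℤ) : ℝ) - ((-n - 1 : ℤ) : ℝ))) / (6 * L) =
        (-(5 * Real.pi / 12) + Real.pi * (m₂ + n)) / (L / 2) := by
      push_cast
      rcases eq_or_ne L 0 with rfl | hL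
      · simp
      · field_simp
        ring
    rw [hl₂, e, Real.norm_eq_abs, Real.norm_eq_abs]
    have e2 : |((-n - 1 : ℤ) : ℝ)| = n + 1 := by
      have hn : (0 : ℝ) ≤ n := n.cast_nonneg
      push_cast
      rw [abs_of_nonpos (by linarith)]
      ring
    rw [e2, sub_neg_eq_add, ← abs_neg, neg_add, neg_neg, ← sub_eq_add_neg]
    exact hC₂ n

theorem exists_eigenbasis_int (hL : 0 < L) : ∃ (e : ℤ → L2 L) (lam : ℤ → ℝ), Orthonormal ℂ e ∧
    (∀ p, (∀ n, inner ℂ (e n) p = 0) → p = 0) ∧ (∀ n, IsEigB L (lam n) (e n)) ∧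
      HasSpectralAsymptotics L lam := by
  obtain ⟨J, b, lam, hb, hfin⟩ := exists_eigenbasis hL
  obtain ⟨S₀, hS₀, hne⟩ := exists_forall_etaL2_ne_zero hL
  have hl : 0 < L / 2 := by positivity
  obtain ⟨S₁, m₁, r₁, K₁, hS₁, hr₁, hr₁', hi₁, hK₁⟩ := exists_roots hl (smallAtTop_charH_pos hL) S₀
  obtain ⟨S₂, m₂, r₂, K₂, hS₂, hr₂, hr₂', hi₂, hK₂⟩ := exists_roots hl (smallAtTop_charH_neg hL) S₀
  obtain ⟨φ₁, hφ₁, hlam₁, hsurj₁⟩ := exists_enumeration hL b hb (ε := 1) (by norm_num)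
    (hS₀.trans hS₁) (fun ξ hξ => hne ξ (hS₁.trans_lt hξ)) (by simpa using hr₁)
    (by simpa using hr₁') hi₁
  obtain ⟨φ₂, hφ₂, hlam₂, hsurj₂⟩ := exists_enumeration hL b hb (ε := -1) (by norm_num)
    (hS₀.trans hS₂) (fun ξ hξ => hne ξ (hS₂.trans_lt hξ)) (by simpa using hr₂)
    (by simpa using hr₂') hi₂
  have hpos : ∀ {s : ℝ}, 2 ≤ s → 0 < s ^ 3 - s := fun hs => by
    have := cube_sub_lt_cube_sub (s := 1) le_rfl (by linarith : (1 : ℝ) < _)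
    linarith
  have hd : ∀ n m, φ₁ n ≠ φ₂ m := by
    intro n m h
    have h1 := hlam₁ n
    rw [h, hlam₂ m] at h1
    linarith [hpos (hS₀.trans (hS₁.trans (hr₁ n).1.le)), hpos (hS₀.trans (hS₂.trans (hr₂ m).1.le))]
  -- An index missed by both enumerations has `|λ|` below a fixed bound, and there are finitely many
  -- of those.
  obtain ⟨d, ψ, hψ₁, hψ₂⟩ := exists_int_equiv hφ₁ hφ₂ hd (by
    refine (hfin (max (S₁ ^ 3 - S₁) (S₂ ^ 3 - S₂))).subset fun j hj => ?_
    have h1 : 1 * lam j ≤ S₁ ^ 3 - S₁ := by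
      by_contra! h
      obtain ⟨n, hn⟩ := hsurj₁ j h
      exact hj.1 n hn
    have h2 : -1 * lam j ≤ S₂ ^ 3 - S₂ := by
      by_contra! h
      obtain ⟨n, hn⟩ := hsurj₂ j h
      exact hj.2 n hn
    exact abs_le'.mpr ⟨(by linarith : lam j ≤ S₁ ^ 3 - S₁).trans (le_max_left _ _),
      (by linarith : -lam j ≤ S₂ ^ 3 - S₂).trans (le_max_right _ _)⟩)
  refine ⟨b ∘ ψ, lam ∘ ψ, b.orthonormal.comp _ ψ.injective, fun p hp => ?_, fun n => hb _,
    hasSpectralAsymptotics_of_enumeration hK₁ hK₂ (d := d) (fun n => ?_) (fun n => ?_)⟩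
  · refine b.repr.injective ?_
    rw [map_zero]
    ext j
    rw [HilbertBasis.repr_apply_apply, lp.coeFn_zero, Pi.zero_apply]
    have := hp (ψ.symm j)
    rwa [Function.comp_apply, Equiv.apply_symm_apply] at this
  · rw [Function.comp_apply, hψ₁, hlam₁, one_mul]
  · rw [Function.comp_apply, hψ₂, hlam₂, neg_one_mul]

end Enumeration

/-! ### From the scalar eigenbasis to the eigenbasis of `A` -/

section ProductBasis

variable {L : ℝ}

/-- The vector `(f, s • f(L - ·)) / √2` of `X₀`. -/
def pairVec (s : ℂ) (f : L2 L) : X0 L :=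
  WithLp.toLp 2 (((√2)⁻¹ : ℂ) • f, s • refl L (((√2)⁻¹ : ℂ) • f))

/-- For `s, t ∈ {i, -i}` the factor is `1` if `s = t` and `0` otherwise, which is the orthonormality
of the doubled family. -/
theorem inner_pairVec (s t : ℂ) (f g : L2 L) : inner ℂ (pairVec s f) (pairVec t g) =
    (1 + (starRingEnd ℂ) s * t) / 2 * inner ℂ f g := by
  have h2 : ((√2 : ℝ) : ℂ)⁻¹ * ((√2 : ℝ) : ℂ)⁻¹ = 1 / 2 := by
    rw [← mul_inv, ← Complex.ofReal_mul, Real.mul_self_sqrt (by norm_num)]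
    simp
  rw [WithLp.prod_inner_apply]
  simp only [pairVec]
  rw [inner_smul_left, inner_smul_right, inner_smul_left, inner_smul_right,
    LinearIsometry.inner_map_map, inner_smul_left, inner_smul_right, map_inv₀, Complex.conj_ofReal]
  linear_combination (1 + (starRingEnd ℂ) s * t) * inner ℂ f g * h2

theorem inner_pairVec_left (s : ℂ) (f : L2 L) (p : X0 L) : inner ℂ (pairVec s f) p =
    ((√2)⁻¹ : ℂ) * (inner ℂ f p.fst + (starRingEnd ℂ) s * inner ℂ f (refl L p.snd)) := by
  rw [WithLp.prod_inner_apply]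
  simp only [pairVec]
  rw [map_smul, inner_smul_left, inner_smul_left, inner_smul_left, inner_refl, map_inv₀,
    Complex.conj_ofReal]
  change _ = ((√2)⁻¹ : ℂ) * (inner ℂ f p.ofLp.1 + (starRingEnd ℂ) s * inner ℂ f (refl L p.ofLp.2))
  ring

theorem exists_hilbertBasis_pairVec {ι : Type*} {e : ι → L2 L} (he : Orthonormal ℂ e)
    (ht : ∀ p, (∀ n, inner ℂ (e n) p = 0) → p = 0) :
    ∃ b : HilbertBasis (ι ⊕ ι) ℂ (X0 L), (∀ n, b (Sum.inl n) = pairVec Complex.I (e n)) ∧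
      ∀ n, b (Sum.inr n) = pairVec (-Complex.I) (e n) := by
  let v : ι ⊕ ι → X0 L := Sum.elim (fun n => pairVec Complex.I (e n))
    (fun n => pairVec (-Complex.I) (e n))
  have hn : ∀ (s : ℂ) (n : ι), (starRingEnd ℂ) s * s = 1 → ‖pairVec s (e n)‖ = 1 := by
    intro s n hs
    have h := inner_pairVec s s (e n) (e n)
    rw [hs, inner_self_eq_norm_sq_to_K, inner_self_eq_norm_sq_to_K, he.1] at h
    have h' : ‖pairVec s (e n)‖ ^ 2 = 1 := by
      have : ((‖pairVec s (e n)‖ ^ 2 : ℝ) : ℂ) = 1 := by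
        push_cast
        refine h.trans ?_
        norm_num
      exact_mod_cast this
    nlinarith [norm_nonneg (pairVec s (e n))]
  have hv : Orthonormal ℂ v := by
    refine ⟨?_, ?_⟩
    · rintro (n | n)
      · exact hn _ _ (by simp)
      · exact hn _ _ (by simp)
    · rintro (n | n) (m | m) hnm
      · have := he.2 (i := n) (j := m) (fun h => hnm (congrArg _ h))
        exact (inner_pairVec _ _ _ _).trans (by rw [this, mul_zero])
      · exact (inner_pairVec _ _ _ _).trans (by simp)
      · exact (inner_pairVec _ _ _ _).trans (by simp)
      · have := he.2 (i := n) (j := m) (fun h => hnm (congrArg _ h))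
        exact (inner_pairVec _ _ _ _).trans (by rw [this, mul_zero])
  have hbot : (Submodule.span ℂ (Set.range v))ᗮ = ⊥ := by
    rw [Submodule.eq_bot_iff]
    intro p hp
    have hc : ((√2)⁻¹ : ℂ) ≠ 0 := by simp
    have h1 : ∀ n, inner ℂ (e n) p.fst - Complex.I * inner ℂ (e n) (refl L p.snd) = 0 := fun n => by
      have h := (Submodule.mem_orthogonal _ _).mp hp _ (Submodule.subset_span ⟨Sum.inl n, rfl⟩)
      have h' := (mul_eq_zero.mp ((inner_pairVec_left _ _ _).symm.trans h)).resolve_left hc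
      rw [Complex.conj_I] at h'
      linear_combination h'
    have h2 : ∀ n, inner ℂ (e n) p.fst + Complex.I * inner ℂ (e n) (refl L p.snd) = 0 := fun n => by
      have h := (Submodule.mem_orthogonal _ _).mp hp _ (Submodule.subset_span ⟨Sum.inr n, rfl⟩)
      have h' := (mul_eq_zero.mp ((inner_pairVec_left _ _ _).symm.trans h)).resolve_left hc
      rw [map_neg, Complex.conj_I, neg_neg] at h'
      exact h'
    have h3 : p.fst = 0 := ht _ fun n => by linear_combination (h1 n + h2 n) / 2
    have h4 : refl L p.snd = 0 := ht _ fun n => by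
      have := h2 n
      rw [h3, inner_zero_right, zero_add] at this
      exact (mul_eq_zero.mp this).resolve_left Complex.I_ne_zero
    have h5 : p.snd = 0 := by rw [← refl_refl p.snd, h4, map_zero]
    exact WithLp.ofLp_injective 2 (Prod.ext h3 h5)
  exact ⟨HilbertBasis.mkOfOrthogonalEqBot hv hbot,
    fun n => by rw [HilbertBasis.coe_mkOfOrthogonalEqBot]; rfl,
    fun n => by rw [HilbertBasis.coe_mkOfOrthogonalEqBot]; rfl⟩

theorem exists_isEigenbasis (hL : 0 < L) :
    ∃ (lam : ℤ → ℝ) (b : HilbertBasis (ℤ ⊕ ℤ) ℂ (X0 L)), IsEigenbasis L lam b := by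
  obtain ⟨e, lam, he, ht, heig, has⟩ := exists_eigenbasis_int hL
  obtain ⟨b, hb1, hb2⟩ := exists_hilbertBasis_pairVec he ht
  refine ⟨lam, b, fun n => ?_, fun n => ?_, has⟩
  · rw [hb1]
    exact ((heig n).smul _).isEigenvectorA _ Complex.I_mul_I
  · rw [hb2, ← neg_mul]
    exact ((heig n).smul _).isEigenvectorA _ (by simp)

theorem tendsto_abs_trace_of_isEigenbasis (hL : 0 < L) {lam : ℤ → ℝ}
    {b : HilbertBasis (ℤ ⊕ ℤ) ℂ (X0 L)} (h : IsEigenbasis L lam b) {e : ℤ → X0 L}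
    (he : (∀ n, e n = b (Sum.inl n)) ∨ ∀ n, e n = b (Sum.inr n)) :
    Tendsto (fun n : ℤ => ‖trace L (weakDeriv L (e n).fst) L‖ / |(n : ℝ)|) absTopInt
        (𝓝 (2 * Real.pi / L * (√3 / √(L / 2) / √2))) ∧
      Tendsto (fun n : ℤ => ‖trace L (weakDeriv L (e n).snd) 0‖ / |(n : ℝ)|) absTopInt
        (𝓝 (2 * Real.pi / L * (√3 / √(L / 2) / √2))) := by
  have ha : 0 < 2 * Real.pi / L := by have := Real.pi_pos; positivity
  have hlam := h.asymp.tendsto_abs hL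
  rcases he with he | he
  · refine tendsto_trace hL ha hlam (fun n => ?_) (fun n => ?_)
    · rw [he]; exact b.orthonormal.1 _
    · rw [he]; exact h.eigen_pos n
  -- The family for `-iλ` is treated as the family for `+i` with `-λ`.
  · refine tendsto_trace hL ha (lam := fun n => -lam n) (by simpa using hlam) (fun n => ?_)
      (fun n => ?_)
    · rw [he]; exact b.orthonormal.1 _
    · rw [he, Complex.ofReal_neg, mul_neg]; exact h.eigen_neg n

end ProductBasis

end KdVKdV

end

/-! ### The main theorem -/

open KdVKdV in
theorem proposition3p2 (L : ℝ) (hL : 0 < L) :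
    (∃ (lam : ℤ → ℝ) (b : HilbertBasis (ℤ ⊕ ℤ) ℂ (X0 L)), IsEigenbasis L lam b) ∧
    ∃ C₁p C₁m C₂p C₂m : ℝ, 0 < C₁p ∧ 0 < C₁m ∧ 0 < C₂p ∧ 0 < C₂m ∧
      ∀ (lam : ℤ → ℝ) (b : HilbertBasis (ℤ ⊕ ℤ) ℂ (X0 L)), IsEigenbasis L lam b →
        Tendsto (fun n : ℤ => ‖trace L (weakDeriv L (b (Sum.inl n)).fst) L‖ / |(n : ℝ)|)
          (comap (fun n : ℤ => |n|) atTop) (𝓝 C₁p) ∧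
        Tendsto (fun n : ℤ => ‖trace L (weakDeriv L (b (Sum.inr n)).fst) L‖ / |(n : ℝ)|)
          (comap (fun n : ℤ => |n|) atTop) (𝓝 C₁m) ∧
        Tendsto (fun n : ℤ => ‖trace L (weakDeriv L (b (Sum.inl n)).snd) 0‖ / |(n : ℝ)|)
          (comap (fun n : ℤ => |n|) atTop) (𝓝 C₂p) ∧
        Tendsto (fun n : ℤ => ‖trace L (weakDeriv L (b (Sum.inr n)).snd) 0‖ / |(n : ℝ)|)
          (comap (fun n : ℤ => |n|) atTop) (𝓝 C₂m) := by
  have hpos : 0 < 2 * Real.pi / L * (√3 / √(L / 2) / √2) := by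
    have := Real.pi_pos
    positivity
  -- All four constants are `2π√3 / L^(3/2)`.
  refine ⟨exists_isEigenbasis hL, _, _, _, _, hpos, hpos, hpos, hpos, fun lam b h => ?_⟩
  have h1 := tendsto_abs_trace_of_isEigenbasis hL h (Or.inl fun n => rfl)
  have h2 := tendsto_abs_trace_of_isEigenbasis hL h (Or.inr fun n => rfl)
  exact ⟨h1.1, h2.1, h1.2, h2.2⟩
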